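/- A Boolean algebra here is a relatively complemented distributive lattice $(\mathcal B,\cup,\cap,\setminus,\emptyset)$ with least element $\emptyset$ (a greatest element is not required). A Boolean dynamical system $(\mathcal B,\mathcal L,\theta)$ consists of a Boolean algebra $\mathcal B$, a set $\mathcal L$ and Boolean homomorphisms $\theta_a:\mathcal B\to\mathcal B$ ($a\in\mathcal L$) with $\theta_a(\emptyset)=\emptyset$ such that, for every nonempty word $\alpha=a_1\cdots a_n$ in $\mathcal L$, with $\theta_\alpha=\theta_{a_n}\circ\cdots\circ\theta_{a_1}$, the set $\{\theta_\alpha(A):A\in\mathcal B\}$ has a least upper bound $\mathcal R_\alpha$ and $\mathcal R_\alpha=\theta_\alpha(\mathcal D_\alpha)$ for some $\mathcal D_\alpha\in\mathcal B$. For the empty word put $\theta_\emptyset=\mathrm{id}$, and read $A\subseteq\mathcal R_\emptyset$ as true for all $A\in\mathcal B$. Let $\Delta_A=\{a\in\mathcal L:\theta_a(A)\neq\emptyset\}$; the set $A$ is regular if $0<|\Delta_B|<\infty$ for every $\emptyset\ne B\subseteq A$ (so $\emptyset$ is regular). The Cuntz–Krieger relations for families $p_A$ ($A\in\mathcal B$),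 $s_a$, $s_a^*$ ($a\in\mathcal L$) are: $p_\emptyset=0$, $p_{A\cap B}=p_Ap_B$, $p_{A\cup B}=p_A+p_B-p_{A\cap B}$; $s_as_a^*s_a=s_a$ and $s_a^*s_as_a^*=s_a^*$; $p_As_a=s_ap_{\theta_a(A)}$ and $s_a^*p_A=p_{\theta_a(A)}s_a^*$; $s_a^*s_b=\delta_{a,b}\,p_{\mathcal R_a}$; and $p_A=\sum_{a\in\Delta_A}s_ap_{\theta_a(A)}s_a^*$ for every regular $A$. Let $C^*(\mathcal B,\mathcal L,\theta)$ be the C*-algebra generated by a universal Cuntz–Krieger representation (the $p_A$ being projections and $s_a^*$ the adjoint of $s_a$), write $s_\alpha=s_{a_1}\cdots s_{a_n}$, and let $$T=\{s_\alpha p_As_\beta^*:\alpha,\beta\in\mathcal L^*,\ A\in\mathcal B,\ A\subseteq\mathcal R_\alpha\cap\mathcal R_\beta\}\cup\{0\}\subseteq C^*(\mathcal B,\mathcal L,\theta),$$ where $\mathcal L^*$ is the set of all finite words; $T$ is an inverse semigroup with zero. Let $\mathcal G_{tight}(T)$ be its tight groupoid, i.e. the topological groupoid of germs $[t,\xi]$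 of the action of $T$ on the space of tight filters of its semilattice of idempotents; for an idempotent $e$ let $\operatorname{Dom}(e)$ be the set of the tight filters that contain $e$, and let $\Theta(t,\operatorname{Dom}(t^*t))=\{[t,\xi]:\xi\in\operatorname{Dom}(t^*t)\}$. Let $R$ be a commutative ring with unit. The Steinberg algebra $A_R(\mathcal G_{tight}(T))$ is the set of the locally constant, compactly supported functions $\mathcal G_{tight}(T)\to R$, with the convolution product $(fg)(\gamma)=\sum_{\gamma_1\gamma_2=\gamma}f(\gamma_1)g(\gamma_2)$. Finally let $R(\mathcal B,\mathcal L,\theta)$ be the (not necessarily unital) $R$-algebra with generators $p_A$, $s_a$, $s_a^*$ ($A\in\mathcal B$, $a\in\mathcal L$) and the Cuntz–Krieger relations. **Theorem 7.1.** For every Boolean dynamical system $(\mathcal B,\mathcal L,\theta)$ and every commutative ring $R$ with unit, $A_R(\mathcal G_{tight}(T))$ is closed under convolution, the characteristic functions below belong to it, and there is a unique isomorphism of $R$-algebras $$\tau:A_R(\mathcal G_{tight}(T))\to R(\mathcal B,\mathcal L,\theta)$$ such that, for all $a\in\mathcal L$ and $A\in\mathcal B$, $$\tau\big(1_{\Theta(s_a,\operatorname{Dom}(s_a^*s_a))}\big)=s_a,\qquad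 \tau\big(1_{\Theta(s_a^*,\operatorname{Dom}(s_as_a^*))}\big)=s_a^*,\qquad \tau\big(1_{\Theta(p_A,\operatorname{Dom}(p_A))}\big)=p_A.$$ -/

import Mathlib

open scoped ENNReal

universe u v w

/-! ## Boolean dynamical systems -/

/-- A Boolean dynamical system `(B, L, θ)`. A Boolean algebra here is a relatively complemented
distributive lattice with a least element; it need not have a greatest one. Every `θ a` is a
Boolean homomorphism (relative complements are then preserved, see `map_sdiff`), and for each
nonempty word `α = a₁ ⋯ aₙ` the composite `θ_α = θ_{aₙ} ∘ ⋯ ∘ θ_{a₁}` has compact range and closed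
domain: the least upper bound of `{θ_α(A) : A ∈ B}` exists and is itself of the form `θ_α(D)`. -/
structure BooleanDynamicalSystem (B : Type u) (L : Type v) [GeneralizedBooleanAlgebra B] where
  θ : L → B → B
  map_bot : ∀ a, θ a ⊥ = ⊥
  map_sup : ∀ a X Y, θ a (X ⊔ Y) = θ a X ⊔ θ a Y
  map_inf : ∀ a X Y, θ a (X ⊓ Y) = θ a X ⊓ θ a Y
  exists_domain : ∀ α : List L, α ≠ [] → ∃ E : B,
    IsLUB (Set.range fun X => α.foldl (fun Y a => θ a Y) X) (α.foldl (fun Y a => θ a Y) E)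

namespace BooleanDynamicalSystem

variable {B : Type u} {L : Type v} [GeneralizedBooleanAlgebra B] (D : BooleanDynamicalSystem B L)

theorem map_sdiff (a : L) (X Y : B) : D.θ a (X \ Y) = D.θ a X \ D.θ a Y := by
  refine (sdiff_unique ?_ ?_).symm
  · rw [← D.map_inf, ← D.map_sup, sup_inf_sdiff]
  · rw [← D.map_inf, ← D.map_inf, inf_inf_sdiff, D.map_bot]

/-- The action `θ_α` of a word `α`, with `θ_∅ = id`. -/
def act (α : List L) (X : B) : B := α.foldl (fun Y a => D.θ a Y) X

open Classical in
/-- `R_α`, the least upper bound of `{θ_α(A) : A ∈ B}`, for a nonempty word `α`.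
(The value at the empty word is irrelevant and never used.) -/
noncomputable def rng (α : List L) : B :=
  if h : α ≠ [] then D.act α (D.exists_domain α h).choose else ⊥

theorem isLUB_rng {α : List L} (h : α ≠ []) : IsLUB (Set.range (D.act α)) (D.rng α) := by
  have := (D.exists_domain α h).choose_spec
  rw [rng, dif_pos h]
  exact this

/-- The relation `A ⊆ R_α`. For the empty word it holds for all `A`, according to the convention
that `R_∅` is the formal union of all elements of `B`. -/
def Below (α : List L) (X : B) : Prop := α ≠ [] → X ≤ D.rng α

/-- `Δ_A`, the set of all letters `a` with `θ_a(A) ≠ ∅`. -/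
def letters (X : B) : Set L := {a | D.θ a X ≠ ⊥}

/-- Regular sets: `0 < |Δ_Y| < ∞` for every nonempty `Y ⊆ X`. The empty set is regular. -/
def IsRegular (X : B) : Prop :=
  ∀ Y, Y ≠ ⊥ → Y ≤ X → (D.letters Y).Nonempty ∧ (D.letters Y).Finite

/-! ### Cuntz-Krieger families -/

/-- The Cuntz-Krieger relations of a Boolean dynamical system for families `P_A`, `S_a`, and `Sd_a`
(playing the part of `S_a^*`) in a ring that need not have a unit. Since no involution is assumed,
the adjoints of those relations that are not self-adjoint are listed too; in a `*`-algebra, with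
`Sd_a = S_a^*` and `P_A^* = P_A`, they are redundant. -/
structure IsCKFamily {A : Type*} [NonUnitalRing A] (P : B → A) (S Sd : L → A) : Prop where
  bot : P ⊥ = 0
  inf : ∀ X Y, P (X ⊓ Y) = P X * P Y
  sup : ∀ X Y, P (X ⊔ Y) = P X + P Y - P (X ⊓ Y)
  isometry_left : ∀ a, S a * Sd a * S a = S a
  isometry_right : ∀ a, Sd a * S a * Sd a = Sd a
  comm_left : ∀ a X, P X * S a = S a * P (D.θ a X)
  comm_right : ∀ a X, Sd a * P X = P (D.θ a X) * Sd a
  source : ∀ a, Sd a * S a = P (D.rng [a])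
  orthogonal : ∀ a b, a ≠ b → Sd a * S b = 0
  regular : ∀ X, D.IsRegular X → ∀ F : Finset L, (F : Set L) = D.letters X →
    P X = ∑ a ∈ F, S a * P (D.θ a X) * Sd a

/-- A Cuntz-Krieger representation in a C*-algebra: a family of projections `P_A` and partial
isometries `S_a` that satisfy the Cuntz-Krieger relations. -/
structure IsCKRepresentation {A : Type*} [NonUnitalCStarAlgebra A] (P : B → A) (S : L → A) :
    Prop where
  projection : ∀ X, IsStarProjection (P X)
  family : D.IsCKFamily P S (fun a => star (S a))

/-- `S_α x = S_{a₁} ⋯ S_{aₙ} x` for a word `α = a₁ ⋯ aₙ`. -/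
def word {A : Type*} [Mul A] (S : L → A) (α : List L) (x : A) : A :=
  α.foldr (fun a y => S a * y) x

/-- `x S_β^* = x S_{bₙ}^* ⋯ S_{b₁}^*` for a word `β = b₁ ⋯ bₙ`, where `Sd b` stands for `S_b^*`. -/
def wordStar {A : Type*} [Mul A] (Sd : L → A) (β : List L) (x : A) : A :=
  β.foldr (fun b y => y * Sd b) x

/-- The element `S_α P_X S_β^*`. -/
def monomial {A : Type*} [Mul A] (P : B → A) (S Sd : L → A) (α : List L) (X : B) (β : List L) : A :=
  word S α (wordStar Sd β (P X))

/-- The set `{S_α P_X S_β^* : α, β ∈ L^*, X ∈ B, X ⊆ R_α ∩ R_β} ∪ {0}`. (The further condition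
`R_α ∩ R_β ≠ ∅` only excludes elements with `X = ∅`, which are equal to `0`.) -/
def monomials {A : Type*} [NonUnitalRing A] (P : B → A) (S Sd : L → A) : Set A :=
  {x | x = 0 ∨ ∃ α X β, D.Below α X ∧ D.Below β X ∧ x = monomial P S Sd α X β}

section facts

theorem act_cons (a : L) (α : List L) (X : B) : D.act (a :: α) X = D.act α (D.θ a X) := rfl

theorem act_append (α β : List L) (X : B) : D.act (α ++ β) X = D.act β (D.act α X) := by
  simp [act, List.foldl_append]

theorem θ_mono (a : L) {X Y : B} (h : X ≤ Y) : D.θ a X ≤ D.θ a Y := by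
  rw [← inf_eq_left] at h ⊢
  rw [← D.map_inf, h]

theorem act_mono (α : List L) {X Y : B} (h : X ≤ Y) : D.act α X ≤ D.act α Y := by
  induction α generalizing X Y with
  | nil => exact h
  | cons a α ih => exact ih (D.θ_mono a h)

theorem below_iff (α : List L) (X : B) : D.Below α X ↔ ∃ Y, X ≤ D.act α Y := by
  constructor
  · intro h
    by_cases hα : α = []
    · subst hα
      exact ⟨X, le_rfl⟩
    · have := h hα
      rw [rng, dif_pos hα] at this
      exact ⟨_, this⟩
  · rintro ⟨Y, hY⟩ hα
    exact hY.trans ((D.isLUB_rng hα).1 ⟨Y, rfl⟩)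

variable {D} in
theorem Below.mono {α : List L} {X Y : B} (h : D.Below α Y) (hXY : X ≤ Y) : D.Below α X :=
  fun hα => hXY.trans (h hα)

variable {D} in
theorem Below.of_cons {a : L} {α : List L} {X : B} (h : D.Below (a :: α) X) : D.Below α X := by
  obtain ⟨Y, hY⟩ := (D.below_iff _ _).1 h
  exact (D.below_iff _ _).2 ⟨D.θ a Y, hY⟩

variable {D} in
theorem Below.le_act {a : L} {α : List L} {X : B} (h : D.Below (a :: α) X) :
    X ≤ D.act α (D.rng [a]) := by
  obtain ⟨Y, hY⟩ := (D.below_iff _ _).1 h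
  exact hY.trans (D.act_mono α ((D.isLUB_rng (α := [a]) (by simp)).1 ⟨Y, rfl⟩))

variable {D} in
theorem Below.append {α : List L} {X : B} (h : D.Below α X) (β : List L) :
    D.Below (α ++ β) (D.act β X) := by
  obtain ⟨Y, hY⟩ := (D.below_iff _ _).1 h
  exact (D.below_iff _ _).2 ⟨Y, by rw [act_append]; exact D.act_mono β hY⟩

variable {A : Type*} [NonUnitalRing A]

theorem word_mul (S : L → A) (α : List L) (x y : A) : word S α x * y = word S α (x * y) := by
  induction α with
  | nil => rfl
  | cons a α ih =>
    change S a * word S α x * y = S a * word S α (x * y)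
    rw [mul_assoc, ih]

theorem mul_wordStar (Sd : L → A) (β : List L) (x y : A) :
    x * wordStar Sd β y = wordStar Sd β (x * y) := by
  induction β with
  | nil => rfl
  | cons b β ih =>
    change x * (wordStar Sd β y * Sd b) = wordStar Sd β (x * y) * Sd b
    rw [← mul_assoc, ih]

theorem word_wordStar (S Sd : L → A) (α β : List L) (x : A) :
    word S α (wordStar Sd β x) = wordStar Sd β (word S α x) := by
  induction α with
  | nil => rfl
  | cons a α ih =>
    change S a * word S α (wordStar Sd β x) = wordStar Sd β (S a * word S α x)
    rw [ih, mul_wordStar]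

theorem word_append (S : L → A) (α β : List L) (x : A) :
    word S (α ++ β) x = word S α (word S β x) := by
  simp [word]

theorem wordStar_append (S : L → A) (α β : List L) (x : A) :
    wordStar S (α ++ β) x = wordStar S α (wordStar S β x) := by
  simp [wordStar]

theorem word_zero (S : L → A) (α : List L) : word S α 0 = 0 := by
  induction α with
  | nil => rfl
  | cons a α ih =>
    change S a * word S α 0 = 0
    rw [ih, mul_zero]

theorem wordStar_zero (S : L → A) (α : List L) : wordStar S α 0 = 0 := by
  induction α with
  | nil => rfl
  | cons a α ih =>
    change wordStar S α 0 * S a = 0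
    rw [ih, zero_mul]

variable {D} {P : B → A} {S Sd : L → A}

theorem IsCKFamily.mul_word (h : D.IsCKFamily P S Sd) (X : B) (γ : List L) (x : A) :
    P X * word S γ x = word S γ (P (D.act γ X) * x) := by
  induction γ generalizing X with
  | nil => rfl
  | cons c γ ih =>
    change P X * (S c * word S γ x) = S c * word S γ (P (D.act γ (D.θ c X)) * x)
    rw [← mul_assoc, h.comm_left, mul_assoc, ih]

theorem IsCKFamily.wordStar_mul (h : D.IsCKFamily P S Sd) (X : B) (γ : List L) (x : A) :
    wordStar Sd γ x * P X = wordStar Sd γ (x * P (D.act γ X)) := by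
  induction γ generalizing X with
  | nil => rfl
  | cons c γ ih =>
    change wordStar Sd γ x * Sd c * P X = wordStar Sd γ (x * P (D.act γ (D.θ c X))) * Sd c
    rw [mul_assoc, h.comm_right, ← mul_assoc, ih]

theorem IsCKFamily.cons_cons (h : D.IsCKFamily P S Sd) (b : L) (β γ : List L) (X Y : B)
    (hY : D.Below (b :: γ) Y) :
    wordStar Sd (b :: β) (P X) * word S (b :: γ) (P Y) = wordStar Sd β (P X) * word S γ (P Y) := by
  change wordStar Sd β (P X) * Sd b * (S b * word S γ (P Y)) = _
  rw [mul_assoc, ← mul_assoc (Sd b), h.source, h.mul_word, ← h.inf,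
    inf_eq_right.2 hY.le_act]

theorem IsCKFamily.inner_self (h : D.IsCKFamily P S Sd) (β : List L) (X Y : B)
    (hY : D.Below β Y) : wordStar Sd β (P X) * word S β (P Y) = P (X ⊓ Y) := by
  induction β with
  | nil => exact (h.inf X Y).symm
  | cons b β ih => rw [h.cons_cons b β β X Y hY, ih hY.of_cons]

theorem IsCKFamily.inner (h : D.IsCKFamily P S Sd) (β γ : List L) (X Y : B)
    (hX : D.Below β X) (hY : D.Below γ Y) :
    (∃ δ, γ = β ++ δ ∧
      wordStar Sd β (P X) * word S γ (P Y) = word S δ (P (D.act δ X ⊓ Y))) ∨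
    (∃ δ, β = γ ++ δ ∧
      wordStar Sd β (P X) * word S γ (P Y) = wordStar Sd δ (P (X ⊓ D.act δ Y))) ∨
    wordStar Sd β (P X) * word S γ (P Y) = 0 := by
  induction β generalizing γ with
  | nil =>
    refine Or.inl ⟨γ, rfl, ?_⟩
    change P X * word S γ (P Y) = _
    rw [h.mul_word, h.inf]
  | cons b β ih =>
    cases γ with
    | nil =>
      refine Or.inr (Or.inl ⟨b :: β, rfl, ?_⟩)
      change wordStar Sd (b :: β) (P X) * P Y = _
      rw [h.wordStar_mul, h.inf]
    | cons c γ =>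
      by_cases hbc : b = c
      · subst hbc
        rw [h.cons_cons b β γ X Y hY]
        rcases ih γ hX.of_cons hY.of_cons with ⟨δ, h1, h2⟩ | ⟨δ, h1, h2⟩ | h2
        · exact Or.inl ⟨δ, by rw [h1]; rfl, h2⟩
        · exact Or.inr (Or.inl ⟨δ, by rw [h1]; rfl, h2⟩)
        · exact Or.inr (Or.inr h2)
      · refine Or.inr (Or.inr ?_)
        change wordStar Sd β (P X) * Sd b * (S c * word S γ (P Y)) = 0
        rw [mul_assoc, ← mul_assoc (Sd b), h.orthogonal b c hbc, zero_mul, mul_zero]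

theorem monomial_mul_monomial {B : Type u} (P : B → A) (S Sd : L → A) (α β γ δ : List L) (X Y : B) :
    monomial P S Sd α X β * monomial P S Sd γ Y δ =
      word S α (wordStar Sd δ (wordStar Sd β (P X) * word S γ (P Y))) := by
  rw [monomial, monomial, word_mul, word_wordStar S Sd γ, mul_wordStar]

theorem IsCKFamily.mul_mem (h : D.IsCKFamily P S Sd) {x y : A}
    (hx : x ∈ D.monomials P S Sd) (hy : y ∈ D.monomials P S Sd) :
    x * y ∈ D.monomials P S Sd := by
  rcases hx with rfl | ⟨α, X, β, h1, h2, rfl⟩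
  · exact Or.inl (zero_mul _)
  rcases hy with rfl | ⟨γ, Y, δ, h3, h4, rfl⟩
  · exact Or.inl (mul_zero _)
  rw [monomial_mul_monomial]
  rcases h.inner β γ X Y h2 h3 with ⟨ε, -, he⟩ | ⟨ε, -, he⟩ | he
  · refine Or.inr ⟨α ++ ε, _, δ, (h1.append ε).mono inf_le_left, h4.mono inf_le_right, ?_⟩
    rw [he, monomial, word_append, word_wordStar S Sd ε]
  · refine Or.inr ⟨α, _, δ ++ ε, h1.mono inf_le_left, (h4.append ε).mono inf_le_right, ?_⟩
    rw [he, monomial, wordStar_append]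
  · refine Or.inl ?_
    rw [he, wordStar_zero, word_zero]

end facts

/-! ### The universal C*-algebra and the inverse semigroup `T` -/

section involution

variable {A : Type*} [NonUnitalRing A] [StarRing A]

theorem star_word (S : L → A) (α : List L) (x : A) :
    star (word S α x) = wordStar (fun a => star (S a)) α (star x) := by
  induction α with
  | nil => rfl
  | cons a α ih =>
    change star (S a * word S α x) = wordStar (fun a => star (S a)) α (star x) * star (S a)
    rw [star_mul, ih]

theorem star_wordStar (S : L → A) (α : List L) (x : A) :
    star (wordStar (fun a => star (S a)) α x) = word S α (star x) := by
  induction α with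
  | nil => rfl
  | cons a α ih =>
    change star (wordStar (fun a => star (S a)) α x * star (S a)) = S a * word S α (star x)
    rw [star_mul, ih, star_star]

end involution

section cstar

variable {D} {A : Type*} [NonUnitalCStarAlgebra A] {P : B → A} {S : L → A}

theorem IsCKRepresentation.star_monomial (h : D.IsCKRepresentation P S) (α β : List L) (X : B) :
    star (monomial P S (fun a => star (S a)) α X β) =
      monomial P S (fun a => star (S a)) β X α := by
  rw [monomial, star_word, star_wordStar, (h.projection X).isSelfAdjoint.star_eq, monomial,
    word_wordStar]

theorem IsCKRepresentation.star_mem (h : D.IsCKRepresentation P S) {x : A}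
    (hx : x ∈ D.monomials P S (fun a => star (S a))) :
    star x ∈ D.monomials P S (fun a => star (S a)) := by
  rcases hx with rfl | ⟨α, X, β, h1, h2, rfl⟩
  · exact Or.inl (star_zero _)
  · exact Or.inr ⟨β, X, α, h2, h1, h.star_monomial α β X⟩

theorem IsCKRepresentation.monomial_star_mul_self (h : D.IsCKRepresentation P S) (α β : List L)
    (X : B) (hα : D.Below α X) :
    star (monomial P S (fun a => star (S a)) α X β) * monomial P S (fun a => star (S a)) α X β =
      monomial P S (fun a => star (S a)) β X β := by
  rw [h.star_monomial, monomial_mul_monomial, h.family.inner_self α X X hα, inf_idem, monomial]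

theorem IsCKRepresentation.mul_star_mul (h : D.IsCKRepresentation P S) {x : A}
    (hx : x ∈ D.monomials P S (fun a => star (S a))) : x * star x * x = x := by
  rcases hx with rfl | ⟨α, X, β, h1, h2, rfl⟩
  · simp
  · rw [mul_assoc, h.monomial_star_mul_self α β X h1, monomial_mul_monomial,
      h.family.inner_self β X X h2, inf_idem, monomial]

/-- An idempotent partial isometry in a C*-algebra is a projection. -/
theorem eq_star_mul_self {x : A} (h1 : x * star x * x = x) (h2 : x * x = x) : x = star x * x := by
  rw [← sub_eq_zero, ← CStarRing.star_mul_self_eq_zero_iff]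
  have h3 : star x * star x = star x := by rw [← star_mul, h2]
  have h4 : star x * x * x = star x * x := by rw [mul_assoc, h2]
  have h5 : star x * (star x * x) = star x * x := by rw [← mul_assoc, h3]
  have h6 : star x * x * (star x * x) = star x * x := by rw [mul_assoc, ← mul_assoc x, h1]
  rw [star_sub, star_mul, star_star, sub_mul, mul_sub, mul_sub, h4, h5, h6]
  simp

theorem IsCKRepresentation.idem_form (h : D.IsCKRepresentation P S) {x : A}
    (hx : x ∈ D.monomials P S (fun a => star (S a))) (hi : x * x = x) :
    x = 0 ∨ ∃ β X, D.Below β X ∧ x = monomial P S (fun a => star (S a)) β X β := by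
  have h0 := eq_star_mul_self (h.mul_star_mul hx) hi
  rcases hx with rfl | ⟨α, X, β, h1, h2, rfl⟩
  · exact Or.inl rfl
  · exact Or.inr ⟨β, X, h2, h0.trans (h.monomial_star_mul_self α β X h1)⟩

theorem IsCKRepresentation.idem_comm (h : D.IsCKRepresentation P S) {x y : A}
    (hx : x ∈ D.monomials P S (fun a => star (S a))) (hxi : x * x = x)
    (hy : y ∈ D.monomials P S (fun a => star (S a))) (hyi : y * y = y) : x * y = y * x := by
  rcases h.idem_form hx hxi with rfl | ⟨β, X, h1, rfl⟩
  · simp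
  rcases h.idem_form hy hyi with rfl | ⟨γ, Y, h2, rfl⟩
  · simp
  have key : star (monomial P S (fun a => star (S a)) β X β *
      monomial P S (fun a => star (S a)) γ Y γ) = monomial P S (fun a => star (S a)) β X β *
      monomial P S (fun a => star (S a)) γ Y γ := by
    rw [monomial_mul_monomial]
    rcases h.family.inner β γ X Y h1 h2 with ⟨δ, h3, h4⟩ | ⟨δ, h3, h4⟩ | h4
    · rw [h4, ← word_wordStar S _ δ, ← word_append, ← h3]
      exact h.star_monomial γ γ _
    · rw [h4, ← wordStar_append, ← h3]
      exact h.star_monomial β β _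
    · rw [h4, wordStar_zero, word_zero, star_zero]
  rw [star_mul, h.star_monomial, h.star_monomial] at key
  exact key.symm

end cstar

/-- A C*-algebra together with a Cuntz-Krieger representation of `D` in it. -/
structure Representation where
  alg : Type (max u v)
  [cstar : NonUnitalCStarAlgebra alg]
  P : B → alg
  S : L → alg
  isCK : D.IsCKRepresentation P S

attribute [instance] Representation.cstar

theorem IsCKRepresentation.norm_S_le {D : BooleanDynamicalSystem B L} {A : Type*}
    [NonUnitalCStarAlgebra A] {P : B → A} {S : L → A} (h : D.IsCKRepresentation P S) (a : L) :
    ‖S a‖ ≤ 1 := by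
  have h1 : ‖S a‖ * ‖S a‖ ≤ 1 := by
    rw [← CStarRing.norm_star_mul_self, h.family.source a]
    exact (h.projection _).norm_le
  nlinarith [norm_nonneg (S a)]

/-- The family of the projections `P_X` of all representations, in the C*-algebra of bounded
families. -/
noncomputable def bigP (X : B) : lp (fun ρ : Representation D => ρ.alg) ∞ :=
  ⟨fun ρ => ρ.P X, memℓp_infty ⟨1, by rintro _ ⟨ρ, rfl⟩; exact (ρ.isCK.projection X).norm_le⟩⟩

/-- The family of the partial isometries `S_a` of all representations. -/
noncomputable def bigS (a : L) : lp (fun ρ : Representation D => ρ.alg) ∞ :=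
  ⟨fun ρ => ρ.S a, memℓp_infty ⟨1, by rintro _ ⟨ρ, rfl⟩; exact ρ.isCK.norm_S_le a⟩⟩

/-- The universal C*-algebra `C^*(B, L, θ)`: the C*-algebra generated by the direct sum of all
Cuntz-Krieger representations. -/
noncomputable def universalSubalgebra :
    NonUnitalStarSubalgebra ℂ (lp (fun ρ : Representation D => ρ.alg) ∞) :=
  (NonUnitalStarAlgebra.adjoin ℂ (Set.range D.bigP ∪ Set.range D.bigS)).topologicalClosure

/-- `C^*(B, L, θ)` as a type. -/
abbrev UniversalCStarAlgebra : Type (max u v + 1) := D.universalSubalgebra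

noncomputable instance : NonUnitalCStarAlgebra D.UniversalCStarAlgebra :=
  NonUnitalStarSubalgebra.nonUnitalCStarAlgebra _
    (h_closed := NonUnitalStarSubalgebra.isClosed_topologicalClosure _)

/-- The projections `p_X` of the universal representation. -/
noncomputable def univP (X : B) : D.UniversalCStarAlgebra :=
  ⟨D.bigP X, NonUnitalStarSubalgebra.le_topologicalClosure _
    (NonUnitalStarAlgebra.subset_adjoin ℂ _ (Or.inl ⟨X, rfl⟩))⟩

/-- The partial isometries `s_a` of the universal representation. -/
noncomputable def univS (a : L) : D.UniversalCStarAlgebra :=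
  ⟨D.bigS a, NonUnitalStarSubalgebra.le_topologicalClosure _
    (NonUnitalStarAlgebra.subset_adjoin ℂ _ (Or.inr ⟨a, rfl⟩))⟩

/-- The component of `C^*(B, L, θ)` at a representation `ρ`: the `*`-homomorphism required by the
universal property. -/
noncomputable def toRep (ρ : Representation D) : D.UniversalCStarAlgebra →⋆ₙₐ[ℂ] ρ.alg where
  toFun x := (x : lp (fun ρ : Representation D => ρ.alg) ∞) ρ
  map_smul' _ _ := rfl
  map_zero' := rfl
  map_add' _ _ := rfl
  map_mul' _ _ := rfl
  map_star' _ := rfl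

theorem toRep_univP (ρ : Representation D) (X : B) : D.toRep ρ (D.univP X) = ρ.P X := rfl

theorem toRep_univS (ρ : Representation D) (a : L) : D.toRep ρ (D.univS a) = ρ.S a := rfl

theorem univ_ext {x y : D.UniversalCStarAlgebra} (h : ∀ ρ, D.toRep ρ x = D.toRep ρ y) : x = y :=
  Subtype.ext (lp.ext (funext h))

theorem univ_isCKRepresentation : D.IsCKRepresentation D.univP D.univS where
  projection X :=
    { isIdempotentElem := D.univ_ext fun ρ => (ρ.isCK.projection X).isIdempotentElem
      isSelfAdjoint := D.univ_ext fun ρ => (ρ.isCK.projection X).isSelfAdjoint }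
  family :=
    { bot := D.univ_ext fun ρ => ρ.isCK.family.bot
      inf := fun X Y => D.univ_ext fun ρ => ρ.isCK.family.inf X Y
      sup := fun X Y => D.univ_ext fun ρ => ρ.isCK.family.sup X Y
      isometry_left := fun a => D.univ_ext fun ρ => ρ.isCK.family.isometry_left a
      isometry_right := fun a => D.univ_ext fun ρ => ρ.isCK.family.isometry_right a
      comm_left := fun a X => D.univ_ext fun ρ => ρ.isCK.family.comm_left a X
      comm_right := fun a X => D.univ_ext fun ρ => ρ.isCK.family.comm_right a X
      source := fun a => D.univ_ext fun ρ => ρ.isCK.family.source a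
      orthogonal := fun a b hab => D.univ_ext fun ρ => ρ.isCK.family.orthogonal a b hab
      regular := fun X hX F hF => D.univ_ext fun ρ => by
        rw [map_sum]
        exact ρ.isCK.family.regular X hX F hF }

end BooleanDynamicalSystem

/-! ## Inverse semigroups -/

/-- A `*`-inverse semigroup with zero: every `s` satisfies `s s^* s = s`, and idempotents
commute. -/
class InverseSemigroup (S : Type*) extends SemigroupWithZero S, StarMul S where
  mul_star_mul : ∀ s : S, s * star s * s = s
  idem_comm : ∀ e f : S, e * e = e → f * f = f → e * f = f * e

namespace BooleanDynamicalSystem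

variable {B : Type u} {L : Type v} [GeneralizedBooleanAlgebra B] (D : BooleanDynamicalSystem B L)

/-- The inverse semigroup
`T = {s_α p_X s_β^* : α, β ∈ L^*, X ∈ B, X ⊆ R_α ∩ R_β} ∪ {0} ⊆ C^*(B, L, θ)`. -/
def T : Type (max u v + 1) :=
  {x : D.UniversalCStarAlgebra // x ∈ D.monomials D.univP D.univS (fun a => star (D.univS a))}

noncomputable instance : InverseSemigroup D.T where
  mul x y := ⟨x.1 * y.1, D.univ_isCKRepresentation.family.mul_mem x.2 y.2⟩
  mul_assoc x y z := Subtype.ext (mul_assoc x.1 y.1 z.1)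
  zero := ⟨0, Or.inl rfl⟩
  zero_mul x := Subtype.ext (zero_mul x.1)
  mul_zero x := Subtype.ext (mul_zero x.1)
  star x := ⟨star x.1, D.univ_isCKRepresentation.star_mem x.2⟩
  star_involutive x := Subtype.ext (star_star x.1)
  star_mul x y := Subtype.ext (star_mul x.1 y.1)
  mul_star_mul x := Subtype.ext (D.univ_isCKRepresentation.mul_star_mul x.2)
  idem_comm x y hx hy := Subtype.ext (D.univ_isCKRepresentation.idem_comm
    x.2 (congrArg Subtype.val hx) y.2 (congrArg Subtype.val hy))

/-- `p_X` as an element of `T`. -/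
noncomputable def pT (X : B) : D.T :=
  ⟨D.univP X, Or.inr ⟨[], X, [], fun h => absurd rfl h, fun h => absurd rfl h, rfl⟩⟩

/-- `s_a = s_a p_{R_a}` as an element of `T`. -/
noncomputable def sT (a : L) : D.T :=
  ⟨D.univS a, Or.inr ⟨[a], D.rng [a], [], fun _ => le_rfl, fun h => absurd rfl h, by
    change D.univS a = D.univS a * D.univP (D.rng [a])
    rw [← D.univ_isCKRepresentation.family.source a, ← mul_assoc]
    exact (D.univ_isCKRepresentation.family.isometry_left a).symm⟩⟩

end BooleanDynamicalSystem

namespace InverseSemigroup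

variable {S : Type*} [InverseSemigroup S]

theorem idem_star_eq {e : S} (he : e * e = e) : star e = e := by
  have h1 : star e * star e = star e := by rw [← star_mul, he]
  have h2 : e = star e * e := by
    conv_lhs => rw [← mul_star_mul e, idem_comm e (star e) he h1, mul_assoc, he]
  rw [h2, star_mul, star_star]

theorem star_mul_self_idem (s : S) : star s * s * (star s * s) = star s * s := by
  rw [← mul_assoc, mul_assoc (star s) s, mul_assoc (star s), mul_star_mul]

theorem mul_star_self_idem (s : S) : s * star s * (s * star s) = s * star s := by
  rw [← mul_assoc, mul_star_mul]

theorem idem_mul_idem {e f : S} (he : e * e = e) (hf : f * f = f) : e * f * (e * f) = e * f := by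
  rw [mul_assoc, ← mul_assoc f, ← idem_comm e f he hf, mul_assoc e f f, hf, ← mul_assoc, he]

theorem conj_mul_conj (s : S) {e f : S} (he : e * e = e) :
    star s * e * s * (star s * f * s) = star s * (e * f) * s := by
  have h : s * star s * e = e * (s * star s) := idem_comm _ _ (mul_star_self_idem s) he
  calc star s * e * s * (star s * f * s) = star s * (e * (s * star s)) * f * s := by
        simp only [mul_assoc]
    _ = star s * (s * star s * e) * f * s := by rw [h]
    _ = (star s * s * star s) * (e * f) * s := by simp only [mul_assoc]
    _ = star s * (e * f) * s := by
        have := mul_star_mul (star s)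
        rw [star_star] at this
        rw [this]

theorem conj_idem (s : S) {e : S} (he : e * e = e) :
    star s * e * s * (star s * e * s) = star s * e * s := by
  rw [conj_mul_conj s he, he]

theorem conj_idem_star (s : S) {e : S} (he : e * e = e) :
    s * e * star s * (s * e * star s) = s * e * star s := by
  simpa using conj_idem (star s) he

/-! ### Tight filters -/

/-- The set `E^{X,Y}` of the idempotents that lie below all elements of `X` and are orthogonal to
all elements of `Y`; for idempotents, `e ≤ f` means `e f = e`. -/
def between (X Y : Set S) : Set S :=
  {e | e * e = e ∧ (∀ x ∈ X, e * x = e) ∧ ∀ y ∈ Y, e * y = 0}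

/-- `Z` is a cover of the set `F` of idempotents: it is a subset of `F`, and every nonzero element
of `F` has a nonzero product with some element of `Z`. -/
def IsCover (Z F : Set S) : Prop := Z ⊆ F ∧ ∀ e ∈ F, e ≠ 0 → ∃ z ∈ Z, e * z ≠ 0

variable (S) in
/-- A tight filter on the semilattice `E(S)` of idempotents of `S`: a proper nonempty filter `ξ`
such that, for all finite sets `X, Y` of idempotents and every finite cover `Z` of `E^{X,Y}`, if
`X ⊆ ξ` and `Y ∩ ξ = ∅` then `Z ∩ ξ ≠ ∅`. -/
@[ext]
structure TightFilter where
  carrier : Set S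
  idem : ∀ e ∈ carrier, e * e = e
  nonempty : carrier.Nonempty
  zero_notMem : (0 : S) ∉ carrier
  mul_mem : ∀ e ∈ carrier, ∀ f ∈ carrier, e * f ∈ carrier
  upward : ∀ e ∈ carrier, ∀ f, f * f = f → e * f = e → f ∈ carrier
  tight : ∀ X Y Z : Set S, X.Finite → Y.Finite → Z.Finite →
    (∀ x ∈ X, x * x = x) → (∀ y ∈ Y, y * y = y) → IsCover Z (between X Y) →
    X ⊆ carrier → Disjoint Y carrier → ∃ z ∈ Z, z ∈ carrier

namespace TightFilter

/-- The domain `D_e` of the idempotent `e`. -/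
def dom (e : S) : Set (TightFilter S) := {ξ | e ∈ ξ.carrier}

/-- The topology of pointwise convergence of characters, generated by the sets `D_e` and their
complements. -/
instance : TopologicalSpace (TightFilter S) :=
  TopologicalSpace.generateFrom {U | ∃ e : S, e * e = e ∧ (U = dom e ∨ U = (dom e)ᶜ)}

theorem mem_of_mul_mem {ξ : TightFilter S} {e f : S} (he : e * e = e) (hf : f * f = f)
    (h : e * f ∈ ξ.carrier) : e ∈ ξ.carrier :=
  ξ.upward _ h e he (by rw [mul_assoc, ← idem_comm e f he hf, ← mul_assoc, he])

/-- The action of `S` on tight filters, `t · ξ = {f ∈ E(S) : t^* f t ∈ ξ}`, for `t^* t ∈ ξ`. It is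
the filter generated by `{t e t^* : e ∈ ξ}`. -/
def act (t : S) (ξ : TightFilter S) (ht : star t * t ∈ ξ.carrier) : TightFilter S where
  carrier := {f | f * f = f ∧ star t * f * t ∈ ξ.carrier}
  idem _ h := h.1
  nonempty := by
    refine ⟨t * star t, mul_star_self_idem t, ?_⟩
    rw [← mul_assoc, mul_assoc _ (star t) t]
    rwa [star_mul_self_idem]
  zero_notMem h := ξ.zero_notMem (by simpa using h.2)
  mul_mem e he f hf := by
    refine ⟨idem_mul_idem he.1 hf.1, ?_⟩
    rw [← conj_mul_conj t he.1]
    exact ξ.mul_mem _ he.2 _ hf.2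
  upward e he f hf hef := by
    refine ⟨hf, ξ.upward _ he.2 _ (conj_idem t hf) ?_⟩
    rw [conj_mul_conj t he.1, hef]
  tight X Y Z hX hY hZ hXi hYi hc hXs hYs := by
    have hcomm : ∀ {e : S}, e * e = e → t * star t * e = e * (t * star t) :=
      fun he => idem_comm _ _ (mul_star_self_idem t) he
    have hst : star t * t * star t = star t := by simpa using mul_star_mul (star t)
    obtain ⟨z', ⟨z, hz, rfl⟩, hz'⟩ := ξ.tight (insert (star t * t) ((fun x => star t * x * t) '' X))
      ((fun y => star t * y * t) '' Y) ((fun z => star t * z * t) '' Z)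
      ((hX.image _).insert _) (hY.image _) (hZ.image _)
      (by
        rintro _ (rfl | ⟨x, hx, rfl⟩)
        · exact star_mul_self_idem t
        · exact conj_idem t (hXi x hx))
      (by rintro _ ⟨y, hy, rfl⟩; exact conj_idem t (hYi y hy))
      (by
        refine ⟨?_, ?_⟩
        · rintro _ ⟨z, hz, rfl⟩
          obtain ⟨h1, h2, h3⟩ := hc.1 hz
          refine ⟨conj_idem t h1, ?_, ?_⟩
          · rintro _ (rfl | ⟨x, hx, rfl⟩)
            · rw [mul_assoc (star t * z), ← mul_assoc t, mul_star_mul]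
            · simp only
              rw [conj_mul_conj t h1, h2 x hx]
          · rintro _ ⟨y, hy, rfl⟩
            simp only
            rw [conj_mul_conj t h1, h3 y hy, mul_zero, zero_mul]
        · rintro e ⟨h1, h2, h3⟩ he0
          have het : e * (star t * t) = e := h2 _ (Or.inl rfl)
          have hte : star t * t * e = e := by
            rw [idem_comm _ _ (star_mul_self_idem t) h1, het]
          have hback : star t * (t * e * star t) * t = e := by
            calc star t * (t * e * star t) * t = star t * t * e * (star t * t) := by
                  simp only [mul_assoc]
              _ = e := by rw [hte, het]
          have key : ∀ f : S, f * f = f →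
              t * e * star t * f = t * (e * (star t * f * t)) * star t := by
            intro f hf
            calc t * e * star t * f = t * e * (star t * t * star t) * f := by rw [hst]
              _ = t * e * star t * (t * star t * f) := by simp only [mul_assoc]
              _ = t * e * star t * (f * (t * star t)) := by rw [hcomm hf]
              _ = _ := by simp only [mul_assoc]
          obtain ⟨z, hz, hz0⟩ := hc.2 (t * e * star t)
            ⟨conj_idem_star t h1, fun x hx => by
              rw [key x (hXi x hx), h2 _ (Or.inr ⟨x, hx, rfl⟩)], fun y hy => by
              rw [key y (hYi y hy), h3 _ ⟨y, hy, rfl⟩, mul_zero, zero_mul]⟩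
            (fun h0 => he0 (by rw [← hback, h0, mul_zero, zero_mul]))
          refine ⟨_, ⟨z, hz, rfl⟩, fun h0 => hz0 ?_⟩
          simp only at h0
          rw [key z (hc.1 hz).1, h0, mul_zero, zero_mul])
      (by
        rintro _ (rfl | ⟨x, hx, rfl⟩)
        · exact ht
        · exact (hXs hx).2)
      (by
        rw [Set.disjoint_left]
        rintro _ ⟨y, hy, rfl⟩ hm
        exact Set.disjoint_left.1 hYs hy ⟨hYi y hy, hm⟩)
    exact ⟨z, hz, (hc.1 hz).1, hz'⟩

end TightFilter

/-! ### The tight groupoid -/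

variable (S) in
/-- Pairs `(t, ξ)` with `ξ` in the domain of `t`. -/
structure PreGerm where
  elt : S
  point : TightFilter S
  mem : star elt * elt ∈ point.carrier

variable (S) in
/-- `(s, ξ)` and `(t, η)` have the same germ if `ξ = η` and `s e = t e` for some idempotent
`e ∈ ξ`. -/
def germSetoid : Setoid (PreGerm S) where
  r x y := x.point = y.point ∧ ∃ e ∈ x.point.carrier, x.elt * e = y.elt * e
  iseqv :=
    { refl := fun x => ⟨rfl, x.point.nonempty.choose, x.point.nonempty.choose_spec, rfl⟩
      symm := by
        rintro ⟨s, ξ, hs⟩ ⟨t, η, ht⟩ ⟨h, e, he, h2⟩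
        simp only at h he h2
        subst h
        exact ⟨rfl, e, he, h2.symm⟩
      trans := by
        rintro ⟨s, ξ, hs⟩ ⟨t, η, ht⟩ ⟨r, ζ, hr⟩ ⟨h, e, he, h2⟩ ⟨h', f, hf, h3⟩
        simp only at h h' he hf h2 h3
        subst h
        subst h'
        refine ⟨rfl, e * f, ξ.mul_mem _ he _ hf, ?_⟩
        change s * (e * f) = r * (e * f)
        rw [← mul_assoc, h2, mul_assoc, idem_comm e f (ξ.idem _ he) (ξ.idem _ hf), ← mul_assoc, h3,
          mul_assoc] }

variable (S) in
/-- The tight groupoid of `S`: the groupoid of germs of the action of `S` on its space of tight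
filters. -/
def TightGroupoid := Quotient (germSetoid S)

namespace TightGroupoid

/-- The germ `[t, ξ]`. -/
def germ (t : S) (ξ : TightFilter S) (ht : star t * t ∈ ξ.carrier) : TightGroupoid S :=
  Quotient.mk (germSetoid S) ⟨t, ξ, ht⟩

theorem germ_eq_iff {s t : S} {ξ η : TightFilter S} {hs : star s * s ∈ ξ.carrier}
    {ht : star t * t ∈ η.carrier} :
    germ s ξ hs = germ t η ht ↔ ξ = η ∧ ∃ e ∈ ξ.carrier, s * e = t * e :=
  ⟨fun h => Quotient.exact h, fun h => Quotient.sound h⟩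

/-- The source of `[t, ξ]` is `ξ`. -/
def source : TightGroupoid S → TightFilter S :=
  Quotient.lift PreGerm.point fun _ _ h => h.1

theorem act_congr {s t : S} {ξ : TightFilter S} {hs : star s * s ∈ ξ.carrier}
    {ht : star t * t ∈ ξ.carrier} {e : S} (he : e ∈ ξ.carrier) (h : s * e = t * e) :
    ξ.act s hs = ξ.act t ht := by
  have hei := ξ.idem e he
  have key : ∀ (r f : S), f * f = f →
      (star r * f * r ∈ ξ.carrier ↔ star (r * e) * f * (r * e) ∈ ξ.carrier) := by
    intro r f hf
    have h1 : star (r * e) * f * (r * e) = (star r * f * r) * e := by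
      rw [star_mul, idem_star_eq hei]
      calc e * star r * f * (r * e) = e * (star r * f * r) * e := by simp only [mul_assoc]
        _ = (star r * f * r) * e := by
          rw [idem_comm e _ hei (conj_idem r hf), mul_assoc, hei]
    rw [h1]
    exact ⟨fun h2 => ξ.mul_mem _ h2 _ he,
      fun h2 => TightFilter.mem_of_mul_mem (conj_idem r hf) hei h2⟩
  ext f
  change (f * f = f ∧ _) ↔ (f * f = f ∧ _)
  refine and_congr_right fun hf => ?_
  rw [key s f hf, key t f hf, h]

/-- The range of `[t, ξ]` is `t · ξ`. -/
def range : TightGroupoid S → TightFilter S :=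
  Quotient.lift (fun x => x.point.act x.elt x.mem) (by
    rintro ⟨s, ξ, hs⟩ ⟨t, η, ht⟩ ⟨h, e, he, h2⟩
    simp only at h he h2
    subst h
    exact act_congr he h2)

theorem mem_of_comp {s t : S} {ξ : TightFilter S} {ht : star t * t ∈ ξ.carrier}
    (hs : star s * s ∈ (ξ.act t ht).carrier) : star (s * t) * (s * t) ∈ ξ.carrier := by
  have h := hs.2
  rwa [star_mul, ← mul_assoc, mul_assoc (star t)]

/-- `IsComp a b c` says that the pair `(a, b)` is composable and that `a b = c`, where the product
of germs is `[s, t · ξ] [t, ξ] = [s t, ξ]`. -/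
def IsComp (a b c : TightGroupoid S) : Prop :=
  ∃ (s t : S) (ξ : TightFilter S) (ht : star t * t ∈ ξ.carrier)
    (hs : star s * s ∈ (ξ.act t ht).carrier),
    a = germ s (ξ.act t ht) hs ∧ b = germ t ξ ht ∧ c = germ (s * t) ξ (mem_of_comp hs)

/-- The product is well defined: it exists, and is then unique, exactly for the pairs `(a, b)` with
`source a = range b`. -/
theorem existsUnique_isComp (a b : TightGroupoid S) (h : source a = range b) :
    ∃! c, IsComp a b c := by
  obtain ⟨⟨s, η, hs⟩, rfl⟩ := Quotient.exists_rep a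
  obtain ⟨⟨t, ξ, ht⟩, rfl⟩ := Quotient.exists_rep b
  change η = ξ.act t ht at h
  subst h
  refine ⟨germ (s * t) ξ (mem_of_comp hs), ⟨s, t, ξ, ht, hs, rfl, rfl, rfl⟩, ?_⟩
  rintro c ⟨s', t', ξ', ht', hs', h1, h2, rfl⟩
  obtain ⟨h3, e, he, h4⟩ := germ_eq_iff.1 h2
  obtain ⟨-, f, hf, h5⟩ := germ_eq_iff.1 h1
  subst h3
  refine germ_eq_iff.2 ⟨rfl, star t * f * t * e, ξ.mul_mem _ hf.2 _ he, ?_⟩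
  have ht1 : t * (star t * f * t * e) = f * (t * e) := by
    calc t * (star t * f * t * e) = t * star t * f * (t * e) := by simp only [mul_assoc]
      _ = f * (t * star t) * (t * e) := by rw [idem_comm _ _ (mul_star_self_idem t) hf.1]
      _ = f * ((t * star t * t) * e) := by simp only [mul_assoc]
      _ = f * (t * e) := by rw [mul_star_mul]
  have hcomm : star t * f * t * e = e * (star t * f * t * e) := by
    rw [idem_comm e _ (ξ.idem _ he) (idem_mul_idem (conj_idem t hf.1) (ξ.idem _ he)),
      mul_assoc _ e e, ξ.idem _ he]
  have ht2 : t' * (star t * f * t * e) = f * (t * e) := by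
    rw [hcomm, ← mul_assoc, ← h4, mul_assoc, ← hcomm, ht1]
  change s' * t' * (star t * f * t * e) = s * t * (star t * f * t * e)
  rw [mul_assoc s', mul_assoc s t, ht1, ht2, ← mul_assoc s', ← mul_assoc s f, h5]

theorem IsComp.source_eq_range {a b c : TightGroupoid S} (h : IsComp a b c) :
    source a = range b := by
  obtain ⟨s, t, ξ, ht, hs, rfl, rfl, rfl⟩ := h
  rfl

/-- The set `Θ(t, U) = {[t, ξ] : ξ ∈ U}` of germs, where only `ξ` in the domain of `t` count. -/
def Θ (t : S) (U : Set (TightFilter S)) : Set (TightGroupoid S) :=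
  {a | ∃ (ξ : TightFilter S) (ht : star t * t ∈ ξ.carrier), ξ ∈ U ∧ a = germ t ξ ht}

/-- The topology of the groupoid of germs, generated by the sets `Θ(t, U)` with `U` an open subset
of the domain of `t`. -/
instance : TopologicalSpace (TightGroupoid S) :=
  TopologicalSpace.generateFrom
    {V | ∃ (t : S) (U : Set (TightFilter S)),
      IsOpen U ∧ U ⊆ TightFilter.dom (star t * t) ∧ V = Θ t U}

end TightGroupoid

end InverseSemigroup

/-! ## The Steinberg algebra -/

open InverseSemigroup in
/-- The Steinberg algebra `A_R(G)` of the tight groupoid `G` of `S`, as an `R`-module: the locally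
constant functions `G → R` with compact support `{a : f a ≠ 0}`. Its product is the convolution
below. (This is the usual definition when `G` is Hausdorff, as it is for the inverse semigroup `T`
of a Boolean dynamical system.) -/
def SteinbergAlgebra (R : Type w) [CommRing R] (S : Type*) [InverseSemigroup S] :
    Submodule R (TightGroupoid S → R) where
  carrier := {f | IsLocallyConstant f ∧ IsCompact (Function.support f)}
  zero_mem' := ⟨IsLocallyConstant.const 0, by simp⟩
  add_mem' := by
    rintro f g ⟨hf, hf'⟩ ⟨hg, hg'⟩
    exact ⟨hf.add hg, (hf'.union hg').of_isClosed_subset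
      ((hf.add hg).isOpen_fiber 0).isClosed_compl (Function.support_add f g)⟩
  smul_mem' := by
    rintro r f ⟨hf, hf'⟩
    have hr : IsLocallyConstant (r • f) := hf.comp (fun x => r • x)
    exact ⟨hr, hf'.of_isClosed_subset (hr.isOpen_fiber 0).isClosed_compl (Function.support_const_smul_subset r f)⟩

open InverseSemigroup in
/-- The convolution product `(f g)(c) = ∑ f(a) g(b)`, the sum extending over all composable pairs
`(a, b)` with `a b = c`. -/
noncomputable def convolution {R : Type w} [CommRing R] {S : Type*} [InverseSemigroup S]
    (f g : TightGroupoid S → R) (c : TightGroupoid S) : R :=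
  ∑ᶠ x : {x : TightGroupoid S × TightGroupoid S // TightGroupoid.IsComp x.1 x.2 c},
    f x.1.1 * g x.1.2

/-! ## The algebra `R(B, L, θ)` -/

/-- The generators `p_X`, `s_a` and `s_a^*` (written `sd a`). -/
inductive CKGenerator (B : Type u) (L : Type v) : Type (max u v)
  | p (X : B)
  | s (a : L)
  | sd (a : L)

namespace BooleanDynamicalSystem

variable {B : Type u} {L : Type v} [GeneralizedBooleanAlgebra B] (D : BooleanDynamicalSystem B L)
  (R : Type w) [CommRing R]

open CKGenerator in
/-- The Cuntz-Krieger relations between the generators of the free `R`-algebra. -/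
inductive Rel : FreeAlgebra R (CKGenerator B L) → FreeAlgebra R (CKGenerator B L) → Prop
  | bot : Rel (FreeAlgebra.ι R (p ⊥)) 0
  | inf (X Y) : Rel (FreeAlgebra.ι R (p (X ⊓ Y))) (FreeAlgebra.ι R (p X) * FreeAlgebra.ι R (p Y))
  | sup (X Y) : Rel (FreeAlgebra.ι R (p (X ⊔ Y)))
      (FreeAlgebra.ι R (p X) + FreeAlgebra.ι R (p Y) - FreeAlgebra.ι R (p (X ⊓ Y)))
  | isometry_left (a) : Rel
      (FreeAlgebra.ι R (s a) * FreeAlgebra.ι R (sd a) * FreeAlgebra.ι R (s a))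
      (FreeAlgebra.ι R (s a))
  | isometry_right (a) : Rel
      (FreeAlgebra.ι R (sd a) * FreeAlgebra.ι R (s a) * FreeAlgebra.ι R (sd a))
      (FreeAlgebra.ι R (sd a))
  | comm_left (a X) : Rel (FreeAlgebra.ι R (p X) * FreeAlgebra.ι R (s a))
      (FreeAlgebra.ι R (s a) * FreeAlgebra.ι R (p (D.θ a X)))
  | comm_right (a X) : Rel (FreeAlgebra.ι R (sd a) * FreeAlgebra.ι R (p X))
      (FreeAlgebra.ι R (p (D.θ a X)) * FreeAlgebra.ι R (sd a))
  | source (a) : Rel (FreeAlgebra.ι R (sd a) * FreeAlgebra.ι R (s a))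
      (FreeAlgebra.ι R (p (D.rng [a])))
  | orthogonal (a b) (h : a ≠ b) : Rel (FreeAlgebra.ι R (sd a) * FreeAlgebra.ι R (s b)) 0
  | regular (X) (hX : D.IsRegular X) (F : Finset L) (hF : (F : Set L) = D.letters X) :
      Rel (FreeAlgebra.ι R (p X))
        (∑ a ∈ F, FreeAlgebra.ι R (s a) * FreeAlgebra.ι R (p (D.θ a X)) * FreeAlgebra.ι R (sd a))

/-- The image of a generator in the unital `R`-algebra presented by the Cuntz-Krieger relations. -/
def gen (x : CKGenerator B L) : RingQuot (D.Rel R) :=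
  RingQuot.mkAlgHom R (D.Rel R) (FreeAlgebra.ι R x)

/-- The `R`-algebra `R(B, L, θ)`, not unital in general, with generators `p_X`, `s_a`, `s_a^*` and
the Cuntz-Krieger relations. Since the relations have no constant term, the unital algebra with the
same presentation is its unitization; so it is the non-unital subalgebra of the latter that the
generators generate. Its universal property is `existsUnique_lift`. -/
def alg : NonUnitalSubalgebra R (RingQuot (D.Rel R)) :=
  NonUnitalAlgebra.adjoin R (Set.range (D.gen R))

/-- The generator `p_X` of `R(B, L, θ)`. -/
def pR (X : B) : D.alg R := ⟨D.gen R (.p X), NonUnitalAlgebra.subset_adjoin R ⟨_, rfl⟩⟩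

/-- The generator `s_a` of `R(B, L, θ)`. -/
def sR (a : L) : D.alg R := ⟨D.gen R (.s a), NonUnitalAlgebra.subset_adjoin R ⟨_, rfl⟩⟩

/-- The generator `s_a^*` of `R(B, L, θ)`. -/
def sdR (a : L) : D.alg R := ⟨D.gen R (.sd a), NonUnitalAlgebra.subset_adjoin R ⟨_, rfl⟩⟩

theorem coe_pR (X : B) : (D.pR R X : RingQuot (D.Rel R)) = RingQuot.mkAlgHom R (D.Rel R)
    (FreeAlgebra.ι R (.p X)) := rfl

theorem coe_sR (a : L) : (D.sR R a : RingQuot (D.Rel R)) = RingQuot.mkAlgHom R (D.Rel R)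
    (FreeAlgebra.ι R (.s a)) := rfl

theorem coe_sdR (a : L) : (D.sdR R a : RingQuot (D.Rel R)) = RingQuot.mkAlgHom R (D.Rel R)
    (FreeAlgebra.ι R (.sd a)) := rfl

theorem alg_isCKFamily : D.IsCKFamily (D.pR R) (D.sR R) (D.sdR R) where
  bot := Subtype.ext (by
    exact (RingQuot.mkAlgHom_rel R (Rel.bot (D := D) (R := R))).trans (map_zero _))
  inf X Y := Subtype.ext (by
    simpa [coe_pR, coe_sR, coe_sdR] using RingQuot.mkAlgHom_rel R (Rel.inf (D := D) (R := R) X Y))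
  sup X Y := Subtype.ext (by
    simpa [coe_pR, coe_sR, coe_sdR] using RingQuot.mkAlgHom_rel R (Rel.sup (D := D) (R := R) X Y))
  isometry_left a := Subtype.ext (by
    simpa [coe_pR, coe_sR, coe_sdR] using RingQuot.mkAlgHom_rel R (Rel.isometry_left (D := D) (R := R) a))
  isometry_right a := Subtype.ext (by
    simpa [coe_pR, coe_sR, coe_sdR] using RingQuot.mkAlgHom_rel R (Rel.isometry_right (D := D) (R := R) a))
  comm_left a X := Subtype.ext (by
    simpa [coe_pR, coe_sR, coe_sdR] using RingQuot.mkAlgHom_rel R (Rel.comm_left (D := D) (R := R) a X))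
  comm_right a X := Subtype.ext (by
    simpa [coe_pR, coe_sR, coe_sdR] using RingQuot.mkAlgHom_rel R (Rel.comm_right (D := D) (R := R) a X))
  source a := Subtype.ext (by
    simpa [coe_pR, coe_sR, coe_sdR] using RingQuot.mkAlgHom_rel R (Rel.source (D := D) (R := R) a))
  orthogonal a b h := Subtype.ext (by
    simpa [coe_pR, coe_sR, coe_sdR] using RingQuot.mkAlgHom_rel R (Rel.orthogonal (D := D) (R := R) a b h))
  regular X hX F hF := Subtype.ext (by
    have := RingQuot.mkAlgHom_rel R (Rel.regular (D := D) (R := R) X hX F hF)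
    rw [map_sum] at this
    simpa [coe_pR, coe_sR, coe_sdR] using this)

/-- `R(B, L, θ)` is universal among the `R`-algebras with a family that satisfies the
Cuntz-Krieger relations. -/
theorem existsUnique_lift {A : Type*} [NonUnitalRing A] [Module R A] [IsScalarTower R A A]
    [SMulCommClass R A A] {P : B → A} {S Sd : L → A} (h : D.IsCKFamily P S Sd) :
    ∃! φ : D.alg R →ₙₐ[R] A,
      (∀ X, φ (D.pR R X) = P X) ∧ (∀ a, φ (D.sR R a) = S a) ∧ ∀ a, φ (D.sdR R a) = Sd a := by
  let ψ : CKGenerator B L → A := fun x => CKGenerator.casesOn x P S Sd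
  let Ψ : FreeAlgebra R (CKGenerator B L) →ₐ[R] Unitization R A :=
    FreeAlgebra.lift R fun x => Unitization.inr (ψ x)
  have hp : ∀ X, Ψ (FreeAlgebra.ι R (.p X)) = (P X : Unitization R A) := fun X => by simp [Ψ, ψ]
  have hs : ∀ a, Ψ (FreeAlgebra.ι R (.s a)) = (S a : Unitization R A) := fun X => by simp [Ψ, ψ]
  have hsd : ∀ a, Ψ (FreeAlgebra.ι R (.sd a)) = (Sd a : Unitization R A) := fun X => by
    simp [Ψ, ψ]
  have hrel : ∀ ⦃x y⦄, D.Rel R x y → Ψ x = Ψ y := by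
    intro x y hxy
    cases hxy with
    | bot => rw [hp, h.bot, map_zero, Unitization.inr_zero]
    | inf X Y => rw [map_mul, hp, hp, hp, h.inf, Unitization.inr_mul]
    | sup X Y =>
      rw [map_sub, map_add, hp, hp, hp, hp, h.sup, Unitization.inr_sub, Unitization.inr_add]
    | isometry_left a => simp only [map_mul, hs, hsd, ← Unitization.inr_mul, h.isometry_left]
    | isometry_right a => simp only [map_mul, hs, hsd, ← Unitization.inr_mul, h.isometry_right]
    | comm_left a X => simp only [map_mul, hs, hp, ← Unitization.inr_mul, h.comm_left]
    | comm_right a X => simp only [map_mul, hsd, hp, ← Unitization.inr_mul, h.comm_right]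
    | source a => simp only [map_mul, hs, hsd, hp, ← Unitization.inr_mul, h.source]
    | orthogonal a b hab =>
      simp only [map_mul, hs, hsd, ← Unitization.inr_mul, h.orthogonal a b hab, map_zero,
        Unitization.inr_zero]
    | regular X hX F hF =>
      rw [map_sum, hp, h.regular X hX F hF]
      simp only [map_mul, hs, hsd, hp, ← Unitization.inr_mul]
      exact map_sum (Unitization.inrHom R R A) _ _
  let Φ : RingQuot (D.Rel R) →ₐ[R] Unitization R A := RingQuot.liftAlgHom R ⟨Ψ, hrel⟩
  have hΦ : ∀ x, Φ (RingQuot.mkAlgHom R (D.Rel R) x) = Ψ x := fun x =>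
    RingQuot.liftAlgHom_mkAlgHom_apply R Ψ hrel x
  have hmem : ∀ z ∈ D.alg R, (Φ z).fst = 0 := by
    intro z hz
    refine NonUnitalAlgebra.adjoin_induction (R := R)
      (p := fun x _ => (Φ x).fst = 0) ?_ ?_ ?_ ?_ ?_ hz
    · rintro _ ⟨x, rfl⟩
      rw [gen, hΦ]
      simp [Ψ]
    · intro x y _ _ hx hy
      rw [map_add, Unitization.fst_add, hx, hy, add_zero]
    · rw [map_zero, Unitization.fst_zero]
    · intro x y _ _ hx hy
      rw [map_mul, Unitization.fst_mul, hx, hy, mul_zero]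
    · intro r x _ hx
      rw [map_smul, Unitization.fst_smul, hx, smul_zero]
  let φ : D.alg R →ₙₐ[R] A :=
    { toFun := fun z => (Φ z.1).snd
      map_smul' := fun r z => by simp
      map_zero' := by simp
      map_add' := fun x y => by simp
      map_mul' := fun x y => by simp [hmem _ x.2, hmem _ y.2] }
  refine ⟨φ, ⟨fun X => ?_, fun a => ?_, fun a => ?_⟩, ?_⟩
  · change (Φ (D.pR R X).1).snd = P X
    rw [coe_pR, hΦ, hp, Unitization.snd_inr]
  · change (Φ (D.sR R a).1).snd = S a
    rw [coe_sR, hΦ, hs, Unitization.snd_inr]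
  · change (Φ (D.sdR R a).1).snd = Sd a
    rw [coe_sdR, hΦ, hsd, Unitization.snd_inr]
  · rintro φ' ⟨h1, h2, h3⟩
    ext ⟨z, hz⟩
    refine NonUnitalAlgebra.adjoin_induction (R := R)
      (p := fun x hx => φ' ⟨x, hx⟩ = φ ⟨x, hx⟩) ?_ ?_ ?_ ?_ ?_ hz
    · rintro _ ⟨x, rfl⟩
      have hφ : φ ⟨D.gen R x, NonUnitalAlgebra.subset_adjoin R ⟨x, rfl⟩⟩ = ψ x := by
        change (Φ (D.gen R x)).snd = ψ x
        rw [gen, hΦ]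
        simp [Ψ]
      rw [hφ]
      cases x with
      | p X => exact h1 X
      | s a => exact h2 a
      | sd a => exact h3 a
    · intro x y hx hy h4 h5
      exact (map_add φ' ⟨x, hx⟩ ⟨y, hy⟩).trans
        ((congrArg₂ (· + ·) h4 h5).trans (map_add φ ⟨x, hx⟩ ⟨y, hy⟩).symm)
    · exact (map_zero φ').trans (map_zero φ).symm
    · intro x y hx hy h4 h5
      exact (map_mul φ' ⟨x, hx⟩ ⟨y, hy⟩).trans
        ((congrArg₂ (· * ·) h4 h5).trans (map_mul φ ⟨x, hx⟩ ⟨y, hy⟩).symm)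
    · intro r x hx h4
      exact (map_smul φ' r ⟨x, hx⟩).trans
        ((congrArg (r • ·) h4).trans (map_smul φ r ⟨x, hx⟩).symm)

end BooleanDynamicalSystem

open InverseSemigroup

/-!
The inverse semigroup `T` acts on the functions on its tight groupoid by left translation, and this
is a Cuntz–Krieger family: the relations at a regular set say that finitely many idempotents cover
another one, which is exactly what tight filters see. Evaluating the resulting representation of
`R(B, L, θ)` at the characteristic function of the unit space gives a multiplicative map to the
functions on the groupoid that sends `s_α p_X s_β^*` to the characteristic function of its
bisection. As `T` is `E*`-unitary, the bisections are compact open and closed under intersection,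
so their characteristic functions span the Steinberg algebra, which is thus the image.

For injectivity, a linear relation among the characteristic functions of the bisections has to hold
among the elements `s_α p_X s_β^*` of `R(B, L, θ)`. The map `t ↦ s_α p_X s_β^*` is well defined on
`T`, since the gauge action on the universal C*-algebra and a faithful representation on boundary
paths recover the triple `(α, X, β)` from `t ≠ 0` up to extension of words. It is moreover a tight
representation: localized at a maximal ideal of the diagonal, it only sees the germs at one tight
filter, the idempotents outside of the ideal, and so does the relation.
-/

namespace InverseSemigroup

variable {S : Type*} [InverseSemigroup S]

theorem star_mul_self_mul_star (s : S) : star s * s * star s = star s := by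
  simpa only [star_star] using mul_star_mul (star s)

theorem star_mul_self_of_idem {e : S} (he : e * e = e) : star e * e = e := by
  rw [idem_star_eq he, he]

theorem star_mul_self_mul_idem (s : S) {e : S} (he : e * e = e) :
    star (s * e) * (s * e) = star s * s * e := by
  rw [star_mul, idem_star_eq he]
  calc e * star s * (s * e) = e * (star s * s) * e := by simp only [mul_assoc]
    _ = star s * s * e := by
      rw [idem_comm e _ he (star_mul_self_idem s), mul_assoc, he]

theorem star_mul_self_idem_mul {e : S} (he : e * e = e) (s : S) :
    star (e * s) * (e * s) = star s * e * s := by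
  rw [star_mul, idem_star_eq he, mul_assoc, ← mul_assoc e, he, ← mul_assoc]

theorem mul_conj_idem (s : S) {e : S} (he : e * e = e) : s * (star s * e * s) = e * s := by
  calc s * (star s * e * s) = s * star s * e * s := by simp only [mul_assoc]
    _ = e * (s * star s * s) := by
      rw [idem_comm _ e (mul_star_self_idem s) he, mul_assoc]
    _ = e * s := by rw [mul_star_mul]

theorem mul_eq_mul_of_star_mul_mul_eq {s t e : S} (he : e * e = e) (h : star t * s * e = e) :
    s * e = t * e := by
  have hstar : e * (star s * t) = e := by
    simpa only [star_mul, star_star, idem_star_eq he] using congrArg star h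
  have hconj : star s * (t * star t) * s * e = e := by
    have hi := conj_idem s (mul_star_self_idem t)
    calc star s * (t * star t) * s * e = star s * (t * star t) * s * e * e := by
          rw [mul_assoc _ e e, he]
      _ = e * (star s * t) * (star t * s * e) := by
          rw [idem_comm _ e hi he]; simp only [mul_assoc]
      _ = e := by rw [hstar, h, he]
  calc s * e = s * (star s * (t * star t) * s) * e := by rw [mul_assoc, hconj]
    _ = t * (star t * s * e) := by
      rw [mul_conj_idem s (mul_star_self_idem t)]; simp only [mul_assoc]
    _ = t * e := by rw [h]

theorem star_mul_mul_eq_of_mul_eq_mul {s t e : S} (he : e * e = e) (h : s * e = t * e) :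
    star t * s * (e * (star t * t)) = e * (star t * t) := by
  calc star t * s * (e * (star t * t)) = star t * (s * e) * (star t * t) := by
        simp only [mul_assoc]
    _ = star t * t * e * (star t * t) := by rw [h]; simp only [mul_assoc]
    _ = e * (star t * t) := by
      rw [← idem_comm e _ he (star_mul_self_idem t), mul_assoc, star_mul_self_idem]

namespace TightFilter

theorem mul_mem_iff (ξ : TightFilter S) {e f : S} (he : e * e = e) (hf : f * f = f) :
    e * f ∈ ξ.carrier ↔ e ∈ ξ.carrier ∧ f ∈ ξ.carrier :=
  ⟨fun h => ⟨mem_of_mul_mem he hf h, mem_of_mul_mem hf he (by rwa [idem_comm f e hf he])⟩,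
    fun h => ξ.mul_mem _ h.1 _ h.2⟩

theorem star_mul_self_mem (ξ : TightFilter S) {e : S} (he : e ∈ ξ.carrier) :
    star e * e ∈ ξ.carrier := by
  rwa [star_mul_self_of_idem (ξ.idem e he)]

theorem star_mul_self_mem_congr (ξ : TightFilter S) {s t e : S} (he : e ∈ ξ.carrier)
    (h : s * e = t * e) : star s * s ∈ ξ.carrier ↔ star t * t ∈ ξ.carrier := by
  have hei := ξ.idem e he
  have key : ∀ r : S, star r * r ∈ ξ.carrier ↔ star (r * e) * (r * e) ∈ ξ.carrier := fun r => by
    rw [star_mul_self_mul_idem r hei, ξ.mul_mem_iff (star_mul_self_idem r) hei, and_iff_left he]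
  rw [key s, key t, h]

theorem star_mul_self_mem_of_mul {ξ : TightFilter S} {r t : S}
    (h : star (r * t) * (r * t) ∈ ξ.carrier) : star t * t ∈ ξ.carrier := by
  refine ξ.upward _ h _ (star_mul_self_idem t) ?_
  calc star (r * t) * (r * t) * (star t * t) = star (r * t) * (r * (t * star t * t)) := by
        simp only [mul_assoc]
    _ = star (r * t) * (r * t) := by rw [mul_star_mul]

end TightFilter

namespace TightGroupoid

open TightFilter

theorem exists_germ (c : TightGroupoid S) : ∃ (s : S) (ξ : TightFilter S)
    (hs : star s * s ∈ ξ.carrier), c = germ s ξ hs := by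
  obtain ⟨⟨s, ξ, hs⟩, rfl⟩ := Quotient.exists_rep c
  exact ⟨s, ξ, hs, rfl⟩

theorem germ_idem_mul {e s : S} {ξ : TightFilter S} (he : e * e = e)
    (h : star s * e * s ∈ ξ.carrier) (hes : star (e * s) * (e * s) ∈ ξ.carrier)
    (hs : star s * s ∈ ξ.carrier) : germ (e * s) ξ hes = germ s ξ hs :=
  germ_eq_iff.2 ⟨rfl, _, h, by rw [mul_assoc, mul_conj_idem s he, ← mul_assoc, he]⟩

/-- The bisection `Θ(t, Dom(t^* t))` of all germs of `t`. -/
def bisection (t : S) : Set (TightGroupoid S) := Θ t (dom (star t * t))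

theorem mem_bisection {t : S} {a : TightGroupoid S} :
    a ∈ bisection t ↔ ∃ (ξ : TightFilter S) (ht : star t * t ∈ ξ.carrier), a = germ t ξ ht :=
  ⟨fun ⟨ξ, ht, _, h⟩ => ⟨ξ, ht, h⟩, fun ⟨ξ, ht, h⟩ => ⟨ξ, ht, ht, h⟩⟩

theorem germ_mem_bisection {s t : S} {ξ : TightFilter S} {hs : star s * s ∈ ξ.carrier} :
    germ s ξ hs ∈ bisection t ↔ ∃ e ∈ ξ.carrier, s * e = t * e := by
  rw [mem_bisection]
  constructor
  · rintro ⟨η, ht, h⟩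
    exact (germ_eq_iff.1 h).2
  · rintro ⟨e, he, h⟩
    exact ⟨ξ, (ξ.star_mul_self_mem_congr he h).1 hs, germ_eq_iff.2 ⟨rfl, e, he, h⟩⟩

theorem germ_mem_bisection_iff_star_mul {s t : S} {ξ : TightFilter S}
    {hs : star s * s ∈ ξ.carrier} :
    germ s ξ hs ∈ bisection t ↔ ∃ e ∈ ξ.carrier, star t * s * e = e := by
  rw [germ_mem_bisection]
  constructor
  · rintro ⟨e, he, h⟩
    have ht := (ξ.star_mul_self_mem_congr he h).1 hs
    exact ⟨_, ξ.mul_mem _ he _ ht, star_mul_mul_eq_of_mul_eq_mul (ξ.idem e he) h⟩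
  · rintro ⟨e, he, h⟩
    exact ⟨e, he, mul_eq_mul_of_star_mul_mul_eq (ξ.idem e he) h⟩

theorem injOn_source_bisection (t : S) : Set.InjOn source (bisection t) := by
  intro a ha b hb hab
  obtain ⟨ξ, hξ, rfl⟩ := mem_bisection.1 ha
  obtain ⟨η, hη, rfl⟩ := mem_bisection.1 hb
  obtain rfl : ξ = η := hab
  rfl

section regular

variable {R : Type*}

open Classical in
/-- The value of `g` at `[s, ξ]`, extended by `0` to the pairs `(s, ξ)` that have no germ. -/
noncomputable def germValue [Zero R] (g : TightGroupoid S → R) (s : S) (ξ : TightFilter S) : R :=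
  if h : star s * s ∈ ξ.carrier then g (germ s ξ h) else 0

theorem germValue_of_mem [Zero R] (g : TightGroupoid S → R) {s : S} {ξ : TightFilter S}
    (h : star s * s ∈ ξ.carrier) : germValue g s ξ = g (germ s ξ h) := dif_pos h

theorem germValue_of_notMem [Zero R] (g : TightGroupoid S → R) {s : S} {ξ : TightFilter S}
    (h : star s * s ∉ ξ.carrier) : germValue g s ξ = 0 := dif_neg h

theorem germValue_congr [Zero R] (g : TightGroupoid S → R) {s t e : S} {ξ : TightFilter S}
    (he : e ∈ ξ.carrier) (h : s * e = t * e) : germValue g s ξ = germValue g t ξ := by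
  have hst := ξ.star_mul_self_mem_congr he h
  by_cases hs : star s * s ∈ ξ.carrier
  · rw [germValue_of_mem g hs, germValue_of_mem g (hst.1 hs),
      germ_eq_iff.2 ⟨rfl, e, he, h⟩]
  · rw [germValue_of_notMem g hs, germValue_of_notMem g (mt hst.2 hs)]

open Classical in
theorem germValue_idem_mul [Zero R] (g : TightGroupoid S → R) {e : S} (he : e * e = e) (s : S)
    (ξ : TightFilter S) :
    germValue g (e * s) ξ = if star s * e * s ∈ ξ.carrier then germValue g s ξ else 0 := by
  split_ifs with h
  · have hes : star (e * s) * (e * s) ∈ ξ.carrier := by rwa [star_mul_self_idem_mul he]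
    have hs := star_mul_self_mem_of_mul hes
    rw [germValue_of_mem g hes, germValue_of_mem g hs, germ_idem_mul he h hes hs]
  · exact germValue_of_notMem g (by rwa [star_mul_self_idem_mul he])

variable [CommRing R]

variable (R) in
/-- The left regular representation of `S` on the functions on its tight groupoid:
`t` sends `g` to the function `[s, ξ] ↦ g [t^* s, ξ]`, extended by `0`. -/
noncomputable def leftRegular (t : S) : Module.End R (TightGroupoid S → R) where
  toFun g := Quotient.lift (fun x : PreGerm S => germValue g (star t * x.elt) x.point) (by
    rintro ⟨s, ξ, hs⟩ ⟨r, η, hr⟩ ⟨h, e, he, hsr⟩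
    obtain rfl : ξ = η := h
    exact germValue_congr g he (by simpa only [mul_assoc] using congrArg (star t * ·) hsr))
  map_add' f g := by
    refine funext (Quotient.ind fun x => ?_)
    change germValue (f + g) _ _ = germValue f _ _ + germValue g _ _
    by_cases h : star (star t * x.elt) * (star t * x.elt) ∈ x.point.carrier
    · simp only [germValue_of_mem _ h, Pi.add_apply]
    · simp only [germValue_of_notMem _ h, add_zero]
  map_smul' r g := by
    refine funext (Quotient.ind fun x => ?_)
    change germValue (r • g) _ _ = r • germValue g _ _
    by_cases h : star (star t * x.elt) * (star t * x.elt) ∈ x.point.carrier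
    · simp only [germValue_of_mem _ h, Pi.smul_apply]
    · simp only [germValue_of_notMem _ h, smul_zero]

theorem leftRegular_germ (t : S) (g : TightGroupoid S → R) (s : S) (ξ : TightFilter S)
    (hs : star s * s ∈ ξ.carrier) :
    leftRegular R t g (germ s ξ hs) = germValue g (star t * s) ξ := rfl

theorem germValue_leftRegular (t : S) (g : TightGroupoid S → R) (s : S) (ξ : TightFilter S) :
    germValue (leftRegular R t g) s ξ = germValue g (star t * s) ξ := by
  by_cases hs : star s * s ∈ ξ.carrier
  · rw [germValue_of_mem _ hs, leftRegular_germ]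
  · rw [germValue_of_notMem _ hs, germValue_of_notMem _ (mt star_mul_self_mem_of_mul hs)]

theorem leftRegular_mul (r t : S) :
    leftRegular R (r * t) = leftRegular R r * leftRegular R t := by
  ext g c
  obtain ⟨s, ξ, hs, rfl⟩ := exists_germ c
  rw [Module.End.mul_apply, leftRegular_germ, leftRegular_germ, germValue_leftRegular, star_mul,
    mul_assoc]

open Classical in
theorem leftRegular_idem_apply {e : S} (he : e * e = e) (g : TightGroupoid S → R)
    (c : TightGroupoid S) :
    leftRegular R e g c = if e ∈ (range c).carrier then g c else 0 := by
  obtain ⟨s, ξ, hs, rfl⟩ := exists_germ c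
  rw [leftRegular_germ, idem_star_eq he, germValue_idem_mul g he, germValue_of_mem g hs]
  exact if_congr (and_iff_right he).symm rfl rfl

theorem leftRegular_zero : leftRegular R (0 : S) = 0 := by
  classical
  ext g c
  rw [leftRegular_idem_apply (mul_zero 0), if_neg (range c).zero_notMem]
  rfl

variable (S) in
/-- The unit space of the tight groupoid: the germs `[e, ξ]` of idempotents `e`. -/
def units : Set (TightGroupoid S) :=
  {c | ∃ (ξ : TightFilter S) (e : S) (he : star e * e ∈ ξ.carrier), e * e = e ∧ c = germ e ξ he}

theorem germ_mem_units {s : S} {ξ : TightFilter S} {hs : star s * s ∈ ξ.carrier} :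
    germ s ξ hs ∈ units S ↔ ∃ e ∈ ξ.carrier, s * e = e := by
  constructor
  · rintro ⟨η, e, he, hei, h⟩
    obtain ⟨rfl, f, hf, hsf⟩ := germ_eq_iff.1 h
    rw [star_mul_self_of_idem hei] at he
    have hef := ξ.mul_mem _ he _ hf
    refine ⟨e * f, hef, ?_⟩
    calc s * (e * f) = s * f * e := by rw [idem_comm e f hei (ξ.idem f hf), mul_assoc]
      _ = e * (f * e) := by rw [hsf, mul_assoc]
      _ = e * f := by rw [← idem_comm e f hei (ξ.idem f hf), ← mul_assoc, hei]
  · rintro ⟨e, he, h⟩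
    have hei := ξ.idem e he
    exact ⟨ξ, e, ξ.star_mul_self_mem he, hei, germ_eq_iff.2 ⟨rfl, e, he, by rw [h, hei]⟩⟩

open Classical in
theorem germValue_indicator_units (s : S) (ξ : TightFilter S) :
    germValue ((units S).indicator (1 : TightGroupoid S → R)) s ξ =
      if ∃ e ∈ ξ.carrier, s * e = e then 1 else 0 := by
  by_cases hs : star s * s ∈ ξ.carrier
  · rw [germValue_of_mem _ hs, Set.indicator_apply, germ_mem_units]
    rfl
  · rw [germValue_of_notMem _ hs, if_neg]
    rintro ⟨e, he, h⟩
    exact hs ((ξ.star_mul_self_mem_congr he (h.trans (ξ.idem e he).symm)).2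
      (ξ.star_mul_self_mem he))

theorem leftRegular_indicator_units (t : S) :
    leftRegular R t ((units S).indicator 1) = (bisection t).indicator 1 := by
  classical
  funext c
  obtain ⟨s, ξ, hs, rfl⟩ := exists_germ c
  rw [leftRegular_germ, germValue_indicator_units, Set.indicator_apply,
    germ_mem_bisection_iff_star_mul, Pi.one_apply]

theorem IsComp.exists_eq_germ {a b c : TightGroupoid S} (h : IsComp a b c) {t : S}
    (ha : a ∈ bisection t) : ∃ (r : S) (ξ : TightFilter S) (hr : star r * r ∈ ξ.carrier)
      (ht : star t * t ∈ (ξ.act r hr).carrier),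
      b = germ r ξ hr ∧ c = germ (t * r) ξ (mem_of_comp ht) := by
  obtain ⟨η, ht, rfl⟩ := mem_bisection.1 ha
  obtain ⟨r, ξ, hr, rfl⟩ := exists_germ b
  obtain rfl : η = ξ.act r hr := h.source_eq_range
  exact ⟨r, ξ, hr, ht, rfl, (existsUnique_isComp _ _ h.source_eq_range).unique h
    ⟨t, r, ξ, hr, ht, rfl, rfl, rfl⟩⟩

theorem IsComp.right_eq {a b : TightGroupoid S} {s t : S} {ξ : TightFilter S}
    {hs : star s * s ∈ ξ.carrier} (h : IsComp a b (germ s ξ hs)) (ha : a ∈ bisection t) :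
    ∃ hts : star (star t * s) * (star t * s) ∈ ξ.carrier, b = germ (star t * s) ξ hts := by
  obtain ⟨r, η, hr, ht, rfl, hc⟩ := h.exists_eq_germ ha
  obtain ⟨rfl, e, he, hse⟩ := germ_eq_iff.1 hc
  have hmem := ξ.mul_mem _ he _ ht.2
  have hcomm := idem_comm _ _ (ξ.idem e he) (conj_idem r (star_mul_self_idem t))
  have hr' : r * (e * (star r * (star t * t) * r)) = star t * t * r * e := by
    rw [hcomm, ← mul_assoc, mul_conj_idem r (star_mul_self_idem t)]
  have key : r * (e * (star r * (star t * t) * r)) =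
      star t * s * (e * (star r * (star t * t) * r)) := by
    calc r * (e * (star r * (star t * t) * r)) =
          star t * t * (r * (e * (star r * (star t * t) * r))) := by
          rw [hr', mul_assoc (star t * t) r, ← mul_assoc (star t * t) (star t * t),
            star_mul_self_idem]
      _ = star t * (t * r * e) * (star r * (star t * t) * r) := by simp only [mul_assoc]
      _ = star t * s * (e * (star r * (star t * t) * r)) := by
          rw [← hse]; simp only [mul_assoc]
  exact ⟨(ξ.star_mul_self_mem_congr hmem key).1 hr, germ_eq_iff.2 ⟨rfl, _, hmem, key⟩⟩

theorem exists_isComp_germ {s t : S} {ξ : TightFilter S} (hs : star s * s ∈ ξ.carrier)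
    (hts : star (star t * s) * (star t * s) ∈ ξ.carrier) :
    ∃ a ∈ bisection t, IsComp a (germ (star t * s) ξ hts) (germ s ξ hs) := by
  have htt : star (star t * s) * (star t * t) * (star t * s) =
      star (star t * s) * (star t * s) := by
    calc _ = star (star t * s) * (star t * t * star t * s) := by simp only [mul_assoc]
      _ = _ := by rw [star_mul_self_mul_star]
  have ht : star t * t ∈ (ξ.act _ hts).carrier := ⟨star_mul_self_idem t, by rwa [htt]⟩
  have hconj : star s * (t * star t) * s ∈ ξ.carrier := by
    simpa only [star_mul, star_star, mul_assoc] using hts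
  refine ⟨germ t _ ht, mem_bisection.2 ⟨_, ht, rfl⟩, t, star t * s, ξ, hts, ht, rfl, rfl, ?_⟩
  refine germ_eq_iff.2 ⟨rfl, _, hconj, ?_⟩
  rw [← mul_assoc t, mul_assoc _ s, mul_conj_idem s (mul_star_self_idem t), ← mul_assoc,
    mul_star_self_idem]

theorem subsingleton_isComp_bisection (t : S) (c : TightGroupoid S) :
    {x : {x : TightGroupoid S × TightGroupoid S // IsComp x.1 x.2 c} |
      x.1.1 ∈ bisection t}.Subsingleton := by
  obtain ⟨s, ξ, hs, rfl⟩ := exists_germ c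
  rintro ⟨⟨a, b⟩, hx⟩ ha ⟨⟨a', b'⟩, hx'⟩ ha'
  obtain rfl : b = b' := by
    obtain ⟨_, h⟩ := hx.right_eq ha
    obtain ⟨_, h'⟩ := hx'.right_eq ha'
    exact h.trans h'.symm
  obtain rfl : a = a' :=
    injOn_source_bisection t ha ha' (hx.source_eq_range.trans hx'.source_eq_range.symm)
  rfl

theorem convolution_indicator_bisection (t : S) (g : TightGroupoid S → R) :
    convolution ((bisection t).indicator 1) g = leftRegular R t g := by
  funext c
  have hsub := subsingleton_isComp_bisection t c
  obtain ⟨s, ξ, hs, rfl⟩ := exists_germ c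
  rw [leftRegular_germ, convolution]
  by_cases hts : star (star t * s) * (star t * s) ∈ ξ.carrier
  · obtain ⟨a, ha, hc⟩ := exists_isComp_germ hs hts
    rw [germValue_of_mem g hts, finsum_eq_single _ ⟨(a, _), hc⟩]
    · rw [Set.indicator_of_mem ha, Pi.one_apply, one_mul]
      rfl
    · intro x hx
      rw [Set.indicator_of_notMem (s := bisection t) fun hx' => hx (hsub hx' ha), zero_mul]
  · rw [germValue_of_notMem g hts]
    refine finsum_eq_zero_of_forall_eq_zero fun x => ?_
    rw [Set.indicator_of_notMem (s := bisection t) fun hx => hts (x.2.right_eq hx).1, zero_mul]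

variable (S R) in
/-- The `R`-linear map from the semigroup algebra of `S` to the functions on its tight groupoid that
sends `t` to the characteristic function of `bisection t`. -/
noncomputable def bisectionSum : (S →₀ R) →ₗ[R] (TightGroupoid S → R) :=
  Finsupp.linearCombination R fun t => (bisection t).indicator 1

theorem bisectionSum_single (t : S) :
    bisectionSum S R (Finsupp.single t 1) = (bisection t).indicator 1 := by
  rw [bisectionSum, Finsupp.linearCombination_single, one_smul]

theorem indicator_bisection_mem (t : S) :
    (bisection t).indicator 1 ∈ LinearMap.range (bisectionSum S R) :=
  ⟨_, bisectionSum_single t⟩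

theorem convolution_bisectionSum (c : S →₀ R) (g : TightGroupoid S → R) :
    convolution (bisectionSum S R c) g = Finsupp.linearCombination R (leftRegular R) c g := by
  funext a
  have hfin : ∀ t ∈ c.support, (Function.support fun x :
      {x : TightGroupoid S × TightGroupoid S // IsComp x.1 x.2 a} =>
      c t • ((bisection t).indicator 1 x.1.1 * g x.1.2)).Finite := fun t _ =>
    (subsingleton_isComp_bisection t a).finite.subset fun x hx => by
      by_contra h
      exact hx (by simp only [Set.indicator_of_notMem (s := bisection t) h, zero_mul, smul_zero])
  simp only [convolution, bisectionSum, Finsupp.linearCombination_apply, Finsupp.sum,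
    Finset.sum_apply, Pi.smul_apply, Finset.sum_mul, smul_mul_assoc, LinearMap.sum_apply,
    LinearMap.smul_apply, ← convolution_indicator_bisection]
  rw [finsum_sum_comm _ _ hfin]
  exact Finset.sum_congr rfl fun t _ =>
    (smul_finsum' _ ((subsingleton_isComp_bisection t a).finite.subset fun x hx => by
      by_contra h
      exact hx (by simp only [Set.indicator_of_notMem (s := bisection t) h, zero_mul]))).symm

end regular

end TightGroupoid

end InverseSemigroup

namespace InverseSemigroup

/-- `S` is `E*`-unitary: the elements above a nonzero idempotent are idempotent. This is what makes
the tight groupoid of `S` Hausdorff. -/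
def IsEStarUnitary (S : Type*) [InverseSemigroup S] : Prop :=
  ∀ s e : S, e * e = e → e ≠ 0 → s * e = e → s * s = s

variable {S : Type*} [InverseSemigroup S]

/-- `Z` is a finite set of idempotents that meets every nonzero idempotent below `e`. Unlike in
`IsCover`, the elements of `Z` need not lie below `e`. -/
structure IsFiniteCover (Z : Set S) (e : S) : Prop where
  finite : Z.Finite
  idem : ∀ z ∈ Z, z * z = z
  exists_mul_ne_zero : ∀ f, f * f = f → f * e = f → f ≠ 0 → ∃ z ∈ Z, f * z ≠ 0

namespace TightFilter

theorem exists_mem_of_isFiniteCover (ξ : TightFilter S) {e : S} (he : e ∈ ξ.carrier) {Z : Set S}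
    (hZ : IsFiniteCover Z e) : ∃ z ∈ Z, z ∈ ξ.carrier := by
  have hei := ξ.idem e he
  have hc : IsCover ((e * ·) '' Z) (between {e} ∅) := by
    refine ⟨?_, fun f ⟨hfi, hfe, _⟩ hf => ?_⟩
    · rintro _ ⟨z, hz, rfl⟩
      refine ⟨idem_mul_idem hei (hZ.idem z hz), ?_, fun _ h => h.elim⟩
      rintro _ rfl
      rw [mul_assoc, ← idem_comm _ z hei (hZ.idem z hz), ← mul_assoc, hei]
    · obtain ⟨z, hz, hfz⟩ := hZ.exists_mul_ne_zero f hfi (hfe e rfl) hf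
      exact ⟨_, ⟨z, hz, rfl⟩, by rwa [← mul_assoc, hfe e rfl]⟩
  obtain ⟨_, ⟨z, hz, rfl⟩, h⟩ := ξ.tight {e} ∅ _ (Set.finite_singleton e) Set.finite_empty
    (hZ.finite.image _) (by rintro _ rfl; exact hei) (fun _ h => h.elim) hc
    (Set.singleton_subset_iff.2 he) (Set.empty_disjoint _)
  exact ⟨z, hz, ((ξ.mul_mem_iff hei (hZ.idem z hz)).1 h).2⟩

/-- The limit of an ultrafilter of tight filters that contain a fixed idempotent. -/
def ultraLimit (𝒰 : Ultrafilter (TightFilter S)) (e : S) (he : dom e ∈ 𝒰) : TightFilter S where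
  carrier := {f | dom f ∈ 𝒰}
  idem f hf := by
    obtain ⟨ξ, hξ⟩ := 𝒰.nonempty_of_mem hf
    exact ξ.idem f hξ
  nonempty := ⟨e, he⟩
  zero_notMem h := by
    obtain ⟨ξ, hξ⟩ := 𝒰.nonempty_of_mem h
    exact ξ.zero_notMem hξ
  mul_mem f hf g hg := by
    filter_upwards [hf, hg] with ξ hfξ hgξ using ξ.mul_mem f hfξ g hgξ
  upward f hf g hg h := by
    filter_upwards [hf] with ξ hfξ using ξ.upward f hfξ g hg h
  tight X Y Z hX hY hZ hXi hYi hc hXs hYs := by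
    have hX' : ∀ᶠ ξ in (𝒰 : Filter (TightFilter S)), ∀ x ∈ X, x ∈ ξ.carrier :=
      (Filter.eventually_all_finite hX).2 fun x hx => hXs hx
    have hY' : ∀ᶠ ξ in (𝒰 : Filter (TightFilter S)), ∀ y ∈ Y, y ∉ ξ.carrier :=
      (Filter.eventually_all_finite hY).2 fun y hy =>
        Ultrafilter.compl_mem_iff_notMem.2 (Set.disjoint_left.1 hYs hy)
    have hZ' : (⋃ z ∈ Z, dom z) ∈ 𝒰 := by
      filter_upwards [hX', hY'] with ξ hXξ hYξ
      obtain ⟨z, hz, hzξ⟩ := ξ.tight X Y Z hX hY hZ hXi hYi hc hXξ (Set.disjoint_left.2 hYξ)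
      exact Set.mem_biUnion hz hzξ
    exact (Ultrafilter.finite_biUnion_mem_iff hZ).1 hZ'

theorem isCompact_dom (e : S) : IsCompact (dom e) := by
  rw [isCompact_iff_ultrafilter_le_nhds]
  intro 𝒰 h𝒰
  have he : dom e ∈ 𝒰 := Filter.le_principal_iff.1 h𝒰
  refine ⟨ultraLimit 𝒰 e he, he, ?_⟩
  rw [TopologicalSpace.nhds_generateFrom]
  refine le_iInf₂ fun U hU => Filter.le_principal_iff.2 ?_
  obtain ⟨hξ, f, -, rfl | rfl⟩ := hU
  · exact hξ
  · exact Ultrafilter.compl_mem_iff_notMem.2 hξ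

theorem isOpen_dom {e : S} (he : e * e = e) : IsOpen (dom e) :=
  TopologicalSpace.isOpen_generateFrom_of_mem ⟨e, he, Or.inl rfl⟩

theorem isOpen_dom_compl {e : S} (he : e * e = e) : IsOpen (dom e)ᶜ :=
  TopologicalSpace.isOpen_generateFrom_of_mem ⟨e, he, Or.inr rfl⟩

end TightFilter

theorem IsEStarUnitary.exists_idem_mem_iff (hS : IsEStarUnitary S) (u : S) :
    ∃ h : S, h * h = h ∧
      ∀ ξ : TightFilter S, (∃ e ∈ ξ.carrier, u * e = e) ↔ h ∈ ξ.carrier := by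
  by_cases hu : u * u = u
  · refine ⟨u, hu, fun ξ => ⟨fun ⟨e, he, hue⟩ => ξ.upward e he u hu ?_, fun h => ⟨u, h, hu⟩⟩⟩
    rw [idem_comm e u (ξ.idem e he) hu, hue]
  · refine ⟨0, mul_zero 0, fun ξ => ⟨fun ⟨e, he, hue⟩ => (hu ?_).elim,
      fun h => (ξ.zero_notMem h).elim⟩⟩
    exact hS u e (ξ.idem e he) (fun h0 => ξ.zero_notMem (h0 ▸ he)) hue

namespace TightGroupoid

open TightFilter

theorem germ_mem_bisection_self {s : S} {ξ : TightFilter S} (hs : star s * s ∈ ξ.carrier) :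
    germ s ξ hs ∈ bisection s :=
  mem_bisection.2 ⟨ξ, hs, rfl⟩

theorem Θ_eq_inter (t : S) (U : Set (TightFilter S)) : Θ t U = bisection t ∩ source ⁻¹' U := by
  ext c
  constructor
  · rintro ⟨ξ, ht, hξ, rfl⟩
    exact ⟨germ_mem_bisection_self ht, hξ⟩
  · rintro ⟨hc, hU⟩
    obtain ⟨ξ, ht, rfl⟩ := mem_bisection.1 hc
    exact ⟨ξ, ht, hU, rfl⟩

theorem bisection_mul_idem (t : S) {e : S} (he : e * e = e) :
    bisection (t * e) = bisection t ∩ source ⁻¹' dom e := by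
  ext c
  obtain ⟨s, ξ, hs, rfl⟩ := exists_germ c
  rw [Set.mem_inter_iff, germ_mem_bisection, germ_mem_bisection]
  constructor
  · rintro ⟨f, hf, h⟩
    have hmem := (ξ.star_mul_self_mem_congr hf h).1 hs
    rw [star_mul_self_mul_idem t he, ξ.mul_mem_iff (star_mul_self_idem t) he] at hmem
    refine ⟨⟨e * f, ξ.mul_mem _ hmem.2 _ hf, ?_⟩, hmem.2⟩
    calc s * (e * f) = s * f * e := by rw [idem_comm e f he (ξ.idem f hf), mul_assoc]
      _ = t * (e * f) := by
        rw [h, mul_assoc t e f, mul_assoc, mul_assoc, ← idem_comm e f he (ξ.idem f hf),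
          ← mul_assoc e e, he]
  · rintro ⟨⟨f, hf, h⟩, hξ⟩
    refine ⟨e * f, ξ.mul_mem _ hξ _ hf, ?_⟩
    calc s * (e * f) = s * f * e := by rw [idem_comm e f he (ξ.idem f hf), mul_assoc]
      _ = t * e * (e * f) := by
        rw [h, mul_assoc, ← idem_comm e f he (ξ.idem f hf), mul_assoc t e, ← mul_assoc e e, he]

theorem exists_bisection_inter (hS : IsEStarUnitary S) (s t : S) :
    ∃ h : S, h * h = h ∧ bisection s ∩ bisection t = bisection (s * h) := by
  obtain ⟨h, hh, hmem⟩ := hS.exists_idem_mem_iff (star t * s)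
  refine ⟨h, hh, ?_⟩
  rw [bisection_mul_idem s hh]
  ext c
  refine and_congr_right fun hc => ?_
  obtain ⟨ξ, hs, rfl⟩ := mem_bisection.1 hc
  rw [germ_mem_bisection_iff_star_mul, hmem]
  rfl

theorem isOpen_Θ (t : S) {U : Set (TightFilter S)} (hU : IsOpen U) : IsOpen (Θ t U) := by
  refine TopologicalSpace.isOpen_generateFrom_of_mem
    ⟨t, U ∩ dom (star t * t), hU.inter (isOpen_dom (star_mul_self_idem t)),
      Set.inter_subset_right, ?_⟩
  ext c
  exact ⟨fun ⟨ξ, ht, hU, h⟩ => ⟨ξ, ht, ⟨hU, ht⟩, h⟩, fun ⟨ξ, ht, hU, h⟩ => ⟨ξ, ht, hU.1, h⟩⟩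

theorem isOpen_bisection (t : S) : IsOpen (bisection t) :=
  isOpen_Θ t (isOpen_dom (star_mul_self_idem t))

theorem isClosed_bisection (hS : IsEStarUnitary S) (t : S) : IsClosed (bisection t) := by
  rw [← isOpen_compl_iff, isOpen_iff_forall_mem_open]
  intro c hc
  obtain ⟨s, ξ, hs, rfl⟩ := exists_germ c
  obtain ⟨h, hh, hst⟩ := exists_bisection_inter hS s t
  rw [bisection_mul_idem s hh] at hst
  refine ⟨Θ s (dom h)ᶜ, ?_, isOpen_Θ s (isOpen_dom_compl hh), ?_⟩
  · rw [Θ_eq_inter]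
    exact fun a ha hat => ha.2 (hst.subset ⟨ha.1, hat⟩).2
  · rw [Θ_eq_inter]
    have hmem := germ_mem_bisection_self hs
    exact ⟨hmem, fun hd => hc (hst.superset ⟨hmem, hd⟩).2⟩

theorem isCompact_bisection (hS : IsEStarUnitary S) (t : S) : IsCompact (bisection t) := by
  have hcont : Continuous fun ξ : dom (star t * t) => germ t ξ.1 ξ.2 := by
    refine continuous_generateFrom_iff.2 ?_
    rintro _ ⟨s, U, hU, -, rfl⟩
    obtain ⟨h, hh, hts⟩ := exists_bisection_inter hS t s
    rw [bisection_mul_idem t hh] at hts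
    have hpre : (fun ξ : dom (star t * t) => germ t ξ.1 ξ.2) ⁻¹' Θ s U =
        Subtype.val ⁻¹' (dom h ∩ U) := by
      ext ξ
      have hmem := germ_mem_bisection_self ξ.2
      rw [Θ_eq_inter]
      exact ⟨fun hξ => ⟨(hts.subset ⟨hmem, hξ.1⟩).2, hξ.2⟩,
        fun hξ => ⟨(hts.superset ⟨hmem, hξ.1⟩).2, hξ.2⟩⟩
    rw [hpre]
    exact ((isOpen_dom hh).inter hU).preimage continuous_subtype_val
  have hrange : bisection t = Set.range fun ξ : dom (star t * t) => germ t ξ.1 ξ.2 := by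
    ext c
    rw [mem_bisection, Set.mem_range, Subtype.exists]
    simp only [dom, Set.mem_ofPred_eq, eq_comm]
  have := isCompact_iff_compactSpace.1 (isCompact_dom (star t * t))
  exact hrange ▸ isCompact_range hcont

section steinberg

variable {R : Type*} [CommRing R]

theorem indicator_mem_steinbergAlgebra (hS : IsEStarUnitary S) (t : S) :
    (bisection t).indicator 1 ∈ SteinbergAlgebra R S := by
  have hconst : IsLocallyConstant ((bisection t).indicator (1 : TightGroupoid S → R)) :=
    (LocallyConstant.indicator 1 ⟨isClosed_bisection hS t, isOpen_bisection t⟩).isLocallyConstant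
  exact ⟨hconst, (isCompact_bisection hS t).of_isClosed_subset
    (hconst.isOpen_fiber 0).isClosed_compl Set.support_indicator_subset⟩

theorem mul_mem_range_bisectionSum (hS : IsEStarUnitary S) {f g : TightGroupoid S → R}
    (hf : f ∈ LinearMap.range (bisectionSum S R)) (hg : g ∈ LinearMap.range (bisectionSum S R)) :
    f * g ∈ LinearMap.range (bisectionSum S R) := by
  suffices LinearMap.range (bisectionSum S R) * LinearMap.range (bisectionSum S R) ≤
      LinearMap.range (bisectionSum S R) from this (Submodule.mul_mem_mul hf hg)
  conv_lhs => rw [bisectionSum, Finsupp.range_linearCombination, Submodule.span_mul_span]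
  rw [Submodule.span_le, Set.mul_subset_iff]
  rintro _ ⟨s, rfl⟩ _ ⟨t, rfl⟩
  obtain ⟨h, -, hst⟩ := exists_bisection_inter hS s t
  rw [← Set.inter_indicator_one, hst]
  exact indicator_bisection_mem (s * h)

variable (S R) in
/-- The open sets whose characteristic function is a linear combination of the characteristic
functions of the sets `bisection t`. -/
def spannedOpens : Set (Set (TightGroupoid S)) :=
  {V | IsOpen V ∧ V.indicator 1 ∈ LinearMap.range (bisectionSum S R)}

theorem bisection_mem_spannedOpens (t : S) : bisection t ∈ spannedOpens S R :=
  ⟨isOpen_bisection t, indicator_bisection_mem t⟩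

theorem bisection_diff_mem_spannedOpens (t : S) {e : S} (he : e * e = e) :
    bisection t \ bisection (t * e) ∈ spannedOpens S R := by
  have hsub : bisection (t * e) ⊆ bisection t :=
    (bisection_mul_idem t he).subset.trans Set.inter_subset_left
  constructor
  · have : bisection t \ bisection (t * e) = Θ t (dom e)ᶜ := by
      rw [Θ_eq_inter, bisection_mul_idem t he, Set.sdiff_self_inter, Set.preimage_compl,
        Set.sdiff_eq_compl_inter, Set.inter_comm]
    exact this ▸ isOpen_Θ t (isOpen_dom_compl he)
  · rw [Set.indicator_sdiff hsub]
    exact sub_mem (indicator_bisection_mem t) (indicator_bisection_mem _)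

open scoped Topology in
theorem continuous_source_generateFrom_spannedOpens :
    Continuous[TopologicalSpace.generateFrom (spannedOpens S R), inferInstance]
      (source : TightGroupoid S → TightFilter S) := by
  have isOpen_of_cover : ∀ {W : Set (TightGroupoid S)} (V : S → Set (TightGroupoid S)),
      (∀ t, V t ∈ spannedOpens S R) → (∀ t, V t = bisection t ∩ W) →
      IsOpen[TopologicalSpace.generateFrom (spannedOpens S R)] W := by
    intro W V hV hVW
    have hW : W = ⋃ t, V t := by
      ext c
      obtain ⟨s, ξ, hs, rfl⟩ := exists_germ c
      simp only [hVW, Set.mem_iUnion, Set.mem_inter_iff]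
      exact ⟨fun h => ⟨s, germ_mem_bisection_self hs, h⟩, fun ⟨_, _, h⟩ => h⟩
    rw [hW]
    exact @isOpen_iUnion _ _ (.generateFrom _) _ fun t => .basic _ (hV t)
  refine continuous_generateFrom_iff.2 ?_
  rintro _ ⟨e, he, rfl | rfl⟩
  · exact isOpen_of_cover _ (fun t => bisection_mem_spannedOpens (t * e))
      fun t => bisection_mul_idem t he
  · refine isOpen_of_cover _ (fun t => bisection_diff_mem_spannedOpens t he) fun t => ?_
    rw [bisection_mul_idem t he, Set.sdiff_self_inter, Set.preimage_compl,
      Set.sdiff_eq]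

theorem isTopologicalBasis_spannedOpens (hS : IsEStarUnitary S) :
    TopologicalSpace.IsTopologicalBasis (spannedOpens S R) where
  exists_subset_inter V hV W hW c hc := by
    refine ⟨V ∩ W, ⟨hV.1.inter hW.1, ?_⟩, hc, subset_rfl⟩
    rw [Set.inter_indicator_one]
    exact mul_mem_range_bisectionSum hS hV.2 hW.2
  sUnion_eq := by
    refine Set.eq_univ_of_forall fun c => ?_
    obtain ⟨s, ξ, hs, rfl⟩ := exists_germ c
    exact ⟨_, bisection_mem_spannedOpens s, germ_mem_bisection_self hs⟩
  eq_generateFrom := by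
    refine le_antisymm (le_generateFrom fun V hV => hV.1) (le_generateFrom ?_)
    rintro _ ⟨s, U, hU, -, rfl⟩
    rw [Θ_eq_inter]
    exact TopologicalSpace.GenerateOpen.inter _ _ (.basic _ (bisection_mem_spannedOpens s))
      (@Continuous.isOpen_preimage _ _ (.generateFrom _) _ _
        continuous_source_generateFrom_spannedOpens U hU)

theorem exists_superset_mem_range_bisectionSum (hS : IsEStarUnitary S) {f : TightGroupoid S → R}
    (hf : IsLocallyConstant f) {K : Set (TightGroupoid S)} (hK : IsCompact K) :
    ∃ W ⊇ K, W.indicator 1 ∈ LinearMap.range (bisectionSum S R) ∧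
      f * W.indicator 1 ∈ LinearMap.range (bisectionSum S R) := by
  refine hK.induction_on ?_ ?_ ?_ ?_
  · refine ⟨∅, subset_rfl, ?_⟩
    rw [Set.indicator_empty', mul_zero]
    exact ⟨zero_mem _, zero_mem _⟩
  · rintro K L hKL ⟨W, hLW, hW⟩
    exact ⟨W, hKL.trans hLW, hW⟩
  · rintro K L ⟨V, hKV, hV, hfV⟩ ⟨W, hLW, hW, hfW⟩
    have hVW : (V ∪ W).indicator (1 : TightGroupoid S → R) =
        V.indicator 1 + W.indicator 1 - V.indicator 1 * W.indicator 1 := by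
      rw [← Set.inter_indicator_one, ← Set.indicator_union_add_inter 1 V W, add_sub_cancel_right]
    refine ⟨V ∪ W, Set.union_subset_union hKV hLW, ?_⟩
    rw [hVW, mul_sub, mul_add, ← mul_assoc]
    exact ⟨sub_mem (add_mem hV hW) (mul_mem_range_bisectionSum hS hV hW),
      sub_mem (add_mem hfV hfW) (mul_mem_range_bisectionSum hS hfV hW)⟩
  · intro c _
    obtain ⟨V, hV, hcV, hVf⟩ := (isTopologicalBasis_spannedOpens (R := R) hS)
      |>.exists_subset_of_mem_open (show c ∈ f ⁻¹' {f c} from rfl) (hf.isOpen_fiber (f c))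
    have hfV : f * V.indicator 1 = f c • V.indicator 1 := by
      funext d
      by_cases hd : d ∈ V
      · simp only [Pi.mul_apply, Pi.smul_apply, smul_eq_mul, show f d = f c from hVf hd]
      · simp only [Pi.mul_apply, Pi.smul_apply, smul_eq_mul, Set.indicator_of_notMem hd, mul_zero]
    exact ⟨V, mem_nhdsWithin_of_mem_nhds (hV.1.mem_nhds hcV), V, subset_rfl, hV.2,
      hfV ▸ Submodule.smul_mem _ _ hV.2⟩

theorem range_bisectionSum (hS : IsEStarUnitary S) :
    LinearMap.range (bisectionSum S R) = SteinbergAlgebra R S := by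
  refine le_antisymm ?_ ?_
  · rw [bisectionSum, Finsupp.range_linearCombination, Submodule.span_le]
    rintro _ ⟨t, rfl⟩
    exact indicator_mem_steinbergAlgebra hS t
  · rintro f ⟨hf, hsupp⟩
    obtain ⟨W, hW, -, hfW⟩ := exists_superset_mem_range_bisectionSum hS hf hsupp
    have hf_eq : f * W.indicator 1 = f := by
      rw [← Set.indicator_eq_self.2 hW]
      funext c
      by_cases hc : c ∈ W <;> simp [hc]
    exact hf_eq ▸ hfW

end steinberg

end TightGroupoid

end InverseSemigroup

namespace InverseSemigroup

variable {S : Type*} [InverseSemigroup S]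

theorem exists_mem_forall_mul_eq {F : Set S} (hne : F.Nonempty) (hidem : ∀ e ∈ F, e * e = e)
    (hmul : ∀ e ∈ F, ∀ f ∈ F, e * f ∈ F) {X : Set S} (hX : X.Finite) (hXF : X ⊆ F) :
    ∃ e ∈ F, ∀ x ∈ X, e * x = e := by
  induction X, hX using Set.Finite.induction_on with
  | empty => exact ⟨_, hne.some_mem, fun _ h => h.elim⟩
  | @insert x X _ _ ih =>
    obtain ⟨e, he, heX⟩ := ih ((Set.subset_insert x X).trans hXF)
    have hx := hXF (Set.mem_insert x X)
    refine ⟨e * x, hmul e he x hx, ?_⟩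
    rintro y (rfl | hy)
    · rw [mul_assoc, hidem y hx]
    · rw [mul_assoc, idem_comm x y (hidem x hx) (hidem y (hXF (Or.inr hy))), ← mul_assoc, heX y hy]

theorem exists_mem_of_isCover_between {F : Set S} (hne : F.Nonempty) (hidem : ∀ e ∈ F, e * e = e)
    (hmul : ∀ e ∈ F, ∀ f ∈ F, e * f ∈ F)
    (hcover : ∀ e ∈ F, ∀ Z : Set S, IsFiniteCover Z e → ∃ z ∈ Z, z ∈ F)
    {X Y Z : Set S} (hX : X.Finite) (hY : Y.Finite) (hZ : Z.Finite) (hYi : ∀ y ∈ Y, y * y = y)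
    (hc : IsCover Z (between X Y)) (hXF : X ⊆ F) (hYF : Disjoint Y F) : ∃ z ∈ Z, z ∈ F := by
  obtain ⟨e, he, heX⟩ := exists_mem_forall_mul_eq hne hidem hmul hX hXF
  have hYZ : IsFiniteCover (Y ∪ Z) e := by
    refine ⟨hY.union hZ, ?_, fun f hf hfe hf0 => ?_⟩
    · rintro z (hz | hz)
      exacts [hYi z hz, (hc.1 hz).1]
    · by_cases hfY : ∀ y ∈ Y, f * y = 0
      · have hfX : ∀ x ∈ X, f * x = f := fun x hx => by rw [← hfe, mul_assoc, heX x hx]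
        obtain ⟨z, hz, hfz⟩ := hc.2 f ⟨hf, hfX, hfY⟩ hf0
        exact ⟨z, Or.inr hz, hfz⟩
      · push Not at hfY
        obtain ⟨y, hy, hfy⟩ := hfY
        exact ⟨y, Or.inl hy, hfy⟩
  obtain ⟨z, hz | hz, hzF⟩ := hcover e he _ hYZ
  · exact (Set.disjoint_left.1 hYF hz hzF).elim
  · exact ⟨z, hz, hzF⟩

/-- The restriction of `d` to the idempotents of `S` is a tight representation of the semilattice
of idempotents: it is multiplicative and whatever annihilates a finite cover of `e` annihilates
`e`. -/
structure IsTightOnIdempotents {A : Type*} [Ring A] (d : S → A) : Prop where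
  map_zero : d 0 = 0
  map_idem_mul : ∀ e f, e * e = e → f * f = f → d (e * f) = d e * d f
  mul_eq_zero_of_cover : ∀ e, e * e = e → ∀ Z : Set S, IsFiniteCover Z e →
    ∀ y : A, (∀ z ∈ Z, y * d z = 0) → y * d e = 0

/-- A tight representation of `S` in the multiplicative semigroup of a ring. -/
structure IsTightRepresentation {A : Type*} [Ring A] (π : S → A) : Prop
    extends IsTightOnIdempotents π where
  map_mul : ∀ s t, π (s * t) = π s * π t

theorem one_sub_notMem {C : Type*} [Ring C] {𝔪 : Ideal C} (h𝔪 : 𝔪 ≠ ⊤) {x : C} (hx : x ∈ 𝔪) :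
    1 - x ∉ 𝔪 :=
  fun h => h𝔪 ((Ideal.eq_top_iff_one _).2 (by simpa only [sub_add_cancel] using add_mem h hx))

namespace IsTightOnIdempotents

variable {C : Type*} [CommRing C] {d : S → C}

theorem exists_notMem_of_isFiniteCover (hd : IsTightOnIdempotents d) (𝔪 : Ideal C) [h𝔪 : 𝔪.IsPrime]
    {e : S} (he : e * e = e) (hem : d e ∉ 𝔪) {Z : Set S} (hZ : IsFiniteCover Z e) :
    ∃ z ∈ Z, d z ∉ 𝔪 := by
  classical
  have hq : ∀ z ∈ Z, (∏ z ∈ hZ.finite.toFinset, (1 - d z)) * d z = 0 := fun z hz => by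
    rw [← Finset.mul_prod_erase _ _ (hZ.finite.mem_toFinset.2 hz), mul_right_comm, sub_mul,
      ← hd.map_idem_mul z z (hZ.idem z hz) (hZ.idem z hz), hZ.idem z hz, one_mul, sub_self,
      zero_mul]
  have hqe := hd.mul_eq_zero_of_cover e he Z hZ _ hq
  have hqm := (h𝔪.mem_or_mem (hqe ▸ zero_mem 𝔪)).resolve_right hem
  obtain ⟨z, hz, hzm⟩ := Ideal.IsPrime.prod_mem_iff.1 hqm
  exact ⟨z, hZ.finite.mem_toFinset.1 hz, fun h => one_sub_notMem h𝔪.ne_top h hzm⟩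

theorem map_mul_notMem (hd : IsTightOnIdempotents d) (𝔪 : Ideal C) [h𝔪 : 𝔪.IsPrime] {e f : S}
    (he : e * e = e) (hf : f * f = f) (hem : d e ∉ 𝔪) (hfm : d f ∉ 𝔪) : d (e * f) ∉ 𝔪 := by
  rw [hd.map_idem_mul e f he hf]
  exact fun h => (h𝔪.mem_or_mem h).elim hem hfm

/-- The tight filter of the idempotents that `d` sends outside a prime ideal. -/
def tightFilter (hd : IsTightOnIdempotents d) (𝔪 : Ideal C) [h𝔪 : 𝔪.IsPrime]
    (hne : ∃ e, e * e = e ∧ d e ∉ 𝔪) : TightFilter S where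
  carrier := {e | e * e = e ∧ d e ∉ 𝔪}
  idem _ h := h.1
  nonempty := hne
  zero_notMem h := h.2 (hd.map_zero ▸ zero_mem 𝔪)
  mul_mem _ he _ hf := ⟨idem_mul_idem he.1 hf.1, hd.map_mul_notMem 𝔪 he.1 hf.1 he.2 hf.2⟩
  upward e he f hf hef := ⟨hf, fun h => he.2 (by
    rw [← hef, hd.map_idem_mul e f he.1 hf]
    exact Ideal.mul_mem_left _ _ h)⟩
  tight X Y Z hX hY hZ _ hYi hc hXF hYF := by
    refine exists_mem_of_isCover_between hne (fun _ h => h.1)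
      (fun e he f hf => ⟨idem_mul_idem he.1 hf.1, hd.map_mul_notMem 𝔪 he.1 hf.1 he.2 hf.2⟩)
      (fun e he Z hZ => ?_) hX hY hZ hYi hc hXF hYF
    obtain ⟨z, hz, hzm⟩ := hd.exists_notMem_of_isFiniteCover 𝔪 he.1 he.2 hZ
    exact ⟨z, hz, hZ.idem z hz, hzm⟩

end IsTightOnIdempotents

section localization

variable (R : Type*) [CommRing R] {A : Type*} [Ring A] [Algebra R A] {C : Type*} [CommRing C]

/-- The right annihilator of `x` in a commutative ring `C` that maps to `A`. -/
def rightAnnihilator (ι : C →+* A) (x : A) : Ideal C where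
  carrier := {q | x * ι q = 0}
  add_mem' {p q} hp hq := by
    rw [Set.mem_ofPred_eq] at *
    rw [map_add, mul_add, hp, hq, add_zero]
  zero_mem' := by rw [Set.mem_ofPred_eq, _root_.map_zero, mul_zero]
  smul_mem' p q hq := by
    rw [Set.mem_ofPred_eq] at *
    rw [smul_eq_mul, mul_comm, _root_.map_mul, ← mul_assoc, hq, zero_mul]

/-- The kernel of the map from `A` to its localization, as a right module over the commutative
ring `C`, at a prime ideal. -/
def localKernel (ι : C →+* A) (𝔪 : Ideal C) [h𝔪 : 𝔪.IsPrime] : Submodule R A where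
  carrier := {x | ∃ q ∉ 𝔪, x * ι q = 0}
  add_mem' := by
    rintro x y ⟨p, hp, hxp⟩ ⟨q, hq, hyq⟩
    refine ⟨p * q, fun h => (h𝔪.mem_or_mem h).elim hp hq, ?_⟩
    rw [add_mul, _root_.map_mul, ← mul_assoc, hxp, zero_mul, zero_add, ← _root_.map_mul,
      mul_comm p, _root_.map_mul, ← mul_assoc, hyq, zero_mul]
  zero_mem' := ⟨1, h𝔪.one_notMem, zero_mul _⟩
  smul_mem' := by
    rintro r x ⟨q, hq, hxq⟩
    exact ⟨q, hq, by rw [smul_mul_assoc, hxq, smul_zero]⟩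

theorem eq_zero_of_forall_mem_localKernel (ι : C →+* A) {x : A}
    (h : ∀ (𝔪 : Ideal C) [𝔪.IsPrime], x ∈ localKernel R ι 𝔪) : x = 0 := by
  have htop : rightAnnihilator ι x = ⊤ := by
    by_contra hne
    obtain ⟨𝔪, hmax, hle⟩ := Ideal.exists_le_maximal _ hne
    have := hmax.isPrime
    obtain ⟨q, hq, hxq⟩ := h 𝔪
    exact hq (hle hxq)
  have hone : x * ι 1 = 0 := (Ideal.eq_top_iff_one _).1 htop
  rwa [map_one, mul_one] at hone

end localization

namespace TightGroupoid

open TightFilter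

variable {R : Type*} [CommRing R]

open Classical in
variable (R) in
/-- The germ of `t` at `ξ` as a basis vector, and `0` if `t` has no germ at `ξ`. -/
noncomputable def germVector (ξ : TightFilter S) (t : S) :
    TightGroupoid S →₀ R :=
  if ht : star t * t ∈ ξ.carrier then Finsupp.single (germ t ξ ht) 1 else 0

open Classical in
theorem germVector_apply (ξ : TightFilter S) (t : S) (γ : TightGroupoid S) :
    germVector R ξ t γ = if source γ = ξ then (bisection t).indicator 1 γ else 0 := by
  obtain ⟨s, η, hs, rfl⟩ := exists_germ γ
  have hmem : source (germ s η hs) = ξ → (germ s η hs ∈ bisection t ↔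
      ∃ ht : star t * t ∈ ξ.carrier, germ t ξ ht = germ s η hs) := by
    rintro rfl
    refine ⟨fun h => ?_, fun ⟨ht, h⟩ => h ▸ germ_mem_bisection_self ht⟩
    obtain ⟨ξ, ht, h⟩ := mem_bisection.1 h
    obtain rfl : η = ξ := congrArg source h
    exact ⟨ht, h.symm⟩
  rw [germVector]
  split_ifs with ht hξ hξ
  · rw [Finsupp.single_apply, Set.indicator_apply, hmem hξ, Pi.one_apply]
    simp only [ht, exists_true_left]
  · rw [Finsupp.single_eq_of_ne]
    rintro h
    exact hξ (congrArg source h)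
  · rw [Set.indicator_of_notMem fun h => ht ((hmem hξ).1 h).1, Finsupp.zero_apply]
  · rfl

theorem linearCombination_germVector (ξ : TightFilter S) {c : S →₀ R}
    (hc : bisectionSum S R c = 0) : Finsupp.linearCombination R (germVector R ξ) c = 0 := by
  classical
  ext γ
  have hγ := congrFun hc γ
  rw [bisectionSum, Finsupp.linearCombination_apply, Finsupp.sum, Finset.sum_apply] at hγ
  simp only [Pi.smul_apply] at hγ
  rw [Finsupp.linearCombination_apply, Finsupp.sum, Finsupp.finsetSum_apply]
  simp only [Finsupp.smul_apply, germVector_apply]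
  split_ifs
  · exact hγ
  · exact Finset.sum_eq_zero fun t _ => smul_zero _

theorem linearCombination_eq_zero_of_germ {M : Type*} [AddCommGroup M] [Module R M]
    (ξ : TightFilter S) {φ : S → M} (hzero : ∀ t, star t * t ∉ ξ.carrier → φ t = 0)
    (hgerm : ∀ s t, ∀ e ∈ ξ.carrier, s * e = t * e → φ s = φ t) {c : S →₀ R}
    (hc : bisectionSum S R c = 0) : Finsupp.linearCombination R φ c = 0 := by
  have hφ : ∀ t, φ t = Finsupp.linearCombination R (fun γ : TightGroupoid S => φ γ.out.elt)
      (germVector R ξ t) := by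
    intro t
    by_cases ht : star t * t ∈ ξ.carrier
    · obtain ⟨hξ, e, he, h⟩ := Quotient.exact (Quotient.out_eq (germ t ξ ht))
      rw [germVector, dif_pos ht, Finsupp.linearCombination_single, one_smul]
      have he' : e ∈ ξ.carrier := (congrArg TightFilter.carrier hξ).subset he
      exact (hgerm _ _ e he' h).symm
    · rw [hzero t ht, germVector, dif_neg ht, _root_.map_zero]
  rw [funext hφ, ← Function.comp_def, ← Finsupp.apply_linearCombination,
    linearCombination_germVector ξ hc, _root_.map_zero]

end TightGroupoid

namespace IsTightRepresentation

variable {R : Type*} [CommRing R] {A : Type*} [Ring A] [Algebra R A] {π : S → A}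

theorem exists_isMulCommutative_subring (hπ : IsTightRepresentation π) :
    ∃ (C : Subring A) (_ : IsMulCommutative C), ∀ e, e * e = e → π e ∈ C := by
  refine ⟨Subring.closure (π '' {e | e * e = e}), Subring.isMulCommutative_closure ?_,
    fun e he => Subring.subset_closure ⟨e, he, rfl⟩⟩
  rintro _ ⟨e, he, rfl⟩ _ ⟨f, hf, rfl⟩
  rw [← hπ.map_mul, ← hπ.map_mul, idem_comm e f he hf]

variable {C : Type*} [CommRing C] {ι : C →+* A} {d : S → C}

theorem isTightOnIdempotents_of_comp (hπ : IsTightRepresentation π)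
    (hι : Function.Injective ι) (hd : ∀ e, e * e = e → ι (d e) = π e) :
    IsTightOnIdempotents d where
  map_zero := hι (by rw [hd 0 (mul_zero 0), hπ.map_zero, _root_.map_zero])
  map_idem_mul e f he hf := hι (by
    rw [_root_.map_mul, hd _ (idem_mul_idem he hf), hd e he, hd f hf, hπ.map_mul])
  mul_eq_zero_of_cover e he Z hZ y hy := hι (by
    rw [_root_.map_mul, hd e he, _root_.map_zero]
    refine hπ.mul_eq_zero_of_cover e he Z hZ _ fun z hz => ?_
    rw [← hd z (hZ.idem z hz), ← _root_.map_mul, hy z hz, _root_.map_zero])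

theorem linearCombination_mem_localKernel (hπ : IsTightRepresentation π)
    (hι : Function.Injective ι) (hd : ∀ e, e * e = e → ι (d e) = π e) {c : S →₀ R}
    (hc : TightGroupoid.bisectionSum S R c = 0) (𝔪 : Ideal C) [h𝔪 : 𝔪.IsPrime] :
    Finsupp.linearCombination R π c ∈ localKernel R ι 𝔪 := by
  have hzero : ∀ t, d (star t * t) ∈ 𝔪 → π t ∈ localKernel R ι 𝔪 := fun t ht =>
    ⟨1 - d (star t * t), one_sub_notMem h𝔪.ne_top ht, by
      rw [map_sub, map_one, hd _ (star_mul_self_idem t), mul_sub, mul_one, ← hπ.map_mul,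
        ← mul_assoc, mul_star_mul, sub_self]⟩
  by_cases hne : ∃ e, e * e = e ∧ d e ∉ 𝔪
  · rw [← Submodule.ker_mkQ (localKernel R ι 𝔪), LinearMap.mem_ker,
      Finsupp.apply_linearCombination]
    refine TightGroupoid.linearCombination_eq_zero_of_germ
      ((hπ.isTightOnIdempotents_of_comp hι hd).tightFilter 𝔪 hne) (fun t ht => ?_)
      (fun s t e he hst => ?_) hc
    · rw [Function.comp_apply, Submodule.mkQ_apply, Submodule.Quotient.mk_eq_zero]
      exact hzero t (not_not.1 fun h => ht ⟨star_mul_self_idem t, h⟩)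
    · refine (Submodule.Quotient.eq _).2 ⟨d e, he.2, ?_⟩
      rw [hd e he.1, sub_mul, ← hπ.map_mul, ← hπ.map_mul, hst, sub_self]
  · push Not at hne
    rw [Finsupp.linearCombination_apply]
    exact Submodule.sum_smul_mem _ _ fun t _ => hzero t (hne _ (star_mul_self_idem t))

open scoped IsMulCommutative in
theorem linearCombination_eq_zero (hπ : IsTightRepresentation π) {c : S →₀ R}
    (hc : TightGroupoid.bisectionSum S R c = 0) : Finsupp.linearCombination R π c = 0 := by
  classical
  obtain ⟨C, hC, hmem⟩ := hπ.exists_isMulCommutative_subring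
  have hd : ∀ e, e * e = e →
      C.subtype (if he : e * e = e then ⟨π e, hmem e he⟩ else 0) = π e := fun e he => by
    rw [dif_pos he]
    rfl
  exact eq_zero_of_forall_mem_localKernel R C.subtype fun 𝔪 _ =>
    hπ.linearCombination_mem_localKernel Subtype.val_injective hd hc 𝔪

end IsTightRepresentation

end InverseSemigroup

namespace partialIsometry

variable {Ω : Type*}

theorem sum_norm_elim_le (k : Ω ≃. Ω) (f : lp (fun _ : Ω => ℂ) 2) (s : Finset Ω) :
    ∑ ω ∈ s, ‖(k ω).elim 0 f‖ ^ (2 : ℝ≥0∞).toReal ≤ ‖f‖ ^ (2 : ℝ≥0∞).toReal := by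
  classical
  have hp : 0 < (2 : ℝ≥0∞).toReal := by norm_num
  have hsome : ∀ ω, ‖(k ω).elim 0 f‖ ^ (2 : ℝ≥0∞).toReal ≠ 0 → (k ω).isSome := fun ω h => by
    contrapose! h
    rw [Option.not_isSome_iff_eq_none.1 h, Option.elim_none, norm_zero, Real.zero_rpow hp.ne']
  refine le_trans (le_of_eq ?_) (lp.sum_rpow_le_norm_rpow hp f (s.image k).eraseNone)
  refine Finset.sum_bij_ne_zero (fun ω _ h => (k ω).get (hsome ω h)) ?_ ?_ ?_ ?_
  · intro ω hω h
    rw [Finset.mem_eraseNone, Option.some_get]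
    exact Finset.mem_image_of_mem _ hω
  · intro ω _ h ω' _ h' he
    exact k.inj (b := (k ω).get (hsome ω h)) (by simp) (by rw [he]; simp)
  · intro ω hω h
    rw [Finset.mem_eraseNone, Finset.mem_image] at hω
    obtain ⟨ω', hω', hk⟩ := hω
    exact ⟨ω', hω', by rwa [hk], by simp [hk]⟩
  · intro ω _ h
    obtain ⟨ω', h'⟩ := Option.isSome_iff_exists.1 (hsome ω h)
    simp [h']

end partialIsometry

/-- The operator `f ↦ f ∘ k` on `ℓ²(Ω)` defined by a partial bijection `k` of `Ω`, with value `0`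
where `k` is not defined. Products of operators correspond to `PEquiv.trans` in the same order. -/
noncomputable def partialIsometry {Ω : Type*} (k : Ω ≃. Ω) :
    lp (fun _ : Ω => ℂ) 2 →L[ℂ] lp (fun _ : Ω => ℂ) 2 :=
  LinearMap.mkContinuous
    { toFun := fun f =>
        ⟨fun ω => (k ω).elim 0 f, memℓp_gen' (partialIsometry.sum_norm_elim_le k f)⟩
      map_add' := fun f g => by
        ext ω
        change (k ω).elim 0 (f + g) = (k ω).elim 0 f + (k ω).elim 0 g
        cases k ω with
        | none => exact (add_zero 0).symm
        | some ω' => rfl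
      map_smul' := fun c f => by
        ext ω
        change (k ω).elim 0 (c • f) = c • (k ω).elim 0 f
        cases k ω <;> simp } 1 fun f => by
    rw [one_mul]
    exact lp.norm_le_of_forall_sum_le (by norm_num) (norm_nonneg f)
      (partialIsometry.sum_norm_elim_le k f)

section

variable {Ω : Type*}

theorem partialIsometry_apply (k : Ω ≃. Ω) (f : lp (fun _ : Ω => ℂ) 2) (ω : Ω) :
    partialIsometry k f ω = (k ω).elim 0 f := rfl

theorem partialIsometry_mul (k l : Ω ≃. Ω) :
    partialIsometry k * partialIsometry l = partialIsometry (k.trans l) := by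
  ext f ω
  change (k ω).elim 0 (partialIsometry l f) = ((k ω).bind l).elim 0 f
  cases k ω <;> rfl

theorem partialIsometry_mul_symm_mul (k : Ω ≃. Ω) :
    partialIsometry k * partialIsometry k.symm * partialIsometry k = partialIsometry k := by
  rw [partialIsometry_mul, partialIsometry_mul, PEquiv.self_trans_symm]
  refine congrArg partialIsometry (PEquiv.ext fun ω => Option.ext fun ω' => ?_)
  simp only [PEquiv.trans_eq_some, PEquiv.ofSet_eq_some_iff, Set.mem_ofPred_eq]
  exact ⟨fun ⟨_, ⟨rfl, _⟩, h⟩ => h, fun h => ⟨ω, ⟨rfl, Option.isSome_of_mem h⟩, h⟩⟩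

theorem partialIsometry_bot : partialIsometry (⊥ : Ω ≃. Ω) = 0 := rfl

theorem star_partialIsometry (k : Ω ≃. Ω) : star (partialIsometry k) = partialIsometry k.symm := by
  symm
  rw [ContinuousLinearMap.star_eq_adjoint, ContinuousLinearMap.eq_adjoint_iff]
  intro x y
  rw [lp.inner_eq_tsum, lp.inner_eq_tsum]
  have hsome : ∀ ω : Function.support fun ω => inner ℂ (x ω) (partialIsometry k y ω),
      (k ω.1).isSome := by
    refine fun ω => by_contra fun h => ω.2 ?_
    simp only
    rw [partialIsometry_apply, Option.not_isSome_iff_eq_none.1 h, Option.elim_none,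
      inner_zero_right]
  refine tsum_eq_tsum_of_ne_zero_bij (fun ω => (k ω.1).get (hsome ω)) ?_ ?_ ?_
  · intro ω ω' he
    simp only at he
    exact Subtype.ext (k.inj (b := (k ω.1).get (hsome ω)) (by simp) (by rw [he]; simp))
  · intro ω h
    cases h' : k.symm ω with
    | none =>
      simp only [Function.mem_support, partialIsometry_apply, h'] at h
      exact absurd (by simp) h
    | some ω' =>
      have h'' := k.eq_some_iff.1 h'
      refine ⟨⟨ω', ?_⟩, by simp [h'']⟩
      simp only [Function.mem_support, partialIsometry_apply, h', h'', Option.elim_some] at h ⊢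
      exact h
  · intro ω
    obtain ⟨ω', h'⟩ := Option.isSome_iff_exists.1 (hsome ω)
    have h'' := k.eq_some_iff.2 h'
    simp [partialIsometry_apply, h', h'']

end

namespace BooleanDynamicalSystem

variable {B : Type u} {L : Type v} [GeneralizedBooleanAlgebra B]

/-- The prime filters of a generalized Boolean algebra, as sets: the preimages of `{1}` under its
nonzero homomorphisms to the two-element Boolean algebra. They are the points of its Stone space,
at which boundary paths are based. -/
structure IsPrimeFilter (χ : Set B) : Prop where
  nonempty : χ.Nonempty
  bot_notMem : ⊥ ∉ χ
  inf_mem_iff : ∀ X Y, X ⊓ Y ∈ χ ↔ X ∈ χ ∧ Y ∈ χ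
  sup_mem_iff : ∀ X Y, X ⊔ Y ∈ χ ↔ X ∈ χ ∨ Y ∈ χ

theorem IsPrimeFilter.mem_of_le {χ : Set B} (h : IsPrimeFilter χ) {X Y : B} (hX : X ∈ χ)
    (hXY : X ≤ Y) : Y ∈ χ :=
  ((h.inf_mem_iff X Y).1 (by rwa [inf_eq_left.2 hXY])).2

theorem IsPrimeFilter.eq_of_subset {χ χ' : Set B} (h : IsPrimeFilter χ) (h' : IsPrimeFilter χ')
    (hsub : χ ⊆ χ') : χ = χ' := by
  refine hsub.antisymm fun X hX => ?_
  obtain ⟨Y, hY⟩ := h.nonempty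
  rw [← sup_inf_sdiff Y X] at hY
  rcases (h.sup_mem_iff _ _).1 hY with h1 | h1
  · exact ((h.inf_mem_iff _ _).1 h1).2
  · refine absurd ((h'.inf_mem_iff _ _).2 ⟨hX, hsub h1⟩) ?_
    rw [inf_sdiff_self_right]
    exact h'.bot_notMem

theorem exists_isPrimeFilter {F : Set B} (hne : F.Nonempty) (hbot : ⊥ ∉ F)
    (hinf : ∀ X ∈ F, ∀ Y ∈ F, X ⊓ Y ∈ F) : ∃ χ, IsPrimeFilter χ ∧ F ⊆ χ := by
  have hF : Order.IsPFilter {Y | ∃ X ∈ F, X ≤ Y} := by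
    refine Order.IsPFilter.of_def ?_ ?_ ?_
    · obtain ⟨X, hX⟩ := hne
      exact ⟨X, X, hX, le_rfl⟩
    · rintro X ⟨X', h1, h2⟩ Y ⟨Y', h3, h4⟩
      exact ⟨X ⊓ Y, ⟨_, hinf _ h1 _ h3, inf_le_inf h2 h4⟩, inf_le_left, inf_le_right⟩
    · rintro X Y hXY ⟨X', h1, h2⟩
      exact ⟨X', h1, h2.trans hXY⟩
  have hFm : ∀ X, X ∈ hF.toPFilter ↔ ∃ X' ∈ F, X' ≤ X := fun X => Iff.rfl
  obtain ⟨J, hJ, -, hdis⟩ := DistribLattice.prime_ideal_of_disjoint_filter_ideal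
    (F := hF.toPFilter) (I := Order.Ideal.principal (⊥ : B)) (by
      rw [Set.disjoint_left]
      rintro X ⟨X', h1, h2⟩ h3
      have : X' = ⊥ := le_bot_iff.1 (h2.trans h3)
      exact hbot (this ▸ h1))
  have hsub : F ⊆ (J : Set B)ᶜ := fun X hX => Set.disjoint_left.1 hdis ((hFm X).2 ⟨X, hX, le_rfl⟩)
  refine ⟨(J : Set B)ᶜ, ⟨hne.mono hsub, ?_, fun X Y => ?_, fun X Y => ?_⟩, hsub⟩
  · exact fun h => h J.bot_mem
  · simp only [Set.mem_compl_iff, SetLike.mem_coe, ← not_or, not_iff_not]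
    exact ⟨hJ.mem_or_mem, fun h => h.elim (fun h => J.lower inf_le_left h)
      (fun h => J.lower inf_le_right h)⟩
  · simp only [Set.mem_compl_iff, SetLike.mem_coe, ← not_and_or, not_iff_not]
    exact Order.Ideal.sup_mem_iff

variable (D : BooleanDynamicalSystem B L)

theorem θ_le_rng (a : L) (X : B) : D.θ a X ≤ D.rng [a] :=
  (D.isLUB_rng (α := [a]) (by simp)).1 ⟨X, rfl⟩

theorem exists_θ_eq_rng (a : L) : ∃ X, D.θ a X = D.rng [a] := by
  refine ⟨(D.exists_domain [a] (by simp)).choose, ?_⟩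
  rw [rng, dif_pos (by simp)]
  rfl

theorem IsPrimeFilter.preimage_θ {χ : Set B} (h : IsPrimeFilter χ) {a : L} (ha : D.rng [a] ∈ χ) :
    IsPrimeFilter (D.θ a ⁻¹' χ) where
  nonempty := by
    obtain ⟨X, hX⟩ := D.exists_θ_eq_rng a
    exact ⟨X, by rwa [Set.mem_preimage, hX]⟩
  bot_notMem := by
    rw [Set.mem_preimage, D.map_bot]
    exact h.bot_notMem
  inf_mem_iff X Y := by
    rw [Set.mem_preimage, D.map_inf]
    exact h.inf_mem_iff _ _
  sup_mem_iff X Y := by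
    rw [Set.mem_preimage, D.map_sup]
    exact h.sup_mem_iff _ _

variable {D} in
theorem IsPrimeFilter.exists_forall_θ_ne_bot {χ : Set B} (h : IsPrimeFilter χ) {X : B}
    (hX : X ∈ χ) (hreg : D.IsRegular X) : ∃ a, ∀ Y ∈ χ, D.θ a Y ≠ ⊥ := by
  have hne : ∀ Y ∈ χ, Y ≠ ⊥ := fun Y hY h0 => h.bot_notMem (h0 ▸ hY)
  by_contra! hcon
  choose Z hZ hZ0 using hcon
  have key : ∀ F : Set L, F.Finite → ∃ Y ∈ χ, Y ≤ X ∧ ∀ a ∈ F, D.θ a Y = ⊥ := by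
    intro F hF
    induction F, hF using Set.Finite.induction_on with
    | empty => exact ⟨X, hX, le_rfl, by simp⟩
    | @insert a F _ _ ih =>
      obtain ⟨Y, hY, hYX, hY0⟩ := ih
      refine ⟨Y ⊓ Z a, (h.inf_mem_iff _ _).2 ⟨hY, hZ a⟩, inf_le_left.trans hYX, ?_⟩
      rintro b (rfl | hb)
      · rw [D.map_inf, hZ0, inf_bot_eq]
      · rw [D.map_inf, hY0 b hb, bot_inf_eq]
  obtain ⟨Y, hY, hYX, hY0⟩ := key _ (hreg X (hne X hX) le_rfl).2
  obtain ⟨a, ha⟩ := (hreg Y (hne Y hY) hYX).1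
  exact ha (hY0 a fun hX0 => ha (le_bot_iff.1 ((D.θ_mono a hYX).trans hX0.le)))

variable {D} in
theorem IsPrimeFilter.exists_preimage_θ_eq {χ : Set B} (h : IsPrimeFilter χ) {X : B} (hX : X ∈ χ)
    (hreg : D.IsRegular X) : ∃ (a : L) (χ' : Set B), IsPrimeFilter χ' ∧ D.θ a ⁻¹' χ' = χ := by
  obtain ⟨a, ha⟩ := h.exists_forall_θ_ne_bot hX hreg
  obtain ⟨χ', h', hsub⟩ := exists_isPrimeFilter (F := D.θ a '' χ) (h.nonempty.image _)
    (by rintro ⟨Y, hY, h0⟩; exact ha Y hY h0)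
    (by
      rintro _ ⟨Y, hY, rfl⟩ _ ⟨Z, hZ, rfl⟩
      exact ⟨Y ⊓ Z, (h.inf_mem_iff _ _).2 ⟨hY, hZ⟩, D.map_inf a Y Z⟩)
  have hrng : D.rng [a] ∈ χ' := h'.mem_of_le (hsub ⟨X, hX, rfl⟩) (D.θ_le_rng a X)
  exact ⟨a, χ', h',
    (h.eq_of_subset (h'.preimage_θ D hrng) (Set.image_subset_iff.1 hsub)).symm⟩

/-- The transitions of a boundary path between prime filters, each with the letter that leaves it.
The letter `none` marks the end of a path, which is allowed only at a prime filter that contains no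
regular set; the sequence is constant from there on. -/
def Step (x y : Set B × Option L) : Prop :=
  (∃ a, x.2 = some a ∧ D.θ a ⁻¹' y.1 = x.1) ∨
    (x.2 = none ∧ (∀ X ∈ x.1, ¬ D.IsRegular X) ∧ y = x)

/-- The boundary paths of a Boolean dynamical system, finite or infinite: prime filters connected
by letters, the basis of the Hilbert space of a faithful Cuntz-Krieger representation. A finite path
is encoded as an infinite sequence that is constant from its end on. -/
def BoundaryPath : Type (max u v) :=
  {f : ℕ → Set B × Option L // ∀ n, IsPrimeFilter (f n).1 ∧ D.Step (f n) (f (n + 1))}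

namespace BoundaryPath

variable {D}

/-- The prime filter at the start of a path. -/
def base (ω : D.BoundaryPath) : Set B := (ω.1 0).1

/-- The first letter of a path. -/
def label (ω : D.BoundaryPath) : Option L := (ω.1 0).2

/-- The path without its first letter. -/
def tail (ω : D.BoundaryPath) : D.BoundaryPath := ⟨fun n => ω.1 (n + 1), fun n => ω.2 (n + 1)⟩

/-- The path with a letter prepended. -/
def cons (a : L) (ω : D.BoundaryPath) (h : D.rng [a] ∈ ω.base) : D.BoundaryPath :=
  ⟨fun n => Nat.casesOn n (D.θ a ⁻¹' ω.base, some a) ω.1, fun n => by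
    cases n with
    | zero => exact ⟨(ω.2 0).1.preimage_θ D h, Or.inl ⟨a, rfl, rfl⟩⟩
    | succ n => exact ω.2 n⟩

theorem isPrimeFilter_base (ω : D.BoundaryPath) : IsPrimeFilter ω.base := (ω.2 0).1

theorem label_cons (a : L) (ω : D.BoundaryPath) (h : D.rng [a] ∈ ω.base) :
    (cons a ω h).label = some a := rfl

theorem tail_cons (a : L) (ω : D.BoundaryPath) (h : D.rng [a] ∈ ω.base) :
    (cons a ω h).tail = ω := rfl

theorem base_eq_preimage {ω : D.BoundaryPath} {a : L} (h : ω.label = some a) :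
    ω.base = D.θ a ⁻¹' ω.tail.base := by
  rcases (ω.2 0).2 with ⟨b, h1, h2⟩ | ⟨h1, -⟩
  · have : a = b := Option.some_injective _ (h.symm.trans h1)
    subst this
    exact h2.symm
  · exact absurd (h.symm.trans h1) (by simp)

theorem rng_mem_base_tail {ω : D.BoundaryPath} {a : L} (h : ω.label = some a) :
    D.rng [a] ∈ ω.tail.base := by
  obtain ⟨X, hX⟩ := ω.isPrimeFilter_base.nonempty
  rw [base_eq_preimage h] at hX
  exact ω.tail.isPrimeFilter_base.mem_of_le hX (D.θ_le_rng a X)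

theorem cons_tail {ω : D.BoundaryPath} {a : L} (h : ω.label = some a) :
    cons a ω.tail (rng_mem_base_tail h) = ω := by
  refine Subtype.ext (funext fun n => ?_)
  cases n with
  | zero => exact (Prod.ext (base_eq_preimage h) h : ω.1 0 = (_, some a)).symm
  | succ n => rfl

theorem exists_label {ω : D.BoundaryPath} {X : B} (hX : X ∈ ω.base) (hreg : D.IsRegular X) :
    ∃ a, ω.label = some a := by
  rcases (ω.2 0).2 with ⟨b, h1, -⟩ | ⟨-, h1, -⟩
  · exact ⟨b, h1⟩
  · exact absurd hreg (h1 X hX)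

variable (D) in
theorem exists_mem_base {X : B} (hX : X ≠ ⊥) : ∃ ω : D.BoundaryPath, X ∈ ω.base := by
  obtain ⟨χ, hχ, hXχ⟩ := exists_isPrimeFilter (F := {X}) (by simp) (by simpa using hX.symm)
    (by simp)
  have hstep : ∀ χ : {χ : Set B // IsPrimeFilter χ}, ∃ (o : Option L)
      (χ' : {χ : Set B // IsPrimeFilter χ}), (∃ a, o = some a ∧ D.θ a ⁻¹' χ'.1 = χ.1) ∨
        (o = none ∧ (∀ X ∈ χ.1, ¬ D.IsRegular X) ∧ χ' = χ) := by
    intro χ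
    by_cases h : ∃ X ∈ χ.1, D.IsRegular X
    · obtain ⟨X, hX, hreg⟩ := h
      obtain ⟨a, χ', hχ', ha⟩ := χ.2.exists_preimage_θ_eq hX hreg
      exact ⟨some a, ⟨χ', hχ'⟩, Or.inl ⟨a, rfl, ha⟩⟩
    · push Not at h
      exact ⟨none, χ, Or.inr ⟨rfl, h, rfl⟩⟩
  choose o next hnext using hstep
  let f : ℕ → {χ : Set B // IsPrimeFilter χ} := fun n => next^[n] ⟨χ, hχ⟩
  have hf : ∀ n, f (n + 1) = next (f n) := fun n => Function.iterate_succ_apply' _ _ _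
  refine ⟨⟨fun n => ((f n).1, o (f n)), fun n => ⟨(f n).2, ?_⟩⟩, hXχ rfl⟩
  rcases hnext (f n) with ⟨a, hlabel, hθ⟩ | ⟨hlabel, hreg, hconst⟩
  · exact Or.inl ⟨a, hlabel, by simp only [hf]; exact hθ⟩
  · exact Or.inr ⟨hlabel, hreg, by simp only [hf, hconst]⟩

open Classical in
/-- The partial bijection that removes the first letter `a`. -/
noncomputable def drop (a : L) : D.BoundaryPath ≃. D.BoundaryPath where
  toFun ω := if ω.label = some a then some ω.tail else none
  invFun ω := if h : D.rng [a] ∈ ω.base then some (cons a ω h) else none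
  inv ω ω' := by
    constructor
    · intro h
      by_cases h1 : D.rng [a] ∈ ω'.base
      · rw [dif_pos h1] at h
        obtain rfl := Option.mem_some_iff.1 h
        rw [if_pos (label_cons a ω' h1)]
        rfl
      · rw [dif_neg h1] at h
        exact absurd h (by simp)
    · intro h
      by_cases h1 : ω.label = some a
      · rw [if_pos h1] at h
        obtain rfl := Option.mem_some_iff.1 h
        rw [dif_pos (rng_mem_base_tail h1), cons_tail h1]
      · rw [if_neg h1] at h
        exact absurd h (by simp)

open Classical in
theorem drop_apply (a : L) (ω : D.BoundaryPath) :
    drop a ω = if ω.label = some a then some ω.tail else none := rfl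

open Classical in
theorem drop_symm_apply (a : L) (ω : D.BoundaryPath) :
    (drop a).symm ω = if h : D.rng [a] ∈ ω.base then some (cons a ω h) else none := rfl

open Classical in
variable (D) in
/-- The partial identity on the paths that start in `X`, which gives the projection `P_X`. -/
noncomputable def restrict (X : B) : D.BoundaryPath ≃. D.BoundaryPath :=
  PEquiv.ofSet {ω | X ∈ ω.base}

open Classical in
theorem restrict_apply (X : B) (ω : D.BoundaryPath) :
    restrict D X ω = if X ∈ ω.base then some ω else none := rfl

theorem restrict_bot : restrict D ⊥ = ⊥ := by
  ext1 ω
  rw [restrict_apply, if_neg ω.isPrimeFilter_base.bot_notMem, PEquiv.bot_apply]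

open Classical in
theorem restrict_trans (X : B) (k : D.BoundaryPath ≃. D.BoundaryPath) (ω : D.BoundaryPath) :
    (restrict D X).trans k ω = if X ∈ ω.base then k ω else none := by
  change (restrict D X ω).bind k = _
  rw [restrict_apply]
  split_ifs <;> rfl

open Classical in
theorem drop_trans (a : L) (k : D.BoundaryPath ≃. D.BoundaryPath) (ω : D.BoundaryPath) :
    (drop a).trans k ω = if ω.label = some a then k ω.tail else none := by
  change (drop a ω).bind k = _
  rw [drop_apply]
  split_ifs <;> rfl

open Classical in
theorem drop_symm_trans (a : L) (k : D.BoundaryPath ≃. D.BoundaryPath) (ω : D.BoundaryPath) :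
    (drop a).symm.trans k ω = if h : D.rng [a] ∈ ω.base then k (cons a ω h) else none := by
  change ((drop a).symm ω).bind k = _
  rw [drop_symm_apply]
  split_ifs <;> rfl

theorem restrict_inf (X Y : B) : restrict D (X ⊓ Y) = (restrict D X).trans (restrict D Y) := by
  classical
  ext1 ω
  simp only [restrict_trans, restrict_apply, ω.isPrimeFilter_base.inf_mem_iff, ite_and]

theorem restrict_trans_drop (a : L) (X : B) :
    (restrict D X).trans (drop a) = (drop a).trans (restrict D (D.θ a X)) := by
  classical
  ext1 ω
  rw [restrict_trans, drop_trans, drop_apply, restrict_apply]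
  by_cases h : ω.label = some a
  · simp only [h, if_true, base_eq_preimage h, Set.mem_preimage]
  · simp only [h, if_false, ite_self]

theorem drop_symm_trans_drop (a : L) :
    (drop (D := D) a).symm.trans (drop a) = restrict D (D.rng [a]) := by
  classical
  ext1 ω
  rw [drop_symm_trans, restrict_apply]
  split_ifs with h
  · rw [drop_apply, if_pos (label_cons a ω h), tail_cons]
  · rfl

theorem drop_symm_trans_drop_of_ne {a b : L} (hab : a ≠ b) :
    (drop (D := D) a).symm.trans (drop b) = ⊥ := by
  classical
  ext1 ω
  rw [drop_symm_trans, PEquiv.bot_apply]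
  split_ifs with h
  · rw [drop_apply, label_cons, if_neg (by simpa using hab)]
  · rfl

open Classical in
theorem drop_trans_restrict_trans_drop_symm (a : L) (X : B) (ω : D.BoundaryPath) :
    ((drop a).trans (restrict D (D.θ a X))).trans (drop a).symm ω =
      if ω.label = some a ∧ X ∈ ω.base then some ω else none := by
  rw [PEquiv.trans_assoc, drop_trans, ite_and]
  by_cases h : ω.label = some a
  · simp only [h, if_true, restrict_trans, drop_symm_apply, dif_pos (rng_mem_base_tail h),
      cons_tail h, base_eq_preimage h, Set.mem_preimage]
  · simp only [h, if_false]

theorem partialIsometry_restrict_sup (X Y : B) :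
    partialIsometry (restrict D (X ⊔ Y)) = partialIsometry (restrict D X) +
      partialIsometry (restrict D Y) - partialIsometry (restrict D (X ⊓ Y)) := by
  classical
  ext f ω
  change (restrict D (X ⊔ Y) ω).elim 0 f = (restrict D X ω).elim 0 f +
    (restrict D Y ω).elim 0 f - (restrict D (X ⊓ Y) ω).elim 0 f
  simp only [restrict_apply, ω.isPrimeFilter_base.inf_mem_iff, ω.isPrimeFilter_base.sup_mem_iff]
  by_cases hX : X ∈ ω.base <;> by_cases hY : Y ∈ ω.base <;> simp [hX, hY]

theorem partialIsometry_restrict_of_isRegular {X : B} (hX : D.IsRegular X) {F : Finset L}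
    (hF : (F : Set L) = D.letters X) :
    partialIsometry (restrict D X) = ∑ a ∈ F, partialIsometry (drop a) *
      partialIsometry (restrict D (D.θ a X)) * partialIsometry (drop a).symm := by
  classical
  ext f ω
  rw [sum_apply, lp.coeFn_sum, Finset.sum_apply]
  simp only [partialIsometry_mul, partialIsometry_apply, restrict_apply,
    drop_trans_restrict_trans_drop_symm]
  by_cases h : X ∈ ω.base
  · obtain ⟨a, ha⟩ := exists_label h hX
    have haF : a ∈ F := by
      rw [← Finset.mem_coe, hF]
      intro h0
      rw [base_eq_preimage ha, Set.mem_preimage, h0] at h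
      exact ω.tail.isPrimeFilter_base.bot_notMem h
    rw [Finset.sum_eq_single a (fun b _ hb => ?_) (absurd haF)]
    · simp only [h, ha, and_self, if_true]
    · simp only [ha, Option.some.injEq, hb.symm, false_and, if_false, Option.elim_none]
  · simp [h]

theorem isCKFamily : D.IsCKFamily (fun X => partialIsometry (restrict D X))
    (fun a => partialIsometry (drop (D := D) a))
    (fun a => partialIsometry (drop (D := D) a).symm) where
  bot := by rw [restrict_bot, partialIsometry_bot]
  inf X Y := by rw [partialIsometry_mul, restrict_inf]
  sup := partialIsometry_restrict_sup
  isometry_left a := partialIsometry_mul_symm_mul (drop a)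
  isometry_right a := partialIsometry_mul_symm_mul (drop a).symm
  comm_left a X := by rw [partialIsometry_mul, partialIsometry_mul, restrict_trans_drop]
  comm_right a X := by
    have h := congrArg PEquiv.symm (restrict_trans_drop (D := D) a X)
    rw [PEquiv.symm_trans_rev, PEquiv.symm_trans_rev, restrict, restrict, PEquiv.ofSet_symm,
      PEquiv.ofSet_symm] at h
    rw [partialIsometry_mul, partialIsometry_mul]
    exact congrArg partialIsometry h
  source a := by rw [partialIsometry_mul, drop_symm_trans_drop]
  orthogonal a b hab := by
    rw [partialIsometry_mul, drop_symm_trans_drop_of_ne hab, partialIsometry_bot]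
  regular _ hX _ hF := partialIsometry_restrict_of_isRegular hX hF

variable (D) in
/-- The Cuntz-Krieger representation on the Hilbert space of the boundary paths, used to see that
the projections `P_X` with `X ≠ ⊥` do not vanish in the universal C*-algebra. -/
noncomputable def representation : Representation D where
  alg := lp (fun _ : D.BoundaryPath => ℂ) 2 →L[ℂ] lp (fun _ : D.BoundaryPath => ℂ) 2
  P X := partialIsometry (restrict D X)
  S a := partialIsometry (drop a)
  isCK :=
    { projection := fun X =>
        { isIdempotentElem := (isCKFamily.inf X X).symm.trans (by rw [inf_idem])
          isSelfAdjoint := by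
            rw [IsSelfAdjoint, star_partialIsometry, restrict, PEquiv.ofSet_symm] }
      family := by
        simp only [star_partialIsometry]
        exact isCKFamily }

end BoundaryPath

end BooleanDynamicalSystem

namespace BooleanDynamicalSystem

section Words

variable {B : Type u} {L : Type v} {A A' : Type*}

theorem map_word [Mul A] [Mul A'] (f : A → A') (hf : ∀ x y, f (x * y) = f x * f y) (S : L → A)
    (α : List L) (x : A) : f (word S α x) = word (fun a => f (S a)) α (f x) := by
  induction α with
  | nil => rfl
  | cons a α ih => exact (hf _ _).trans (congrArg _ ih)

theorem map_wordStar [Mul A] [Mul A'] (f : A → A') (hf : ∀ x y, f (x * y) = f x * f y)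
    (Sd : L → A) (β : List L) (x : A) :
    f (wordStar Sd β x) = wordStar (fun a => f (Sd a)) β (f x) := by
  induction β with
  | nil => rfl
  | cons a β ih => exact (hf _ _).trans (congrArg (· * f (Sd a)) ih)

theorem map_monomial [Mul A] [Mul A'] (f : A → A') (hf : ∀ x y, f (x * y) = f x * f y)
    (P : B → A) (S Sd : L → A) (α β : List L) (X : B) :
    f (monomial P S Sd α X β) =
      monomial (fun X => f (P X)) (fun a => f (S a)) (fun a => f (Sd a)) α X β := by
  rw [monomial, map_word f hf, map_wordStar f hf, monomial]

variable [NonUnitalRing A]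

theorem monomial_cons_cons (P : B → A) (S Sd : L → A) (a : L) (α β : List L) (X : B) :
    monomial P S Sd (a :: α) X (a :: β) = S a * monomial P S Sd α X β * Sd a := by
  change S a * word S α (wordStar Sd β (P X) * Sd a) = _
  rw [← word_mul, ← mul_assoc]
  rfl

theorem monomial_append (P : B → A) (S Sd : L → A) (α β ε : List L) (X : B) :
    monomial P S Sd (α ++ ε) X (β ++ ε) = word S α (wordStar Sd β (monomial P S Sd ε X ε)) := by
  rw [monomial, monomial, word_append, wordStar_append, word_wordStar S Sd ε β]

variable {𝕜 : Type*} [CommRing 𝕜] [Module 𝕜 A] [IsScalarTower 𝕜 A A] [SMulCommClass 𝕜 A A]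

theorem word_smul_smul (S : L → A) (z c : 𝕜) (α : List L) (x : A) :
    word (fun a => z • S a) α (c • x) = (z ^ α.length * c) • word S α x := by
  induction α with
  | nil => simp [word]
  | cons a α ih =>
    change z • S a * word (fun a => z • S a) α (c • x) = _ • (S a * word S α x)
    rw [ih, smul_mul_smul_comm, List.length_cons, pow_succ', mul_assoc]

theorem wordStar_smul (Sd : L → A) (w : 𝕜) (β : List L) (x : A) :
    wordStar (fun a => w • Sd a) β x = w ^ β.length • wordStar Sd β x := by
  induction β with
  | nil => simp [wordStar]
  | cons a β ih =>
    change wordStar (fun a => w • Sd a) β x * w • Sd a = _ • (wordStar Sd β x * Sd a)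
    rw [ih, smul_mul_smul_comm, List.length_cons, pow_succ]

theorem monomial_smul (P : B → A) (S Sd : L → A) (z w : 𝕜) (α β : List L) (X : B) :
    monomial P (fun a => z • S a) (fun a => w • Sd a) α X β =
      (z ^ α.length * w ^ β.length) • monomial P S Sd α X β := by
  rw [monomial, wordStar_smul, word_smul_smul, monomial]

end Words

variable {B : Type u} {L : Type v} [GeneralizedBooleanAlgebra B] {D : BooleanDynamicalSystem B L}

theorem act_bot (α : List L) : D.act α ⊥ = ⊥ := by
  induction α with
  | nil => rfl
  | cons a α ih => rw [act_cons, D.map_bot, ih]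

theorem Below.nil (X : B) : D.Below [] X := fun h => absurd rfl h

theorem Below.of_append {α β : List L} {X : B} (h : D.Below (α ++ β) X) : D.Below β X := by
  induction α with
  | nil => exact h
  | cons a α ih => exact ih h.of_cons

namespace IsCKFamily

variable {A : Type*} [NonUnitalRing A] {P : B → A} {S Sd : L → A}

theorem P_sdiff (h : D.IsCKFamily P S Sd) (X Y : B) : P X = P (X ⊓ Y) + P (X \ Y) := by
  have := h.sup (X ⊓ Y) (X \ Y)
  rwa [sup_inf_sdiff, inf_inf_sdiff, h.bot, sub_zero] at this

theorem P_mul_self (h : D.IsCKFamily P S Sd) (X : B) : P X * P X = P X := by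
  rw [← h.inf, inf_idem]

theorem monomial_bot (h : D.IsCKFamily P S Sd) (α β : List L) : monomial P S Sd α ⊥ β = 0 := by
  rw [monomial, h.bot, wordStar_zero, word_zero]

theorem inner_append_right (h : D.IsCKFamily P S Sd) (β δ : List L) (X Y : B)
    (hY : D.Below (β ++ δ) Y) :
    wordStar Sd β (P X) * word S (β ++ δ) (P Y) = word S δ (P (D.act δ X ⊓ Y)) := by
  induction β with
  | nil =>
    change P X * word S δ (P Y) = _
    rw [h.mul_word, h.inf]
  | cons b β ih => rw [List.cons_append, h.cons_cons b β (β ++ δ) X Y hY, ih hY.of_cons]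

theorem inner_append_left (h : D.IsCKFamily P S Sd) (γ δ : List L) (X Y : B)
    (hY : D.Below γ Y) :
    wordStar Sd (γ ++ δ) (P X) * word S γ (P Y) = wordStar Sd δ (P (X ⊓ D.act δ Y)) := by
  induction γ with
  | nil =>
    change wordStar Sd δ (P X) * P Y = _
    rw [h.wordStar_mul, h.inf]
  | cons b γ ih => rw [List.cons_append, h.cons_cons b (γ ++ δ) γ X Y hY, ih hY.of_cons]

theorem monomial_mul_append (h : D.IsCKFamily P S Sd) (α β γ δ : List L) (X Y : B)
    (hY : D.Below (β ++ δ) Y) :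
    monomial P S Sd α X β * monomial P S Sd (β ++ δ) Y γ =
      monomial P S Sd (α ++ δ) (D.act δ X ⊓ Y) γ := by
  rw [monomial_mul_monomial, h.inner_append_right β δ X Y hY, monomial, word_append,
    word_wordStar S Sd δ]

theorem monomial_append_mul (h : D.IsCKFamily P S Sd) (α β γ δ : List L) (X Y : B)
    (hY : D.Below β Y) :
    monomial P S Sd α X (β ++ δ) * monomial P S Sd β Y γ =
      monomial P S Sd α (X ⊓ D.act δ Y) (γ ++ δ) := by
  rw [monomial_mul_monomial, h.inner_append_left β δ X Y hY, monomial, wordStar_append]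

theorem monomial_mul_same (h : D.IsCKFamily P S Sd) (α β γ : List L) (X Y : B)
    (hY : D.Below β Y) :
    monomial P S Sd α X β * monomial P S Sd β Y γ = monomial P S Sd α (X ⊓ Y) γ := by
  rw [monomial_mul_monomial, h.inner_self β X Y hY, monomial]

theorem monomial_mul_eq_zero (h : D.IsCKFamily P S Sd) (α β γ δ : List L) (X Y : B)
    (hX : D.Below β X) (hY : D.Below γ Y) (hβγ : ¬ β <+: γ) (hγβ : ¬ γ <+: β) :
    monomial P S Sd α X β * monomial P S Sd γ Y δ = 0 := by
  rcases h.inner β γ X Y hX hY with ⟨ε, he, -⟩ | ⟨ε, he, -⟩ | h0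
  · exact absurd ⟨ε, he.symm⟩ hβγ
  · exact absurd ⟨ε, he.symm⟩ hγβ
  · rw [monomial_mul_monomial, h0, wordStar_zero, word_zero]

theorem wordStar_mul_monomial_mul_word (h : D.IsCKFamily P S Sd) (α β : List L) (X Y : B)
    (hX : D.Below α X) (hY : D.Below β Y) (hXY : X ≤ Y) :
    monomial P S Sd [] Y α * monomial P S Sd α X β * monomial P S Sd β Y [] = P X := by
  rw [h.monomial_mul_same [] α β Y X hX, h.monomial_mul_same [] β [] _ Y hY,
    inf_eq_right.2 hXY, inf_eq_left.2 hXY]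
  rfl

theorem smul {𝕜 : Type*} [CommRing 𝕜] [Module 𝕜 A] [IsScalarTower 𝕜 A A] [SMulCommClass 𝕜 A A]
    (h : D.IsCKFamily P S Sd) {z w : 𝕜} (hzw : z * w = 1) :
    D.IsCKFamily P (fun a => z • S a) (fun a => w • Sd a) where
  bot := h.bot
  inf := h.inf
  sup := h.sup
  isometry_left a := by
    rw [smul_mul_smul_comm, smul_mul_smul_comm, hzw, one_mul, h.isometry_left]
  isometry_right a := by
    rw [smul_mul_smul_comm, smul_mul_smul_comm, mul_comm w, hzw, one_mul, h.isometry_right]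
  comm_left a X := by rw [mul_smul_comm, h.comm_left, smul_mul_assoc]
  comm_right a X := by rw [smul_mul_assoc, h.comm_right, mul_smul_comm]
  source a := by rw [smul_mul_smul_comm, mul_comm w, hzw, one_smul, h.source]
  orthogonal a b hab := by rw [smul_mul_smul_comm, h.orthogonal a b hab, smul_zero]
  regular X hX F hF := by
    rw [h.regular X hX F hF]
    refine Finset.sum_congr rfl fun a _ => ?_
    rw [mul_smul_comm, smul_mul_assoc, smul_mul_assoc, smul_smul, mul_comm w, hzw, one_smul]

end IsCKFamily

theorem univP_ne_zero {X : B} (hX : X ≠ ⊥) : D.univP X ≠ 0 := by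
  classical
  intro h0
  obtain ⟨ω, hω⟩ := BoundaryPath.exists_mem_base D hX
  have hP : partialIsometry (BoundaryPath.restrict D X) = 0 := by
    have hρ := D.toRep_univP (BoundaryPath.representation D) X
    rw [h0, map_zero] at hρ
    exact hρ.symm
  have hω1 := partialIsometry_apply (BoundaryPath.restrict D X) (lp.single 2 ω 1) ω
  rw [hP, BoundaryPath.restrict_apply, if_pos hω] at hω1
  simp at hω1

variable (D) in
/-- The element `s_α p_X s_β^*` of the universal C*-algebra; it lies in `T` if `X` is below the
ranges of `α` and `β`. -/
noncomputable def univMonomial (α : List L) (X : B) (β : List L) : D.UniversalCStarAlgebra :=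
  monomial D.univP D.univS (fun a => star (D.univS a)) α X β

variable (D) in
theorem univ_isCKFamily : D.IsCKFamily D.univP D.univS (fun a => star (D.univS a)) :=
  D.univ_isCKRepresentation.family

theorem univP_eq_zero_iff {X : B} : D.univP X = 0 ↔ X = ⊥ :=
  ⟨fun h => by_contra fun h0 => univP_ne_zero h0 h, fun h => h ▸ D.univ_isCKFamily.bot⟩

theorem univP_injective : Function.Injective D.univP := by
  have hle : ∀ X Y, D.univP X = D.univP Y → X ≤ Y := by
    intro X Y h
    have hsdiff := D.univ_isCKFamily.P_sdiff X Y
    rw [D.univ_isCKFamily.inf, ← h, D.univ_isCKFamily.P_mul_self, left_eq_add,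
      univP_eq_zero_iff] at hsdiff
    exact sdiff_eq_bot_iff.1 hsdiff
  exact fun X Y h => (hle X Y h).antisymm (hle Y X h.symm)

theorem univMonomial_eq_zero_iff {α β : List L} {X : B} (hα : D.Below α X) (hβ : D.Below β X) :
    D.univMonomial α X β = 0 ↔ X = ⊥ := by
  constructor
  · intro h
    have := D.univ_isCKFamily.wordStar_mul_monomial_mul_word α β X X hα hβ le_rfl
    change _ * D.univMonomial α X β * _ = _ at this
    rw [h, mul_zero, zero_mul] at this
    exact univP_eq_zero_iff.1 this.symm
  · rintro rfl
    exact D.univ_isCKFamily.monomial_bot α β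

theorem star_univMonomial (α β : List L) (X : B) :
    star (D.univMonomial α X β) = D.univMonomial β X α :=
  D.univ_isCKRepresentation.star_monomial α β X

theorem toRep_univMonomial (ρ : Representation D) (α β : List L) (X : B) :
    D.toRep ρ (D.univMonomial α X β) = monomial ρ.P ρ.S (fun a => star (ρ.S a)) α X β := by
  rw [univMonomial, map_monomial (D.toRep ρ) (map_mul _)]
  rfl

namespace Representation

/-- The gauge action on representations: `s_a` is multiplied by a complex number `z` of modulus
one. It multiplies `s_α p_X s_β^*` by `z ^ (|α| - |β|)`. -/
noncomputable def gauge (ρ : Representation D) (z : ℂ) (hz : z * star z = 1) :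
    Representation D where
  alg := ρ.alg
  P := ρ.P
  S a := z • ρ.S a
  isCK :=
    { projection := ρ.isCK.projection
      family := by
        simp only [star_smul]
        exact ρ.isCK.family.smul hz }

theorem toRep_gauge (ρ : Representation D) (z : ℂ) (hz : z * star z = 1) (α β : List L) (X : B) :
    D.toRep (ρ.gauge z hz) (D.univMonomial α X β) =
      ((z ^ α.length * star z ^ β.length) • D.toRep ρ (D.univMonomial α X β) : ρ.alg) := by
  rw [toRep_univMonomial, toRep_univMonomial, ← monomial_smul]
  congr 1
  exact funext fun a => star_smul z (ρ.S a)

end Representation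

theorem exists_mul_star_eq_one_and_injective_pow :
    ∃ z : ℂ, z * star z = 1 ∧ Function.Injective fun n : ℕ => z ^ n := by
  refine ⟨Complex.exp Complex.I, ?_, fun m n hmn => ?_⟩
  · rw [Complex.star_def, Complex.mul_conj, Complex.normSq_eq_norm_sq, Complex.norm_exp]
    simp
  · simp only [← Complex.exp_nat_mul, Complex.exp_eq_exp_iff_exists_int] at hmn
    obtain ⟨k, hk⟩ := hmn
    have hk' : ((m : ℤ) - n : ℝ) = (2 * k : ℤ) * Real.pi := by
      have : (m : ℝ) = n + k * (2 * Real.pi) := by simpa using congrArg Complex.im hk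
      push_cast
      linarith
    have hk0 : k = 0 := by
      by_contra hk0
      refine (irrational_pi.intCast_mul (m := 2 * k) (by omega)).ne_int ((m : ℤ) - n) ?_
      push_cast at hk' ⊢
      exact hk'.symm
    rw [hk0] at hk'
    push_cast at hk'
    exact_mod_cast (by linarith : (m : ℝ) = n)

theorem length_add_length_eq_of_univMonomial_eq {α β γ δ : List L} {X Y : B}
    (h : D.univMonomial α X β = D.univMonomial γ Y δ) (h0 : D.univMonomial α X β ≠ 0) :
    α.length + δ.length = γ.length + β.length := by
  obtain ⟨z, hz, hinj⟩ := exists_mul_star_eq_one_and_injective_pow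
  obtain ⟨ρ, hρ⟩ : ∃ ρ, D.toRep ρ (D.univMonomial α X β) ≠ 0 := by
    by_contra! hρ
    exact h0 (D.univ_ext fun ρ => (hρ ρ).trans (map_zero _).symm)
  have hgauge : (z ^ α.length * star z ^ β.length) • D.toRep ρ (D.univMonomial α X β) =
      (z ^ γ.length * star z ^ δ.length) • D.toRep ρ (D.univMonomial α X β) := by
    rw [← ρ.toRep_gauge z hz, h, ← ρ.toRep_gauge z hz]
  have hpow : ∀ a b c : ℕ, z ^ (b + c) * (z ^ a * star z ^ b) = z ^ (a + c) := fun a b c => by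
    calc z ^ (b + c) * (z ^ a * star z ^ b) = z ^ (a + c) * (z * star z) ^ b := by ring
      _ = z ^ (a + c) := by rw [hz, one_pow, mul_one]
  refine hinj ?_
  calc z ^ (α.length + δ.length)
      = z ^ (β.length + δ.length) * (z ^ α.length * star z ^ β.length) := (hpow _ _ _).symm
    _ = z ^ (δ.length + β.length) * (z ^ γ.length * star z ^ δ.length) := by
      rw [smul_left_injective ℂ hρ hgauge, add_comm]
    _ = z ^ (γ.length + β.length) := hpow _ _ _

theorem eq_of_idem {α β : List L} {X : B} (hα : D.Below α X) (hβ : D.Below β X)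
    (hi : D.univMonomial α X β * D.univMonomial α X β = D.univMonomial α X β)
    (h0 : D.univMonomial α X β ≠ 0) : α = β := by
  have hself : D.univMonomial α X β = D.univMonomial β X β :=
    (eq_star_mul_self
      (D.univ_isCKRepresentation.mul_star_mul (Or.inr ⟨α, X, β, hα, hβ, rfl⟩)) hi).trans
      (D.univ_isCKRepresentation.monomial_star_mul_self α β X hα)
  have hlen : α.length = β.length :=
    Nat.add_right_cancel (length_add_length_eq_of_univMonomial_eq hself h0)
  by_contra hne
  refine h0 (hi.symm.trans (D.univ_isCKFamily.monomial_mul_eq_zero α β α β X X hβ hα ?_ ?_))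
  · exact fun hpre => hne (hpre.eq_of_length hlen.symm).symm
  · exact fun hpre => hne (hpre.eq_of_length hlen)

theorem exists_eq_append_of_mul_idem {α β γ δ : List L} {X Y : B} (hα : D.Below α X)
    (hβ : D.Below β X) (hγ : D.Below γ Y) (hδ : D.Below δ Y) {e : D.UniversalCStarAlgebra}
    (hmul : D.univMonomial α X β * D.univMonomial γ Y δ = e) (hi : e * e = e) (h0 : e ≠ 0) :
    (∃ ε, γ = β ++ ε ∧ δ = α ++ ε) ∨ ∃ ε, β = γ ++ ε ∧ α = δ ++ ε := by
  have hu := D.univ_isCKFamily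
  subst hmul
  by_cases hβγ : β <+: γ
  · obtain ⟨ε, rfl⟩ := hβγ
    rw [univMonomial, univMonomial, hu.monomial_mul_append α β δ ε X Y hγ] at hi h0
    exact Or.inl ⟨ε, rfl,
      (eq_of_idem ((hα.append ε).mono inf_le_left) (hδ.mono inf_le_right) hi h0).symm⟩
  by_cases hγβ : γ <+: β
  · obtain ⟨ε, rfl⟩ := hγβ
    rw [univMonomial, univMonomial, hu.monomial_append_mul α γ δ ε X Y hγ] at hi h0
    exact Or.inr ⟨ε, rfl,
      eq_of_idem (hα.mono inf_le_left) ((hδ.append ε).mono inf_le_right) hi h0⟩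
  exact absurd (hu.monomial_mul_eq_zero α β γ δ X Y hβ hγ hβγ hγβ) h0

section Transfer

variable {A : Type*} [NonUnitalRing A] {P : B → A} {S Sd : L → A}

theorem univP_eq_of_le_range {a : L} {X : B} {m : D.UniversalCStarAlgebra}
    (hX : D.univP X = D.univS a * m * star (D.univS a)) {Y : B} (hYX : Y ≤ X) :
    D.univP Y = D.univS a * D.univP (D.θ a Y) * star (D.univS a) := by
  have h := D.univ_isCKFamily
  have h1 : D.univP X * (D.univS a * star (D.univS a)) = D.univP X := by
    conv_lhs => rw [hX, mul_assoc, ← mul_assoc (star _), h.isometry_right]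
    exact hX.symm
  calc D.univP Y = D.univP Y * D.univP X := by rw [← h.inf, inf_eq_left.2 hYX]
    _ = D.univP Y * D.univP X * (D.univS a * star (D.univS a)) := by rw [mul_assoc, h1]
    _ = D.univP Y * D.univS a * star (D.univS a) := by
      rw [← h.inf, inf_eq_left.2 hYX, mul_assoc]
    _ = _ := by rw [h.comm_left]

theorem univS_star_mul_univP_mul (a : L) (X : B) :
    star (D.univS a) * D.univP X * D.univS a = D.univP (D.θ a X) := by
  rw [D.univ_isCKFamily.comm_right, mul_assoc, D.univ_isCKFamily.source, ← D.univ_isCKFamily.inf,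
    inf_eq_left.2 (D.θ_le_rng a X)]

theorem letters_eq_singleton {a : L} {X : B}
    (hX : ∀ Y ≤ X, D.univP Y = D.univS a * D.univP (D.θ a Y) * star (D.univS a)) {Y : B}
    (hY : Y ≠ ⊥) (hYX : Y ≤ X) : D.letters Y = {a} := by
  have h := D.univ_isCKFamily
  ext b
  rw [Set.mem_singleton_iff]
  constructor
  · intro hb
    by_contra hba
    refine hb (univP_eq_zero_iff (D := D).1 ?_)
    rw [← univS_star_mul_univP_mul, hX Y hYX, ← mul_assoc, ← mul_assoc,
      h.orthogonal b a hba, zero_mul, zero_mul, zero_mul]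
  · rintro rfl h0
    refine univP_ne_zero (D := D) hY ?_
    rw [hX Y hYX, h0, h.bot, mul_zero, zero_mul]

theorem IsCKFamily.P_eq_of_univP_eq (h : D.IsCKFamily P S Sd) {a : L} {X : B}
    {m : D.UniversalCStarAlgebra} (hX : D.univP X = D.univS a * m * star (D.univS a)) :
    P X = S a * P (D.θ a X) * Sd a := by
  by_cases h0 : X = ⊥
  · rw [h0, D.map_bot, h.bot, mul_zero, zero_mul]
  -- Every nonempty part of `X` emits exactly the letter `a`, so that `X` is regular.
  have hlet := fun Y (hY : Y ≠ ⊥) (hYX : Y ≤ X) =>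
    letters_eq_singleton (fun Z hZ => univP_eq_of_le_range hX hZ) hY hYX
  rw [h.regular X (fun Y hY hYX => by rw [hlet Y hY hYX]; simp) {a}
    (by rw [hlet X h0 le_rfl]; simp), Finset.sum_singleton]

theorem star_univS_mul_conj_mul (a : L) {ε : List L} {Y : B} (hY : D.Below (a :: ε) Y) :
    star (D.univS a) * (D.univS a * D.univMonomial ε Y ε * star (D.univS a)) * D.univS a =
      D.univMonomial ε Y ε := by
  have hu := D.univ_isCKFamily
  have hleft : D.univP (D.rng [a]) * D.univMonomial ε Y ε = D.univMonomial ε Y ε := by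
    have := hu.monomial_mul_append [] [] ε ε (D.rng [a]) Y hY.of_cons
    rwa [inf_eq_right.2 hY.le_act] at this
  have hright : D.univMonomial ε Y ε * D.univP (D.rng [a]) = D.univMonomial ε Y ε := by
    have := hu.monomial_append_mul ε [] [] ε Y (D.rng [a]) (Below.nil _)
    rwa [inf_eq_left.2 hY.le_act] at this
  calc star (D.univS a) * (D.univS a * D.univMonomial ε Y ε * star (D.univS a)) * D.univS a =
        (star (D.univS a) * D.univS a) * D.univMonomial ε Y ε *
          (star (D.univS a) * D.univS a) := by simp only [mul_assoc]
    _ = D.univMonomial ε Y ε := by rw [hu.source, hleft, hright]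

theorem IsCKFamily.P_eq_monomial (h : D.IsCKFamily P S Sd) (ε : List L) {X Y : B}
    (hY : D.Below ε Y) (hX : D.univP X = D.univMonomial ε Y ε) :
    P X = monomial P S Sd ε Y ε := by
  induction ε generalizing X with
  | nil =>
    rw [univP_injective (hX.trans rfl : D.univP X = D.univP Y)]
    rfl
  | cons a ε ih =>
    have hcons : D.univP X = D.univS a * D.univMonomial ε Y ε * star (D.univS a) :=
      hX.trans (monomial_cons_cons _ _ _ a ε ε Y)
    have hθ : D.univP (D.θ a X) = D.univMonomial ε Y ε := by
      rw [← univS_star_mul_univP_mul, hcons, star_univS_mul_conj_mul a hY]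
    rw [h.P_eq_of_univP_eq hcons, monomial_cons_cons, ih hY.of_cons hθ]

theorem IsCKFamily.monomial_eq_append (h : D.IsCKFamily P S Sd) {α β ε : List L} {X Y : B}
    (hα : D.Below α X) (hβ : D.Below β X) (hα' : D.Below (α ++ ε) Y) (hβ' : D.Below (β ++ ε) Y)
    (he : D.univMonomial α X β = D.univMonomial (α ++ ε) Y (β ++ ε)) :
    monomial P S Sd α X β = monomial P S Sd (α ++ ε) Y (β ++ ε) := by
  have hu := D.univ_isCKFamily
  set Y' := D.act ε X ⊓ Y ⊓ D.act ε X
  have hY'Y : Y' ≤ Y := inf_le_left.trans inf_le_right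
  have hbelow : D.Below ε Y' := (hα'.of_append).mono hY'Y
  have hX : D.univP X = D.univMonomial ε Y' ε := by
    have hcorner := hu.wordStar_mul_monomial_mul_word α β X X hα hβ le_rfl
    rw [show monomial _ _ _ α X β = _ from he, univMonomial,
      hu.monomial_mul_append [] α _ ε X Y hα', hu.monomial_append_mul _ β [] ε _ X hβ] at hcorner
    exact hcorner.symm
  have heY' : D.univMonomial (α ++ ε) Y' (β ++ ε) = D.univMonomial (α ++ ε) Y (β ++ ε) := by
    rw [← he, univMonomial, monomial_append, ← hu.P_eq_monomial ε hbelow hX]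
    rfl
  have hYY' : Y' = Y := by
    have hcorner := hu.wordStar_mul_monomial_mul_word (α ++ ε) (β ++ ε) Y' Y (hα'.mono hY'Y)
      hβ' hY'Y
    rw [show monomial _ _ _ (α ++ ε) Y' (β ++ ε) = _ from heY', univMonomial,
      hu.wordStar_mul_monomial_mul_word _ _ Y Y hα' hβ' le_rfl] at hcorner
    exact univP_injective hcorner.symm
  rw [monomial_append, ← hYY', ← h.P_eq_monomial ε hbelow hX]
  rfl

theorem IsCKFamily.monomial_eq (h : D.IsCKFamily P S Sd) {α β γ δ : List L} {X Y : B}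
    (hα : D.Below α X) (hβ : D.Below β X) (hγ : D.Below γ Y) (hδ : D.Below δ Y)
    (he : D.univMonomial α X β = D.univMonomial γ Y δ) :
    monomial P S Sd α X β = monomial P S Sd γ Y δ := by
  have hu := D.univ_isCKFamily
  by_cases hX : X = ⊥
  · subst hX
    have h0 := (univMonomial_eq_zero_iff hα hβ).2 rfl
    rw [(univMonomial_eq_zero_iff hγ hδ).1 (he ▸ h0), h.monomial_bot, h.monomial_bot]
  have hmul : D.univMonomial α X β * D.univMonomial δ Y γ = D.univMonomial α X α := by
    rw [← star_univMonomial γ δ, ← he, star_univMonomial, univMonomial, univMonomial,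
      hu.monomial_mul_same α β α X X hβ, inf_idem, univMonomial]
  have hidem : D.univMonomial α X α * D.univMonomial α X α = D.univMonomial α X α := by
    rw [univMonomial, hu.monomial_mul_same α α α X X hα, inf_idem]
  have hne : D.univMonomial α X α ≠ 0 := mt (univMonomial_eq_zero_iff hα hα).1 hX
  rcases exists_eq_append_of_mul_idem hα hβ hδ hγ hmul hidem hne with
    ⟨ε, rfl, rfl⟩ | ⟨ε, rfl, rfl⟩
  · exact h.monomial_eq_append hα hβ hγ hδ he
  · exact (h.monomial_eq_append hγ hδ hα hβ he.symm).symm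

end Transfer

namespace T

theorem val_mul (s t : D.T) : (s * t).1 = s.1 * t.1 := rfl

theorem exists_eq (t : D.T) : ∃ α X β, D.Below α X ∧ D.Below β X ∧ t.1 = D.univMonomial α X β := by
  rcases t.2 with h | h
  · exact ⟨[], ⊥, [], Below.nil _, Below.nil _,
      h.trans (D.univ_isCKFamily.monomial_bot [] []).symm⟩
  · exact h

theorem exists_eq_of_idem {e : D.T} (he : e * e = e) :
    ∃ β X, D.Below β X ∧ e.1 = D.univMonomial β X β := by
  rcases D.univ_isCKRepresentation.idem_form e.2 (congrArg Subtype.val he) with h | h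
  · exact ⟨[], ⊥, Below.nil _, h.trans (D.univ_isCKFamily.monomial_bot [] []).symm⟩
  · exact h

variable (D) in
theorem isEStarUnitary : IsEStarUnitary D.T := by
  intro s e he h0 hse
  obtain ⟨α, X, β, hα, hβ, hs⟩ := exists_eq s
  obtain ⟨γ, Y, hγ, he'⟩ := exists_eq_of_idem he
  have hmul : D.univMonomial α X β * D.univMonomial γ Y γ = e.1 := by
    rw [← hs, ← he']
    exact congrArg Subtype.val hse
  have hαβ : α = β := by
    rcases exists_eq_append_of_mul_idem hα hβ hγ hγ hmul (congrArg Subtype.val he)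
      fun h => h0 (Subtype.ext h) with ⟨ε, hγβ, hγα⟩ | ⟨ε, hβγ, hαγ⟩
    · exact List.append_cancel_right (hγα.symm.trans hγβ)
    · exact hαγ.trans hβγ.symm
  subst hαβ
  refine Subtype.ext ?_
  rw [val_mul, hs, univMonomial, D.univ_isCKFamily.monomial_mul_same α α α X X hα, inf_idem]

variable {A : Type*}

/-- The map from `T` to a ring with a Cuntz–Krieger family that sends `s_α p_X s_β^*` to the
corresponding monomial. It chooses an expression of its argument; that the choice does not matter
is `T.lift_eq`. -/
noncomputable def lift [Mul A] (P : B → A) (S Sd : L → A) (t : D.T) : A :=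
  monomial P S Sd (exists_eq t).choose (exists_eq t).choose_spec.choose
    (exists_eq t).choose_spec.choose_spec.choose

variable [NonUnitalRing A] {P : B → A} {S Sd : L → A}

theorem lift_eq (h : D.IsCKFamily P S Sd) {t : D.T} {α β : List L} {X : B} (hα : D.Below α X)
    (hβ : D.Below β X) (ht : t.1 = D.univMonomial α X β) :
    lift P S Sd t = monomial P S Sd α X β := by
  obtain ⟨hα', hβ', ht'⟩ := (exists_eq t).choose_spec.choose_spec.choose_spec
  exact h.monomial_eq hα' hβ' hα hβ (ht'.symm.trans ht)

theorem lift_zero (h : D.IsCKFamily P S Sd) : lift P S Sd (0 : D.T) = 0 := by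
  rw [lift_eq h (Below.nil ⊥) (Below.nil ⊥) (D.univ_isCKFamily.monomial_bot [] []).symm,
    h.monomial_bot]

theorem lift_mul (h : D.IsCKFamily P S Sd) (s t : D.T) :
    lift P S Sd (s * t) = lift P S Sd s * lift P S Sd t := by
  have hu := D.univ_isCKFamily
  obtain ⟨α, X, β, hα, hβ, hs⟩ := exists_eq s
  obtain ⟨γ, Y, δ, hγ, hδ, ht⟩ := exists_eq t
  have hst : (s * t).1 = D.univMonomial α X β * D.univMonomial γ Y δ := by
    rw [val_mul, hs, ht]
  rw [lift_eq h hα hβ hs, lift_eq h hγ hδ ht]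
  rw [univMonomial, univMonomial] at hst
  by_cases hβγ : β <+: γ
  · obtain ⟨ε, rfl⟩ := hβγ
    rw [hu.monomial_mul_append α β _ ε X Y hγ] at hst
    rw [h.monomial_mul_append α β _ ε X Y hγ]
    exact lift_eq h ((hα.append ε).mono inf_le_left) (hδ.mono inf_le_right) hst
  by_cases hγβ : γ <+: β
  · obtain ⟨ε, rfl⟩ := hγβ
    rw [hu.monomial_append_mul α γ δ ε X Y hγ] at hst
    rw [h.monomial_append_mul α γ δ ε X Y hγ]
    exact lift_eq h (hα.mono inf_le_left) ((hδ.append ε).mono inf_le_right) hst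
  rw [hu.monomial_mul_eq_zero α β γ δ X Y hβ hγ hβγ hγβ] at hst
  rw [h.monomial_mul_eq_zero α β γ δ X Y hβ hγ hβγ hγβ, ← lift_zero h]
  exact congrArg _ (Subtype.ext hst)

end T

end BooleanDynamicalSystem

namespace BooleanDynamicalSystem

section Words

variable {L : Type v} {A : Type*} [NonUnitalRing A]

theorem word_add (S : L → A) (β : List L) (x y : A) :
    word S β (x + y) = word S β x + word S β y := by
  induction β with
  | nil => rfl
  | cons b β ih =>
    change S b * word S β _ = S b * word S β x + S b * word S β y
    rw [ih, mul_add]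

theorem word_sum {ι : Type*} (S : L → A) (β : List L) (F : Finset ι) (f : ι → A) :
    word S β (∑ i ∈ F, f i) = ∑ i ∈ F, word S β (f i) :=
  map_sum (⟨⟨word S β, word_zero S β⟩, word_add S β⟩ : A →+ A) f F

end Words

variable {B : Type u} {L : Type v} [GeneralizedBooleanAlgebra B] {D : BooleanDynamicalSystem B L}

variable (D) in
/-- The condition on words which says that the idempotents `s_δ p_Y s_δ^*`, `(δ, Y) ∈ Z`, cover
`s_β p_X s_β^*`: every nonzero `s_{βγ} p_C s_{βγ}^*` below the latter has a nonzero product with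
one of them. -/
def IsWordCover (β : List L) (X : B) (Z : Set (List L × B)) : Prop :=
  ∀ (γ : List L) (C : B), C ≠ ⊥ → C ≤ D.act γ X → ∃ z ∈ Z,
    (∃ ε, β ++ γ = z.1 ++ ε ∧ C ⊓ D.act ε z.2 ≠ ⊥) ∨
      (∃ ε, z.1 = β ++ γ ++ ε ∧ D.act ε C ⊓ z.2 ≠ ⊥)

namespace IsWordCover

variable {β : List L} {X X' : B} {Z : Set (List L × B)}

theorem mono (hc : D.IsWordCover β X Z) (hX : X' ≤ X) : D.IsWordCover β X' Z :=
  fun γ C hC hCX => hc γ C hC (hCX.trans (D.act_mono γ hX))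

theorem append_singleton (hc : D.IsWordCover β X Z) (a : L) :
    D.IsWordCover (β ++ [a]) (D.θ a X) Z := by
  intro γ C hC hCX
  simpa only [List.append_assoc, List.singleton_append] using hc (a :: γ) C hC hCX

theorem letters_nonempty (hc : D.IsWordCover β X Z)
    (hdisj : ∀ z ∈ Z, ∀ ε, β = z.1 ++ ε → Disjoint X (D.act ε z.2)) (hX : X ≠ ⊥) :
    (D.letters X).Nonempty := by
  obtain ⟨z, hz, ⟨ε, hβ, hne⟩ | ⟨ε, hβ, hne⟩⟩ := hc [] X hX le_rfl
  · rw [List.append_nil] at hβ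
    exact absurd (hdisj z hz ε hβ).eq_bot hne
  rw [List.append_nil] at hβ
  cases ε with
  | nil => exact absurd (hdisj z hz [] (by simpa only [List.append_nil] using hβ.symm)).eq_bot hne
  | cons a ε => exact ⟨a, fun h0 => hne (by rw [act_cons, h0, act_bot, bot_inf_eq])⟩

theorem exists_prefix_of_mem_letters (hc : D.IsWordCover β X Z)
    (hdisj : ∀ z ∈ Z, ∀ ε, β = z.1 ++ ε → Disjoint X (D.act ε z.2)) {a : L}
    (ha : a ∈ D.letters X) : ∃ z ∈ Z, β ++ [a] <+: z.1 := by
  obtain ⟨z, hz, ⟨ε, hβ, hne⟩ | ⟨ε, hβ, -⟩⟩ := hc [a] (D.θ a X) ha le_rfl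
  · rcases List.eq_nil_or_concat ε with rfl | ⟨ε', b, rfl⟩
    · exact ⟨z, hz, by rw [hβ, List.append_nil]⟩
    rw [List.concat_eq_append, ← List.append_assoc] at hβ
    obtain ⟨hβ', hab⟩ := List.append_inj' hβ rfl
    rw [List.concat_eq_append, ← hab, act_append] at hne
    refine absurd ?_ hne
    change D.θ a X ⊓ D.θ a _ = ⊥
    rw [← D.map_inf, (hdisj z hz ε' hβ').eq_bot, D.map_bot]
  · exact ⟨z, hz, ε, hβ.symm⟩

theorem isRegular (hc : D.IsWordCover β X Z) (hZ : Z.Finite)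
    (hdisj : ∀ z ∈ Z, ∀ ε, β = z.1 ++ ε → Disjoint X (D.act ε z.2)) : D.IsRegular X := by
  intro C hC hCX
  have hdisjC : ∀ z ∈ Z, ∀ ε, β = z.1 ++ ε → Disjoint C (D.act ε z.2) :=
    fun z hz ε hβ => (hdisj z hz ε hβ).mono_left hCX
  refine ⟨(hc.mono hCX).letters_nonempty hdisjC hC,
    (hZ.biUnion fun z _ => z.1.finite_toSet).subset fun a ha => ?_⟩
  obtain ⟨z, hz, hpre⟩ := (hc.mono hCX).exists_prefix_of_mem_letters hdisjC ha
  exact Set.mem_biUnion hz (hpre.subset (List.mem_append_right β (List.mem_singleton_self a)))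

end IsWordCover

section Tight

variable {A : Type*} [NonUnitalRing A] {P : B → A} {S Sd : L → A}

namespace IsCKFamily

theorem mul_word_P_eq_zero_of_le (h : D.IsCKFamily P S Sd) {β : List L} {y : A}
    {X Y : B} (hY : y * word S β (P Y) = 0) (hXY : X ≤ Y) : y * word S β (P X) = 0 := by
  have hPX : P X = P Y * P X := by rw [← h.inf, inf_eq_right.2 hXY]
  rw [hPX, ← word_mul, ← mul_assoc, hY, zero_mul]

theorem mul_word_P_eq_zero_of_sdiff (h : D.IsCKFamily P S Sd) {β : List L} {y : A}
    {X Y : B} (hY : y * word S β (P Y) = 0) (hXY : y * word S β (P (X \ Y)) = 0) :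
    y * word S β (P X) = 0 := by
  rw [h.P_sdiff X Y, word_add, mul_add, hXY, h.mul_word_P_eq_zero_of_le hY inf_le_right, add_zero]

theorem mul_word_P_act_eq_zero (h : D.IsCKFamily P S Sd) {β ε : List L} {y : A} {Y : B}
    (hY : y * word S β (P Y) = 0) : y * word S (β ++ ε) (P (D.act ε Y)) = 0 := by
  rw [word_append, ← h.P_mul_self (D.act ε Y), ← h.mul_word, ← word_mul, ← mul_assoc, hY, zero_mul]

theorem exists_act_le_and_mul_word_P_eq_zero (h : D.IsCKFamily P S Sd) {Z : Set (List L × B)}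
    (hZ : Z.Finite) {y : A} (hy : ∀ z ∈ Z, y * word S z.1 (P z.2) = 0) (β : List L) :
    ∃ W, (∀ z ∈ Z, ∀ ε, β = z.1 ++ ε → D.act ε z.2 ≤ W) ∧ y * word S β (P W) = 0 := by
  induction Z, hZ using Set.Finite.induction_on with
  | empty => exact ⟨⊥, fun _ hz => hz.elim, by rw [h.bot, word_zero, mul_zero]⟩
  | @insert z Z _ _ ih =>
    obtain ⟨W, hW, hyW⟩ := ih fun z hz => hy z (Or.inr hz)
    by_cases hz : z.1 <+: β
    · obtain ⟨ε, rfl⟩ := hz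
      have hyz := h.mul_word_P_act_eq_zero (ε := ε) (hy z (Or.inl rfl))
      refine ⟨W ⊔ D.act ε z.2, ?_, h.mul_word_P_eq_zero_of_sdiff hyW
        (h.mul_word_P_eq_zero_of_le hyz (sdiff_le_iff.2 le_rfl))⟩
      rintro z' (rfl | hz') ε' he
      · rw [List.append_cancel_left he]
        exact le_sup_right
      · exact (hW z' hz' ε' he).trans le_sup_left
    · refine ⟨W, ?_, hyW⟩
      rintro z' (rfl | hz') ε' he
      · exact absurd ⟨ε', he.symm⟩ hz
      · exact hW z' hz' ε' he

theorem exists_le_forall_disjoint (h : D.IsCKFamily P S Sd) {Z : Set (List L × B)}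
    (hZ : Z.Finite) {y : A} (hy : ∀ z ∈ Z, y * word S z.1 (P z.2) = 0) (β : List L) (X : B) :
    ∃ X' ≤ X, (∀ z ∈ Z, ∀ ε, β = z.1 ++ ε → Disjoint X' (D.act ε z.2)) ∧
      (y * word S β (P X') = 0 → y * word S β (P X) = 0) := by
  obtain ⟨W, hW, hyW⟩ := h.exists_act_le_and_mul_word_P_eq_zero hZ hy β
  exact ⟨X \ W, sdiff_le,
    fun z hz ε he => disjoint_sdiff_self_left.mono_right (hW z hz ε he),
    h.mul_word_P_eq_zero_of_sdiff hyW⟩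

/-- Removing from `X` what is annihilated because of a prefix of `β` in `Z` leaves a regular set, to
which the last Cuntz–Krieger relation applies. That relation makes `β` longer, and no letter can
follow once `β` is as long as the words in `Z`. -/
theorem mul_word_P_eq_zero_of_cover (h : D.IsCKFamily P S Sd) {Z : Set (List L × B)}
    (hZ : Z.Finite) {y : A} (hy : ∀ z ∈ Z, y * word S z.1 (P z.2) = 0) (n : ℕ) {β : List L} {X : B}
    (hlen : ∀ z ∈ Z, z.1.length ≤ β.length + n) (hc : D.IsWordCover β X Z) :
    y * word S β (P X) = 0 := by
  induction n generalizing β X with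
  | zero =>
    obtain ⟨X', hX', hdisj, h0⟩ := h.exists_le_forall_disjoint hZ hy β X
    suffices hbot : X' = ⊥ from h0 (by rw [hbot, h.bot, word_zero, mul_zero])
    by_contra hne
    obtain ⟨a, ha⟩ := (hc.mono hX').letters_nonempty hdisj hne
    obtain ⟨z, hz, hpre⟩ := (hc.mono hX').exists_prefix_of_mem_letters hdisj ha
    have hlt := hpre.length_le.trans (hlen z hz)
    rw [List.length_append, List.length_singleton] at hlt
    omega
  | succ n ih =>
    obtain ⟨X', hX', hdisj, h0⟩ := h.exists_le_forall_disjoint hZ hy β X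
    refine h0 ?_
    by_cases hne : X' = ⊥
    · rw [hne, h.bot, word_zero, mul_zero]
    have hreg := (hc.mono hX').isRegular hZ hdisj
    have hfin := (hreg X' hne le_rfl).2
    rw [h.regular X' hreg hfin.toFinset hfin.coe_toFinset, word_sum, Finset.mul_sum]
    refine Finset.sum_eq_zero fun a _ => ?_
    have hlen' : ∀ z ∈ Z, z.1.length ≤ (β ++ [a]).length + n := fun z hz => by
      rw [List.length_append, List.length_singleton, add_right_comm, add_assoc]
      exact hlen z hz
    have hya := ih hlen' ((hc.mono hX').append_singleton a)
    rw [word_append] at hya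
    change y * word S β (S a * P (D.θ a X')) = 0 at hya
    rw [← word_mul, ← mul_assoc, hya, zero_mul]

end IsCKFamily

end Tight

namespace T

theorem isWordCover_of_isFiniteCover {ι : D.T → List L} {V : D.T → B} {Z : Set D.T} {e : D.T}
    (hc : IsFiniteCover Z e) {β : List L} {X : B} (hβ : D.Below β X)
    (he : e.1 = D.univMonomial β X β) (hι : ∀ z ∈ Z, D.Below (ι z) (V z))
    (hV : ∀ z ∈ Z, z.1 = D.univMonomial (ι z) (V z) (ι z)) :
    D.IsWordCover β X ((fun z => (ι z, V z)) '' Z) := by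
  have hu := D.univ_isCKFamily
  intro γ C hC hCX
  have hC' : D.Below (β ++ γ) C := (hβ.append γ).mono hCX
  let f : D.T := ⟨D.univMonomial (β ++ γ) C (β ++ γ), Or.inr ⟨_, _, _, hC', hC', rfl⟩⟩
  have hf : f * f = f := Subtype.ext <| by
    rw [val_mul]
    exact (hu.monomial_mul_same _ _ _ _ _ hC').trans (by rw [inf_idem]; rfl)
  have hfe : f * e = f := Subtype.ext <| by
    rw [val_mul, he]
    exact (hu.monomial_append_mul _ β β γ C X hβ).trans (by rw [inf_eq_left.2 hCX]; rfl)
  have hf0 : f ≠ 0 := fun h0 =>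
    hC ((univMonomial_eq_zero_iff hC' hC').1 (congrArg Subtype.val h0))
  obtain ⟨z, hz, hfz⟩ := hc.exists_mul_ne_zero f hf hfe hf0
  have hιz := hι z hz
  have hfz' : monomial D.univP D.univS (fun a => star (D.univS a)) (β ++ γ) C (β ++ γ) *
      monomial D.univP D.univS (fun a => star (D.univS a)) (ι z) (V z) (ι z) ≠ 0 :=
    fun h0 => hfz (Subtype.ext (by rw [val_mul, hV z hz]; exact h0))
  refine ⟨_, ⟨z, hz, rfl⟩, ?_⟩
  by_cases hpre : β ++ γ <+: ι z
  · obtain ⟨ε, hε⟩ := hpre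
    refine Or.inr ⟨ε, hε.symm, fun h0 => hfz' ?_⟩
    rw [← hε] at hιz ⊢
    rw [hu.monomial_mul_append _ _ _ ε C _ hιz, h0, hu.monomial_bot]
  by_cases hpre' : ι z <+: β ++ γ
  · obtain ⟨ε, hε⟩ := hpre'
    refine Or.inl ⟨ε, hε.symm, fun h0 => hfz' ?_⟩
    rw [← hε, hu.monomial_append_mul _ _ _ ε C _ hιz, h0, hu.monomial_bot]
  exact absurd (hu.monomial_mul_eq_zero _ _ _ _ _ _ hC' hιz hpre hpre') hfz'

theorem isTightRepresentation_lift {A : Type*} [Ring A] {P : B → A} {S Sd : L → A}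
    (h : D.IsCKFamily P S Sd) : IsTightRepresentation (lift (D := D) P S Sd) where
  map_zero := lift_zero h
  map_idem_mul e f _ _ := lift_mul h e f
  map_mul := lift_mul h
  mul_eq_zero_of_cover e he Z hc y hy := by
    obtain ⟨β, X, hβ, heX⟩ := exists_eq_of_idem he
    choose! ι V hι hV using fun z hz => exists_eq_of_idem (hc.idem z hz)
    obtain ⟨N, hN⟩ := (hc.finite.image fun z => (ι z).length).bddAbove
    have hyZ : ∀ z ∈ Z, y * word S (ι z) (P (V z)) = 0 := fun z hz => by
      have hyz := congrArg (· * monomial P S Sd (ι z) (V z) []) (hy z hz)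
      rw [lift_eq h (hι z hz) (hι z hz) (hV z hz)] at hyz
      simp only [zero_mul] at hyz
      rwa [mul_assoc, h.monomial_mul_same _ _ _ _ _ (hι z hz), inf_idem] at hyz
    have hyX : y * word S β (P X) = 0 :=
      h.mul_word_P_eq_zero_of_cover (hc.finite.image fun z => (ι z, V z))
        (Set.forall_mem_image.2 hyZ) N
        (Set.forall_mem_image.2 fun z hz => (hN ⟨z, hz, rfl⟩).trans (Nat.le_add_left _ _))
        (isWordCover_of_isFiniteCover hc hβ heX hι hV)
    rw [lift_eq h hβ hβ heX, monomial, word_wordStar, mul_wordStar, hyX, wordStar_zero]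

end T

namespace IsCKFamily

variable {A A' : Type*} [NonUnitalRing A] [NonUnitalRing A'] {P : B → A} {S Sd : L → A}

theorem map (h : D.IsCKFamily P S Sd) (f : A →ₙ+* A') :
    D.IsCKFamily (fun X => f (P X)) (fun a => f (S a)) (fun a => f (Sd a)) where
  bot := by rw [h.bot, map_zero]
  inf X Y := by rw [h.inf, map_mul]
  sup X Y := by rw [h.sup, map_sub, map_add]
  isometry_left a := by rw [← map_mul, ← map_mul, h.isometry_left]
  isometry_right a := by rw [← map_mul, ← map_mul, h.isometry_right]
  comm_left a X := by rw [← map_mul, h.comm_left, map_mul]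
  comm_right a X := by rw [← map_mul, h.comm_right, map_mul]
  source a := by rw [← map_mul, h.source]
  orthogonal a b hab := by rw [← map_mul, h.orthogonal a b hab, map_zero]
  regular X hX F hF := by
    rw [h.regular X hX F hF, map_sum]
    simp only [map_mul]

theorem S_eq_monomial (h : D.IsCKFamily P S Sd) (a : L) :
    S a = monomial P S Sd [a] (D.rng [a]) [] := by
  change S a = S a * P (D.rng [a])
  rw [← h.source, ← mul_assoc, h.isometry_left]

theorem Sd_eq_monomial (h : D.IsCKFamily P S Sd) (a : L) :
    Sd a = monomial P S Sd [] (D.rng [a]) [a] := by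
  change Sd a = P (D.rng [a]) * Sd a
  rw [← h.source, h.isometry_right]

end IsCKFamily

variable (D) in
/-- The idempotent `s_a p_X s_a^*` of `T`, as it occurs in the last Cuntz–Krieger relation. -/
noncomputable def qT (a : L) (X : B) : D.T := D.sT a * D.pT X * star (D.sT a)

namespace T

theorem star_sT_mul_sT (a : L) : star (D.sT a) * D.sT a = D.pT (D.rng [a]) :=
  Subtype.ext (D.univ_isCKFamily.source a)

theorem pT_inf (X Y : B) : D.pT (X ⊓ Y) = D.pT X * D.pT Y :=
  Subtype.ext (D.univ_isCKFamily.inf X Y)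

theorem pT_bot : D.pT ⊥ = 0 := Subtype.ext D.univ_isCKFamily.bot

theorem pT_idem (X : B) : D.pT X * D.pT X = D.pT X := by rw [← pT_inf, inf_idem]

theorem eq_monomial {t : D.T} {α β : List L} {X : B} (ht : t.1 = D.univMonomial α X β) :
    t = monomial D.pT D.sT (fun a => star (D.sT a)) α X β :=
  Subtype.ext (ht.trans (map_monomial (A := D.T) (fun t : D.T => t.1) (fun _ _ => rfl)
    D.pT D.sT (fun a => star (D.sT a)) α β X).symm)

theorem qT_idem (a : L) (X : B) : D.qT a X * D.qT a X = D.qT a X :=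
  conj_idem_star (D.sT a) (pT_idem X)

theorem qT_mul_qT_eq_zero {a b : L} (hab : a ≠ b) (X Y : B) : D.qT a X * D.qT b Y = 0 :=
  Subtype.ext <|
    calc D.univS a * D.univP X * star (D.univS a) * (D.univS b * D.univP Y * star (D.univS b))
        = D.univS a * D.univP X * (star (D.univS a) * D.univS b) * D.univP Y *
          star (D.univS b) := by simp only [mul_assoc]
      _ = 0 := by rw [D.univ_isCKFamily.orthogonal a b hab, mul_zero, zero_mul, zero_mul]

theorem qT_mul_pT (a : L) (X : B) : D.qT a (D.θ a X) * D.pT X = D.qT a (D.θ a X) := by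
  have hu := D.univ_isCKFamily
  refine Subtype.ext ?_
  change D.univS a * D.univP (D.θ a X) * star (D.univS a) * D.univP X =
    D.univS a * D.univP (D.θ a X) * star (D.univS a)
  rw [mul_assoc, hu.comm_right, ← mul_assoc, mul_assoc (D.univS a), hu.P_mul_self]

theorem isFiniteCover_of_mul_eq_zero {Z : Set D.T} (hZ : Z.Finite) (hidem : ∀ z ∈ Z, z * z = z)
    {e : D.T} (h : ∀ x : D.UniversalCStarAlgebra, (∀ z ∈ Z, x * z.1 = 0) → x * e.1 = 0) :
    IsFiniteCover Z e := by
  refine ⟨hZ, hidem, fun f _ hfe hf0 => ?_⟩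
  by_contra! hfZ
  refine hf0 (hfe.symm.trans (Subtype.ext ?_))
  exact h f.1 fun z hz => congrArg Subtype.val (hfZ z hz)

theorem isFiniteCover_sup (X Y : B) : IsFiniteCover {D.pT X, D.pT Y} (D.pT (X ⊔ Y)) := by
  refine isFiniteCover_of_mul_eq_zero (Set.toFinite _)
    (by rintro _ (rfl | rfl) <;> exact pT_idem _) fun x hx => ?_
  have hX : x * D.univP X = 0 := hx _ (Or.inl rfl)
  have hY : x * D.univP Y = 0 := hx _ (Or.inr rfl)
  change x * D.univP (X ⊔ Y) = 0
  rw [D.univ_isCKFamily.sup, D.univ_isCKFamily.inf, mul_sub, mul_add, hX, hY, ← mul_assoc, hX,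
    zero_mul, add_zero, sub_zero]

theorem isFiniteCover_of_isRegular {X : B} (hX : D.IsRegular X) {F : Finset L}
    (hF : (F : Set L) = D.letters X) :
    IsFiniteCover ((fun a => D.qT a (D.θ a X)) '' F) (D.pT X) := by
  refine isFiniteCover_of_mul_eq_zero (F.finite_toSet.image _)
    (Set.forall_mem_image.2 fun a _ => qT_idem a _) fun x hx => ?_
  change x * D.univP X = 0
  rw [D.univ_isCKFamily.regular X hX F hF, Finset.mul_sum]
  exact Finset.sum_eq_zero fun a ha => hx _ ⟨a, ha, rfl⟩

theorem pT_sup_mem_iff (ξ : TightFilter D.T) (X Y : B) :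
    D.pT (X ⊔ Y) ∈ ξ.carrier ↔ D.pT X ∈ ξ.carrier ∨ D.pT Y ∈ ξ.carrier := by
  have hmono : ∀ {X Y : B}, X ≤ Y → D.pT X ∈ ξ.carrier → D.pT Y ∈ ξ.carrier := fun hXY hX =>
    ξ.upward _ hX _ (pT_idem _) (by rw [← pT_inf, inf_eq_left.2 hXY])
  refine ⟨fun h => ?_, fun h => h.elim (hmono le_sup_left) (hmono le_sup_right)⟩
  obtain ⟨z, rfl | rfl, hz⟩ := ξ.exists_mem_of_isFiniteCover h (isFiniteCover_sup X Y)
  exacts [Or.inl hz, Or.inr hz]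

theorem pT_mem_iff_of_isRegular (ξ : TightFilter D.T) {X : B} (hX : D.IsRegular X) {F : Finset L}
    (hF : (F : Set L) = D.letters X) :
    D.pT X ∈ ξ.carrier ↔ ∃ a ∈ F, D.qT a (D.θ a X) ∈ ξ.carrier := by
  constructor
  · intro h
    obtain ⟨_, ⟨a, ha, rfl⟩, hz⟩ :=
      ξ.exists_mem_of_isFiniteCover h (isFiniteCover_of_isRegular hX hF)
    exact ⟨a, ha, hz⟩
  · rintro ⟨a, -, h⟩
    exact ξ.upward _ h _ (pT_idem X) (qT_mul_pT a X)

theorem eq_of_qT_mem (ξ : TightFilter D.T) {a b : L} {X Y : B} (ha : D.qT a X ∈ ξ.carrier)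
    (hb : D.qT b Y ∈ ξ.carrier) : a = b := by
  by_contra hab
  have hab0 := ξ.mul_mem _ ha _ hb
  rw [qT_mul_qT_eq_zero hab] at hab0
  exact ξ.zero_notMem hab0

end T

open TightGroupoid

section LeftRegular

variable (R : Type w) [CommRing R]

theorem leftRegular_pT_sup (X Y : B) :
    leftRegular R (D.pT (X ⊔ Y)) =
      leftRegular R (D.pT X) + leftRegular R (D.pT Y) - leftRegular R (D.pT (X ⊓ Y)) := by
  refine LinearMap.ext fun g => funext fun c => ?_
  change leftRegular R _ g c =
    leftRegular R _ g c + leftRegular R _ g c - leftRegular R _ g c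
  rw [leftRegular_idem_apply (T.pT_idem _), leftRegular_idem_apply (T.pT_idem _),
    leftRegular_idem_apply (T.pT_idem _), leftRegular_idem_apply (T.pT_idem _), T.pT_inf,
    TightFilter.mul_mem_iff _ (T.pT_idem _) (T.pT_idem _), T.pT_sup_mem_iff]
  by_cases hX : D.pT X ∈ (range c).carrier <;> by_cases hY : D.pT Y ∈ (range c).carrier <;>
    simp [hX, hY]

theorem leftRegular_pT_of_isRegular {X : B} (hX : D.IsRegular X) {F : Finset L}
    (hF : (F : Set L) = D.letters X) :
    leftRegular R (D.pT X) = ∑ a ∈ F, leftRegular R (D.qT a (D.θ a X)) := by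
  refine LinearMap.ext fun g => funext fun c => ?_
  rw [LinearMap.sum_apply, Finset.sum_apply]
  simp only [leftRegular_idem_apply (T.qT_idem _ _), leftRegular_idem_apply (T.pT_idem _)]
  rw [T.pT_mem_iff_of_isRegular _ hX hF]
  by_cases h : ∃ a ∈ F, D.qT a (D.θ a X) ∈ (range c).carrier
  · rw [if_pos h]
    obtain ⟨a, ha, hac⟩ := h
    rw [Finset.sum_eq_single a, if_pos hac]
    · exact fun b _ hba => if_neg fun hbc => hba (T.eq_of_qT_mem _ hbc hac)
    · exact fun haF => absurd ha haF
  · rw [if_neg h, Finset.sum_eq_zero]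
    exact fun a ha => if_neg fun hac => h ⟨a, ha, hac⟩

variable (D) in
theorem leftRegular_isCKFamily : D.IsCKFamily (fun X => leftRegular R (D.pT X))
    (fun a => leftRegular R (D.sT a)) (fun a => leftRegular R (star (D.sT a))) where
  bot := by rw [T.pT_bot, leftRegular_zero]
  inf X Y := by rw [T.pT_inf, leftRegular_mul]
  sup := leftRegular_pT_sup R
  isometry_left a := by rw [← leftRegular_mul, ← leftRegular_mul, mul_star_mul]
  isometry_right a := by rw [← leftRegular_mul, ← leftRegular_mul, star_mul_self_mul_star]
  comm_left a X := by
    rw [← leftRegular_mul, ← leftRegular_mul]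
    exact congrArg _ (Subtype.ext (D.univ_isCKFamily.comm_left a X))
  comm_right a X := by
    rw [← leftRegular_mul, ← leftRegular_mul]
    exact congrArg _ (Subtype.ext (D.univ_isCKFamily.comm_right a X))
  source a := by rw [← leftRegular_mul, T.star_sT_mul_sT]
  orthogonal a b hab := by
    rw [← leftRegular_mul, ← leftRegular_zero]
    exact congrArg _ (Subtype.ext (D.univ_isCKFamily.orthogonal a b hab))
  regular X hX F hF := by
    simp only [← leftRegular_mul]
    exact leftRegular_pT_of_isRegular R hX hF

end LeftRegular

end BooleanDynamicalSystem

namespace BooleanDynamicalSystem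

variable {B : Type u} {L : Type v} [GeneralizedBooleanAlgebra B] (D : BooleanDynamicalSystem B L)

open TightGroupoid

variable (R : Type w) [CommRing R]

section Alg

variable {D R}

theorem alg_induction {p : D.alg R → Prop} (hp : ∀ X, p (D.pR R X)) (hs : ∀ a, p (D.sR R a))
    (hsd : ∀ a, p (D.sdR R a)) (hadd : ∀ x y, p x → p y → p (x + y)) (hzero : p 0)
    (hmul : ∀ x y, p x → p y → p (x * y)) (hsmul : ∀ (r : R) x, p x → p (r • x)) (x : D.alg R) :
    p x := by
  obtain ⟨x, hx⟩ := x
  refine NonUnitalAlgebra.adjoin_induction (R := R) (p := fun x hx => p ⟨x, hx⟩) ?_ ?_ ?_ ?_ ?_ hx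
  · rintro _ ⟨g, rfl⟩
    cases g with
    | p X => exact hp X
    | s a => exact hs a
    | sd a => exact hsd a
  · exact fun x y hx hy => hadd ⟨x, hx⟩ ⟨y, hy⟩
  · exact hzero
  · exact fun x y hx hy => hmul ⟨x, hx⟩ ⟨y, hy⟩
  · exact fun r x hx => hsmul r ⟨x, hx⟩

theorem alg_linearMap_ext {M : Type*} [NonUnitalNonAssocSemiring M] [Module R M]
    {φ ψ : D.alg R →ₗ[R] M} (hφ : ∀ x y, φ (x * y) = φ x * φ y) (hψ : ∀ x y, ψ (x * y) = ψ x * ψ y)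
    (hp : ∀ X, φ (D.pR R X) = ψ (D.pR R X)) (hs : ∀ a, φ (D.sR R a) = ψ (D.sR R a))
    (hsd : ∀ a, φ (D.sdR R a) = ψ (D.sdR R a)) : φ = ψ :=
  LinearMap.ext <| alg_induction hp hs hsd
    (fun x y hx hy => by rw [map_add, map_add, hx, hy]) (by rw [map_zero, map_zero])
    (fun x y hx hy => by rw [hφ, hψ, hx, hy]) (fun r x hx => by rw [map_smul, map_smul, hx])

end Alg

/-- The map from `T` to `R(B, L, θ)` that sends `s_α p_X s_β^*` to the element with that name. -/
noncomputable def ofT (t : D.T) : D.alg R := T.lift (D.pR R) (D.sR R) (D.sdR R) t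

theorem ofT_mul (s t : D.T) : D.ofT R (s * t) = D.ofT R s * D.ofT R t :=
  T.lift_mul (D.alg_isCKFamily R) s t

theorem ofT_pT (X : B) : D.ofT R (D.pT X) = D.pR R X :=
  T.lift_eq (D.alg_isCKFamily R) (Below.nil X) (Below.nil X) rfl

theorem ofT_sT (a : L) : D.ofT R (D.sT a) = D.sR R a :=
  (T.lift_eq (D.alg_isCKFamily R) (fun _ => le_rfl) (Below.nil _)
    (D.univ_isCKFamily.S_eq_monomial a)).trans ((D.alg_isCKFamily R).S_eq_monomial a).symm

theorem ofT_star_sT (a : L) : D.ofT R (star (D.sT a)) = D.sdR R a :=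
  (T.lift_eq (D.alg_isCKFamily R) (Below.nil _) (fun _ => le_rfl)
    (D.univ_isCKFamily.Sd_eq_monomial a)).trans ((D.alg_isCKFamily R).Sd_eq_monomial a).symm

theorem span_range_ofT : Submodule.span R (Set.range (D.ofT R)) = ⊤ := by
  refine Submodule.eq_top_iff'.2 (alg_induction
    (fun X => Submodule.subset_span ⟨_, D.ofT_pT R X⟩)
    (fun a => Submodule.subset_span ⟨_, D.ofT_sT R a⟩)
    (fun a => Submodule.subset_span ⟨_, D.ofT_star_sT R a⟩)
    (fun x y => add_mem) (zero_mem _) (fun x y hx hy => ?_)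
    (fun r x => Submodule.smul_mem _ r))
  induction hx, hy using Submodule.span_induction₂ with
  | mem_mem x y hx hy =>
    obtain ⟨s, rfl⟩ := hx
    obtain ⟨t, rfl⟩ := hy
    exact Submodule.subset_span ⟨s * t, D.ofT_mul R s t⟩
  | zero_left y hy => rw [zero_mul]; exact zero_mem _
  | zero_right x hx => rw [mul_zero]; exact zero_mem _
  | add_left x y z _ _ _ hxz hyz => rw [add_mul]; exact add_mem hxz hyz
  | add_right x y z _ _ _ hxy hxz => rw [mul_add]; exact add_mem hxy hxz
  | smul_left r x y _ _ hxy => rw [smul_mul_assoc]; exact Submodule.smul_mem _ r hxy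
  | smul_right r x y _ _ hxy => rw [mul_smul_comm]; exact Submodule.smul_mem _ r hxy

theorem range_linearCombination_ofT :
    LinearMap.range (Finsupp.linearCombination R (D.ofT R)) = ⊤ := by
  rw [Finsupp.range_linearCombination, span_range_ofT]

theorem isTightRepresentation_ofT :
    IsTightRepresentation fun t : D.T => (D.ofT R t : RingQuot (D.Rel R)) := by
  let ι : D.alg R →ₙₐ[R] RingQuot (D.Rel R) := NonUnitalSubalgebraClass.subtype (D.alg R)
  have hlift : (fun t => ι (D.ofT R t)) = T.lift (fun X => ι (D.pR R X)) (fun a => ι (D.sR R a))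
      (fun a => ι (D.sdR R a)) :=
    funext fun t => map_monomial ι (map_mul ι) _ _ _ _ _ _
  change IsTightRepresentation fun t => ι (D.ofT R t)
  rw [hlift]
  exact T.isTightRepresentation_lift
    ((D.alg_isCKFamily R).map (ι : D.alg R →ₙ+* RingQuot (D.Rel R)))

theorem linearCombination_ofT_eq_zero {c : D.T →₀ R} (hc : bisectionSum D.T R c = 0) :
    Finsupp.linearCombination R (D.ofT R) c = 0 := by
  let ι : D.alg R →ₙₐ[R] RingQuot (D.Rel R) := NonUnitalSubalgebraClass.subtype (D.alg R)
  refine Subtype.ext (Eq.trans ?_ ((D.isTightRepresentation_ofT R).linearCombination_eq_zero hc))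
  exact Finsupp.apply_linearCombination R (ι : D.alg R →ₗ[R] RingQuot (D.Rel R)) (D.ofT R) c

/-- The representation of `R(B, L, θ)` on the functions on the tight groupoid of `T` that extends
the left regular representation of `T`. -/
noncomputable def regularRepresentation : D.alg R →ₙₐ[R] Module.End R (TightGroupoid D.T → R) :=
  (D.existsUnique_lift R (D.leftRegular_isCKFamily R)).choose

theorem regularRepresentation_pR (X : B) :
    D.regularRepresentation R (D.pR R X) = leftRegular R (D.pT X) :=
  (D.existsUnique_lift R (D.leftRegular_isCKFamily R)).choose_spec.1.1 X

theorem regularRepresentation_sR (a : L) :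
    D.regularRepresentation R (D.sR R a) = leftRegular R (D.sT a) :=
  (D.existsUnique_lift R (D.leftRegular_isCKFamily R)).choose_spec.1.2.1 a

theorem regularRepresentation_sdR (a : L) :
    D.regularRepresentation R (D.sdR R a) = leftRegular R (star (D.sT a)) :=
  (D.existsUnique_lift R (D.leftRegular_isCKFamily R)).choose_spec.1.2.2 a

theorem regularRepresentation_ofT (t : D.T) :
    D.regularRepresentation R (D.ofT R t) = leftRegular R t := by
  obtain ⟨α, X, β, hα, hβ, ht⟩ := T.exists_eq t
  rw [ofT, T.lift_eq (D.alg_isCKFamily R) hα hβ ht,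
    map_monomial (D.regularRepresentation R) (map_mul _)]
  simp only [regularRepresentation_pR, regularRepresentation_sR, regularRepresentation_sdR]
  conv_rhs => rw [T.eq_monomial ht]
  exact (map_monomial (leftRegular R) leftRegular_mul D.pT D.sT _ α β X).symm

/-- The map from `R(B, L, θ)` to the functions on the tight groupoid of `T` that evaluates the
regular representation at the characteristic function of the unit space, the identity of the
convolution product. -/
noncomputable def toFunction : D.alg R →ₗ[R] (TightGroupoid D.T → R) :=
  LinearMap.applyₗ ((units D.T).indicator 1) ∘ₗ
    (D.regularRepresentation R : D.alg R →ₗ[R] Module.End R (TightGroupoid D.T → R))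

theorem toFunction_ofT (t : D.T) : D.toFunction R (D.ofT R t) = (bisection t).indicator 1 := by
  change D.regularRepresentation R _ _ = _
  rw [regularRepresentation_ofT, leftRegular_indicator_units]

theorem toFunction_linearCombination_ofT (c : D.T →₀ R) :
    D.toFunction R (Finsupp.linearCombination R (D.ofT R) c) = bisectionSum D.T R c := by
  rw [Finsupp.apply_linearCombination, bisectionSum]
  exact congrArg (Finsupp.linearCombination R · c) (funext (D.toFunction_ofT R))

theorem range_toFunction : LinearMap.range (D.toFunction R) = SteinbergAlgebra R D.T := by
  rw [← range_bisectionSum (T.isEStarUnitary D),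
    ← LinearMap.range_comp_of_range_eq_top _ (D.range_linearCombination_ofT R)]
  exact congrArg LinearMap.range (LinearMap.ext (D.toFunction_linearCombination_ofT R))

theorem regularRepresentation_apply (x : D.alg R) (g : TightGroupoid D.T → R) :
    D.regularRepresentation R x g = convolution (D.toFunction R x) g := by
  obtain ⟨c, rfl⟩ := LinearMap.range_eq_top.1 (D.range_linearCombination_ofT R) x
  rw [toFunction_linearCombination_ofT, convolution_bisectionSum]
  have h := Finsupp.apply_linearCombination R
    (D.regularRepresentation R : D.alg R →ₗ[R] Module.End R (TightGroupoid D.T → R)) (D.ofT R) c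
  exact LinearMap.congr_fun (h.trans (congrArg (Finsupp.linearCombination R · c)
    (funext (D.regularRepresentation_ofT R)))) g

theorem toFunction_mul (x y : D.alg R) :
    D.toFunction R (x * y) = convolution (D.toFunction R x) (D.toFunction R y) := by
  rw [← regularRepresentation_apply]
  change D.regularRepresentation R (x * y) _ = _
  rw [map_mul]
  rfl

theorem toFunction_injective : Function.Injective (D.toFunction R) := by
  rw [injective_iff_map_eq_zero]
  intro x hx
  obtain ⟨c, rfl⟩ := LinearMap.range_eq_top.1 (D.range_linearCombination_ofT R) x
  exact D.linearCombination_ofT_eq_zero R ((D.toFunction_linearCombination_ofT R c).symm.trans hx)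

/-- The isomorphism of `R(B, L, θ)` with the Steinberg algebra, the inverse of the `τ` of the
theorem. It is only bundled as a linear map, as the Steinberg algebra is only bundled as a module;
its multiplicativity is `toFunction_mul`. -/
noncomputable def toSteinbergAlgebra : D.alg R ≃ₗ[R] SteinbergAlgebra R D.T :=
  (LinearEquiv.ofInjective (D.toFunction R) (D.toFunction_injective R)).trans
    (LinearEquiv.ofEq _ _ (D.range_toFunction R))

theorem coe_toSteinbergAlgebra (x : D.alg R) :
    (D.toSteinbergAlgebra R x : TightGroupoid D.T → R) = D.toFunction R x := rfl

theorem coe_toSteinbergAlgebra_pR (X : B) :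
    (D.toSteinbergAlgebra R (D.pR R X) : TightGroupoid D.T → R) =
      (Θ (D.pT X) (TightFilter.dom (D.pT X))).indicator 1 := by
  rw [coe_toSteinbergAlgebra, ← ofT_pT, toFunction_ofT, bisection,
    idem_star_eq (T.pT_idem X), T.pT_idem]

theorem coe_toSteinbergAlgebra_sR (a : L) :
    (D.toSteinbergAlgebra R (D.sR R a) : TightGroupoid D.T → R) =
      (Θ (D.sT a) (TightFilter.dom (star (D.sT a) * D.sT a))).indicator 1 := by
  rw [coe_toSteinbergAlgebra, ← ofT_sT, toFunction_ofT, bisection]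

theorem coe_toSteinbergAlgebra_sdR (a : L) :
    (D.toSteinbergAlgebra R (D.sdR R a) : TightGroupoid D.T → R) =
      (Θ (star (D.sT a)) (TightFilter.dom (D.sT a * star (D.sT a)))).indicator 1 := by
  rw [coe_toSteinbergAlgebra, ← ofT_star_sT, toFunction_ofT, bisection, star_star]

end BooleanDynamicalSystem

theorem theorem7p1 {B : Type u} {L : Type v} [GeneralizedBooleanAlgebra B]
    (D : BooleanDynamicalSystem B L) (R : Type w) [CommRing R] :
    ∃! τ : SteinbergAlgebra R D.T ≃ₗ[R] D.alg R,
      (∀ f g : SteinbergAlgebra R D.T, ∃ h : SteinbergAlgebra R D.T,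
        (h : TightGroupoid D.T → R) = convolution (f : TightGroupoid D.T → R) g ∧
          τ h = τ f * τ g) ∧
      (∀ a : L, ∃ f : SteinbergAlgebra R D.T,
        (f : TightGroupoid D.T → R) = Set.indicator
          (TightGroupoid.Θ (D.sT a) (TightFilter.dom (star (D.sT a) * D.sT a))) 1 ∧
          τ f = D.sR R a) ∧
      (∀ a : L, ∃ f : SteinbergAlgebra R D.T,
        (f : TightGroupoid D.T → R) = Set.indicator
          (TightGroupoid.Θ (star (D.sT a)) (TightFilter.dom (D.sT a * star (D.sT a)))) 1 ∧
          τ f = D.sdR R a) ∧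
      (∀ X : B, ∃ f : SteinbergAlgebra R D.T,
        (f : TightGroupoid D.T → R) = Set.indicator
          (TightGroupoid.Θ (D.pT X) (TightFilter.dom (D.pT X))) 1 ∧
          τ f = D.pR R X) := by
  let Φ := D.toSteinbergAlgebra R
  have hmul : ∀ x y, (Φ (x * y) : TightGroupoid D.T → R) = convolution (Φ x) (Φ y) :=
    D.toFunction_mul R
  refine ⟨Φ.symm, ⟨fun f g => ⟨Φ (Φ.symm f * Φ.symm g), ?_, Φ.symm_apply_apply _⟩,
    fun a => ⟨_, D.coe_toSteinbergAlgebra_sR R a, Φ.symm_apply_apply _⟩,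
    fun a => ⟨_, D.coe_toSteinbergAlgebra_sdR R a, Φ.symm_apply_apply _⟩,
    fun X => ⟨_, D.coe_toSteinbergAlgebra_pR R X, Φ.symm_apply_apply _⟩⟩, ?_⟩
  · rw [hmul, Φ.apply_symm_apply, Φ.apply_symm_apply]
  rintro τ ⟨hτmul, hτs, hτsd, hτp⟩
  have map_eq {g : TightGroupoid D.T → R} {x y : D.alg R} (hx : (Φ x : TightGroupoid D.T → R) = g) :
      (∃ f : SteinbergAlgebra R D.T, (f : TightGroupoid D.T → R) = g ∧ τ f = y) → τ (Φ x) = y :=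
    fun ⟨_, hf, hfy⟩ => (congrArg τ (Subtype.ext (hx.trans hf.symm))).trans hfy
  have hτΦ : τ.toLinearMap ∘ₗ Φ.toLinearMap = LinearMap.id :=
    BooleanDynamicalSystem.alg_linearMap_ext
      (fun x y => map_eq (hmul x y) (hτmul (Φ x) (Φ y))) (fun _ _ => rfl)
      (fun X => map_eq (D.coe_toSteinbergAlgebra_pR R X) (hτp X))
      (fun a => map_eq (D.coe_toSteinbergAlgebra_sR R a) (hτs a))
      (fun a => map_eq (D.coe_toSteinbergAlgebra_sdR R a) (hτsd a))
  exact LinearEquiv.ext fun f =>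
    (congrArg τ (Φ.apply_symm_apply f).symm).trans (LinearMap.congr_fun hτΦ (Φ.symm f))
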